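/- \textbf{Setting.} Let $(M,\mathbf g)$ be an asymptotically flat (AF) toric gravitational instanton: a complete, simply connected, Ricci-flat Riemannian $4$-manifold with an isometric effective action of $T=U(1)^2$ that has at least one fixed point and no nontrivial discrete isotropy groups, such that the complement of some compact set is diffeomorphic to the quotient $[\mathbb R\times\{x\in\mathbb R^3:|x|>R\}]/\mathbb Z$ generated by $(\tau,r,\theta,\phi)\mapsto(\tau+\beta,r,\theta,\phi+\beta\Omega)$, where $\beta>0$ and $\Omega$ are constants; $\partial_\tau,\partial_\phi$ generate the torus action there, and on the end $$\mathbf g=V(d\tau+\omega\,d\phi)^2+V^{-1}r^2\sin^2\theta\,d\phi^2+e^{2\nu}(dr^2+r^2d\theta^2),$$ with $V-1,\ \omega,\ \nu=O_2(r^{-1})$ as $r\to\infty$ (cartesian derivatives of order $k\le 2$ are $O(r^{-1-k})$). Use the $2\pi$-periodic generators $\partial_\psi=\tfrac{\beta}{2\pi}(\partial_\tau+\Omega\partial_\phi)$ and $\partial_\chi=\partial_\phi$ of the torus action. Let $\rho\ge 0$ be the square root of the determinant of the Gram matrix of $(\partial_\tau,\partial_\phi)$ and let $z$ be its harmonic conjugate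 on the orbit space $M/T$, extended smoothly over the axis and viewed as a $T$-invariant function on $M$; the orientations are such that $d\rho\wedge dz$ is positive on $M/T$ and $(\partial_\tau,\partial_\phi,\nabla\rho,\nabla z)$ is positive on $M$. A \emph{finite rod} $I_A=(z_{A-1},z_A)$ is the bounded $z$-interval corresponding to a component of the part of the axis $\{\rho=0\}$ on which the Gram matrix of the torus generators has rank one. Its length is $\ell_A=z_A-z_{A-1}$, and its bolt $C_A\subset M$ is the closure of that component in $M$. Its rod vector is a $2\pi$-periodic Killing field $v_A=v_A^1\partial_\psi+v_A^2\partial_\chi$, with $v_A^1,v_A^2$ coprime integers, that vanishes over $I_A$ (unique up to sign). Choose integers $u_A^1,u_A^2$ with $u_A^1v_A^2-u_A^2v_A^1=1$, let $u_A=u_A^1\partial_\psi+u_A^2\partial_\chi$, and orient $C_A$ by $dz\wedge u_A^\flat$. For a Killing field $k$, with metric dual one-form also denoted by $k$, set $Q_k[C_A]:=\int_{C_A}\star\,dk$. \textbf{Lemma.} For every finite rod $I_A$, $$Q_{v_A}[C_A]=2\beta\,\ell_A .$$ -/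

import Mathlib

open Bundle Manifold Set Filter Topology MeasureTheory
open scoped ContDiff

namespace ToricInstanton

noncomputable section

/-- The model space of the four-manifold. -/
abbrev E4 := EuclideanSpace ℝ (Fin 4)

/-- Euclidean three-space, the spatial part of the asymptotic model. -/
abbrev E3 := EuclideanSpace ℝ (Fin 3)

/-- The torus `U(1)²`, written additively as `(ℝ / 2πℤ)²`. -/
abbrev Torus := Real.Angle × Real.Angle

/-- The point of the torus with angles `(s, t)`. -/
def angles (s t : ℝ) : Torus := ((s : Real.Angle), (t : Real.Angle))

/-! ### Riemannian geometry: coordinate curvature, volume form, Hodge star -/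

section Riemannian

variable {M : Type*} [MetricSpace M] [ChartedSpace E4 M] [IsManifold (𝓡 4) ∞ M]
  [RiemannianBundle (fun x : M => TangentSpace (𝓡 4) x)]

/-- The tangent vector at the point with coordinates `x` in the preferred chart at `p` whose
coordinate expression in that chart is `w`. -/
def chartVec (p : M) (x w : E4) : TangentSpace (𝓡 4) ((extChartAt (𝓡 4) p).symm x) :=
  mfderiv 𝓘(ℝ, E4) (𝓡 4) (extChartAt (𝓡 4) p).symm x w

/-- The matrix `g_{ij}` of the metric in the preferred chart at `p`, as a function of the
coordinates. -/
def metricMatrix (p : M) (x : E4) : Matrix (Fin 4) (Fin 4) ℝ :=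
  Matrix.of fun i j =>
    inner ℝ (chartVec p x (EuclideanSpace.single i 1)) (chartVec p x (EuclideanSpace.single j 1))

/-- The `i`-th partial derivative of a function of four real variables. -/
def partialD (i : Fin 4) (f : E4 → ℝ) (x : E4) : ℝ :=
  fderiv ℝ f x (EuclideanSpace.single i 1)

/-- The Christoffel symbol `Γ^k_{ij}` of the Levi-Civita connection in the preferred chart
at `p`. -/
def christoffel (p : M) (k i j : Fin 4) (x : E4) : ℝ :=
  (1 / 2) * ∑ l, (metricMatrix p x)⁻¹ k l *
    (partialD i (fun y => metricMatrix p y j l) x + partialD j (fun y => metricMatrix p y i l) x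
      - partialD l (fun y => metricMatrix p y i j) x)

/-- The component `R_{ij}` of the Ricci tensor in the preferred chart at `p`. -/
def ricci (p : M) (i j : Fin 4) (x : E4) : ℝ :=
  ∑ k, (partialD k (christoffel p k i j) x - partialD j (christoffel p k i k) x
    + ∑ l, (christoffel p k k l x * christoffel p l i j x
      - christoffel p k j l x * christoffel p l i k x))

variable (M) in
/-- The Ricci tensor vanishes at every point. -/
def IsRicciFlat : Prop :=
  ∀ (p : M) (i j : Fin 4), ricci p i j (extChartAt (𝓡 4) p p) = 0

/-- `vol` is the Riemannian volume form of an orientation of `M`: a continuous field of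
alternating four-forms taking the values `±1` on orthonormal frames. -/
structure IsVolumeForm (vol : ∀ p : M, TangentSpace (𝓡 4) p [⋀^Fin 4]→ₗ[ℝ] ℝ) : Prop where
  sq_eq : ∀ (p : M) (w : Fin 4 → TangentSpace (𝓡 4) p),
    vol p w ^ 2 = (Matrix.of fun i j => inner ℝ (w i) (w j) : Matrix (Fin 4) (Fin 4) ℝ).det
  continuous : ∀ p : M, ContinuousOn
    (fun x => vol ((extChartAt (𝓡 4) p).symm x)
      fun i => chartVec p x (EuclideanSpace.single i 1)) (extChartAt (𝓡 4) p).target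

instance (p : M) : FiniteDimensional ℝ (TangentSpace (𝓡 4) p) :=
  inferInstanceAs (FiniteDimensional ℝ E4)

/-- The differential `df(X)` of a real function. -/
def differential (f : M → ℝ) (p : M) (X : TangentSpace (𝓡 4) p) : ℝ :=
  mfderiv (𝓡 4) 𝓘(ℝ, ℝ) f p X

/-- The gradient of a function. -/
def grad (f : M → ℝ) (p : M) : TangentSpace (𝓡 4) p :=
  let b := stdOrthonormalBasis ℝ (TangentSpace (𝓡 4) p)
  ∑ i, differential f p (b i) • b i

/-- The Hodge dual of a two-form, `(⋆α)_{ab} = ½ ε_{abcd} α^{cd}`, written in an orthonormal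
basis. -/
def hodgeStar (vol : ∀ p : M, TangentSpace (𝓡 4) p [⋀^Fin 4]→ₗ[ℝ] ℝ)
    (α : ∀ p : M, TangentSpace (𝓡 4) p → TangentSpace (𝓡 4) p → ℝ)
    (p : M) (X Y : TangentSpace (𝓡 4) p) : ℝ :=
  let b := stdOrthonormalBasis ℝ (TangentSpace (𝓡 4) p)
  (1 / 2) * ∑ i, ∑ j, α p (b i) (b j) * vol p ![X, Y, b i, b j]

/-- The exterior derivative of the one-form metrically dual to the vector field `k`, computed at
`p` in the preferred chart at `p`. -/
def dFlat (k : ∀ p : M, TangentSpace (𝓡 4) p) (p : M) (X Y : TangentSpace (𝓡 4) p) : ℝ :=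
  let θ : E4 → E4 → ℝ := fun x w => inner ℝ (k ((extChartAt (𝓡 4) p).symm x)) (chartVec p x w)
  let x₀ : E4 := extChartAt (𝓡 4) p p
  let X' : E4 := mfderiv (𝓡 4) 𝓘(ℝ, E4) (extChartAt (𝓡 4) p) p X
  let Y' : E4 := mfderiv (𝓡 4) 𝓘(ℝ, E4) (extChartAt (𝓡 4) p) p Y
  fderiv ℝ (fun x => θ x Y') x₀ X' - fderiv ℝ (fun x => θ x X') x₀ Y'

/-- The value of a two-form `α` on the coordinate tangent vectors `∂₁F, ∂₂F` of a map `F` of the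
plane into `M`. -/
def pullback (α : ∀ p : M, TangentSpace (𝓡 4) p → TangentSpace (𝓡 4) p → ℝ) (F : ℝ × ℝ → M)
    (q : ℝ × ℝ) : ℝ :=
  α (F q) (mfderiv 𝓘(ℝ, ℝ × ℝ) (𝓡 4) F q ((1, 0) : ℝ × ℝ))
    (mfderiv 𝓘(ℝ, ℝ × ℝ) (𝓡 4) F q ((0, 1) : ℝ × ℝ))

/-- `I` is the integral of the two-form `α` over the surface `C`, oriented by the two-form `o`
(a tangent frame `X, Y` of `C` is positive when `o(X, Y) > 0`). The integral is computed by an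
injective, positively oriented smooth parametrisation of `C` off a null set, namely off countably
many `C¹` curves (which may be constant). The domain `U` need not be connected, so that this
includes decompositions into countably many parametrised pieces. -/
def HasSurfaceIntegral (C : Set M)
    (o α : ∀ p : M, TangentSpace (𝓡 4) p → TangentSpace (𝓡 4) p → ℝ) (I : ℝ) : Prop :=
  ∃ (U : Set (ℝ × ℝ)) (F : ℝ × ℝ → M),
    IsOpen U ∧ ContMDiffOn 𝓘(ℝ, ℝ × ℝ) (𝓡 4) ∞ F U ∧ InjOn F U ∧ MapsTo F U C ∧
    (∃ c : ℕ → ℝ → M, (∀ n, ContMDiff 𝓘(ℝ, ℝ) (𝓡 4) 1 (c n)) ∧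
      C \ F '' U ⊆ ⋃ n, range (c n)) ∧
    (∀ q ∈ U, 0 < pullback o F q) ∧
    IntegrableOn (pullback α F) U ∧ ∫ q in U, pullback α F q = I

end Riemannian

/-! ### Toric gravitational instantons -/

section Toric

variable {M : Type*} [MetricSpace M] [ChartedSpace E4 M] [IsManifold (𝓡 4) ∞ M]
  [RiemannianBundle (fun x : M => TangentSpace (𝓡 4) x)] [AddAction Torus M]

variable (M) in
/-- A toric gravitational instanton: a complete, simply-connected, Ricci-flat Riemannian
four-manifold with an effective, isometric torus action which has a fixed point and no nontrivial
discrete isotropy groups. (A discrete closed subgroup of the torus is the same as a finite one.) -/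
structure IsToricGravitationalInstanton : Prop where
  complete : CompleteSpace M
  simplyConnected : SimplyConnectedSpace M
  ricciFlat : IsRicciFlat M
  smooth : ContMDiff (𝓘(ℝ, ℝ × ℝ).prod (𝓡 4)) (𝓡 4) ∞
    (fun x : (ℝ × ℝ) × M => angles x.1.1 x.1.2 +ᵥ x.2)
  isometric : ∀ (a : Torus) (p : M) (X Y : TangentSpace (𝓡 4) p),
    inner ℝ (mfderiv (𝓡 4) (𝓡 4) (fun x : M => a +ᵥ x) p X)
      (mfderiv (𝓡 4) (𝓡 4) (fun x : M => a +ᵥ x) p Y) = inner ℝ X Y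
  effective : ∀ a : Torus, (∀ p : M, a +ᵥ p = p) → a = 0
  fixedPoint : ∃ p : M, ∀ a : Torus, a +ᵥ p = p
  noDiscreteIsotropy : ∀ p : M, {a : Torus | a +ᵥ p = p}.Finite → ∀ a : Torus, a +ᵥ p = p → a = 0

/-- The Killing field `c₁ η₁ + c₂ η₂`, where `η₁, η₂` are the `2π`-periodic generators of the two
circle factors: the velocity of the one-parameter group `t ↦ (c₁ t, c₂ t)`. -/
def killing (c : Fin 2 → ℝ) (p : M) : TangentSpace (𝓡 4) p :=
  (mfderiv 𝓘(ℝ, ℝ) (𝓡 4) (fun t : ℝ => angles (c 0 * t) (c 1 * t) +ᵥ p) 0 (1 : ℝ) : E4)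

/-- Gram matrix of two Killing fields. -/
def gram (c d : Fin 2 → ℝ) (p : M) : Matrix (Fin 2) (Fin 2) ℝ :=
  !![inner ℝ (killing c p) (killing c p), inner ℝ (killing c p) (killing d p);
     inner ℝ (killing d p) (killing c p), inner ℝ (killing d p) (killing d p)]

/-! ### Asymptotic flatness -/

/-- Rotation of `ℝ³` about the third axis, `φ ↦ φ + a`. -/
def rot (a : ℝ) (x : E3) : E3 :=
  !₂[Real.cos a * x 0 - Real.sin a * x 1, Real.sin a * x 0 + Real.cos a * x 1, x 2]

/-- The cylindrical radius `r sin θ` on `ℝ³`. -/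
def cyl (x : E3) : ℝ := Real.sqrt (x 0 ^ 2 + x 1 ^ 2)

/-- The one-form `dφ` on `ℝ³` minus the third axis. -/
def dphi (x y : E3) : ℝ := (x 0 * y 1 - x 1 * y 0) / (x 0 ^ 2 + x 1 ^ 2)

/-- The one-form `d(r sin θ)` on `ℝ³` minus the third axis. -/
def dcyl (x y : E3) : ℝ := (x 0 * y 0 + x 1 * y 1) / cyl x

/-- `f = O₂(r⁻¹)`: the derivatives of order `k ≤ 2` in cartesian coordinates are
`O(r^{-1-k})`. -/
def IsO2 (f : E3 → ℝ) : Prop :=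
  ∀ k : ℕ, k ≤ 2 → (fun x => iteratedFDeriv ℝ k f x) =O[Bornology.cobounded E3]
    fun x => (‖x‖ ^ (1 + k))⁻¹

variable (M) in
/-- An asymptotically flat end with parameters `β` and `Ω`. The map `F` induces a diffeomorphism
from the quotient of `ℝ × {r > R}` by `(τ, φ) ↦ (τ + β, φ + β Ω)` onto a neighbourhood of infinity
in `M`. On the end the torus acts in the preferred basis
`∂_ψ = (β / 2π) (∂_τ + Ω ∂_φ)`, `∂_χ = ∂_φ` of `2π`-periodic Killing fields, and the metric is
`V (dτ + w dφ)² + V⁻¹ r² sin² θ dφ² + e^{2ν} (dr² + r² dθ²)`. -/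
structure AFEnd where
  β : ℝ
  Ω : ℝ
  R : ℝ
  F : ℝ × E3 → M
  V : E3 → ℝ
  w : E3 → ℝ
  ν : E3 → ℝ
  β_pos : 0 < β
  R_pos : 0 < R
  smooth : ContMDiffOn 𝓘(ℝ, ℝ × E3) (𝓡 4) ∞ F {q | R < ‖q.2‖}
  bijective_deriv : ∀ q : ℝ × E3, R < ‖q.2‖ →
    Function.Bijective (mfderiv 𝓘(ℝ, ℝ × E3) (𝓡 4) F q)
  eq_iff : ∀ q q' : ℝ × E3, R < ‖q.2‖ → R < ‖q'.2‖ →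
    (F q = F q' ↔ ∃ n : ℤ, q'.1 = q.1 + n * β ∧ q'.2 = rot (n * (β * Ω)) q.2)
  isEnd : ∀ R', R < R' → IsCompact (F '' {q | R' < ‖q.2‖})ᶜ
  torus_action : ∀ (s t τ : ℝ) (x : E3), R < ‖x‖ →
    angles s t +ᵥ F (τ, x)
      = F (τ + β / (2 * Real.pi) * s, rot (Ω * (β / (2 * Real.pi)) * s + t) x)
  V_smooth : ContDiffOn ℝ ∞ V {x | R < ‖x‖}
  w_smooth : ContDiffOn ℝ ∞ w {x | R < ‖x‖}
  ν_smooth : ContDiffOn ℝ ∞ ν {x | R < ‖x‖}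
  metric_eq : ∀ (τ : ℝ) (x : E3), R < ‖x‖ → cyl x ≠ 0 → ∀ (a : ℝ) (y : E3),
    inner ℝ (mfderiv 𝓘(ℝ, ℝ × E3) (𝓡 4) F (τ, x) ((a, y) : ℝ × E3))
        (mfderiv 𝓘(ℝ, ℝ × E3) (𝓡 4) F (τ, x) ((a, y) : ℝ × E3))
      = V x * (a + w x * dphi x y) ^ 2 + (V x)⁻¹ * cyl x ^ 2 * dphi x y ^ 2
        + Real.exp (2 * ν x) * (dcyl x y ^ 2 + y 2 ^ 2)
  V_decay : IsO2 fun x => V x - 1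
  w_decay : IsO2 w
  ν_decay : IsO2 ν

namespace AFEnd

/-- The Killing field `∂_τ = (2π / β) ∂_ψ - Ω ∂_χ`, in components. -/
def tauVec (e : AFEnd M) : Fin 2 → ℝ := ![2 * Real.pi / e.β, -e.Ω]

/-- The Killing field `∂_φ = ∂_χ`, in components. -/
def phiVec (_e : AFEnd M) : Fin 2 → ℝ := ![0, 1]

/-- The Weyl coordinate `ρ`, the square root of the determinant of the Gram matrix of
`∂_τ, ∂_φ`. -/
def rho (e : AFEnd M) (p : M) : ℝ := Real.sqrt (gram e.tauVec e.phiVec p).det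

/-- `z` is a harmonic conjugate of `ρ`, `dz = - ⋆̂ dρ`, so that `dρ ∧ dz` is positive on the orbit
space. Here the area form of the orbit space is that of the four-manifold contracted with
`∂_τ, ∂_φ` and divided by `ρ`, and `(⋆̂ α)_a = ε̂_{ab} α^b`. The function `z` is defined up to an
additive constant; it is considered as an invariant function on the whole of `M`. -/
structure IsConjugate (e : AFEnd M) (vol : ∀ p : M, TangentSpace (𝓡 4) p [⋀^Fin 4]→ₗ[ℝ] ℝ)
    (z : M → ℝ) : Prop where
  smooth : ContMDiff (𝓡 4) 𝓘(ℝ, ℝ) ∞ z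
  dz_eq : ∀ p : M, e.rho p ≠ 0 → ∀ w : TangentSpace (𝓡 4) p,
    differential z p w
      = (e.rho p)⁻¹ * vol p ![killing e.tauVec p, killing e.phiVec p, grad e.rho p, w]

end AFEnd

/-! ### Rods and bolts -/

variable (M) in
/-- The part of the axis where the Gram matrix of the generators has rank one. -/
def rankOneLocus : Set M := {p | (gram ![1, 0] ![0, 1] p).rank = 1}

/-- The part of `M` lying over a finite rod: a connected component of the rank-one part of the
axis, over which the coordinate `z` is bounded. The rod itself is the image interval `z '' S`. -/
def IsFiniteRod (z : M → ℝ) (S : Set M) : Prop :=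
  (∃ p ∈ rankOneLocus M, S = connectedComponentIn (rankOneLocus M) p) ∧
    Bornology.IsBounded (z '' S)

/-- The length `z_A - z_{A-1}` of a rod, the difference of the end points of the interval
`z '' S`. -/
def rodLength (z : M → ℝ) (S : Set M) : ℝ := sSup (z '' S) - sInf (z '' S)

/-- `v` is the rod vector of the rod: coprime integers such that the `2π`-periodic Killing field
`v¹ η₁ + v² η₂` vanishes over the rod. -/
def IsRodVector (S : Set M) (v : Fin 2 → ℤ) : Prop :=
  IsCoprime (v 0) (v 1) ∧ ∀ p ∈ S, killing (fun i => (v i : ℝ)) p = 0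

/-- The bolt: the rod's fixed surface together with the corner points at its ends. -/
def bolt (S : Set M) : Set M := closure S

/-- The two-form `dz ∧ u`, which orients the bolt: `u = ∂_{φ¹}` is the angular Killing field
tangent to it. -/
def boltOrientation (z : M → ℝ) (u : Fin 2 → ℤ) (p : M) (X Y : TangentSpace (𝓡 4) p) : ℝ :=
  differential z p X * inner ℝ (killing (fun i => (u i : ℝ)) p) Y
    - differential z p Y * inner ℝ (killing (fun i => (u i : ℝ)) p) X

/-- `Q` is the charge `∫_C ⋆ dk` of the Killing field `k = k¹ η₁ + k² η₂` over the surface `C`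
oriented by `o`. -/
def HasCharge (vol : ∀ p : M, TangentSpace (𝓡 4) p [⋀^Fin 4]→ₗ[ℝ] ℝ) (k : Fin 2 → ℝ) (C : Set M)
    (o : ∀ p : M, TangentSpace (𝓡 4) p → TangentSpace (𝓡 4) p → ℝ) (Q : ℝ) : Prop :=
  HasSurfaceIntegral C o (hodgeStar vol (dFlat (killing k))) Q

end Toric

end

end ToricInstanton

namespace ToricInstanton

section LinearAlgebra

variable {V : Type*} [NormedAddCommGroup V] [InnerProductSpace ℝ V]

/-- A nonzero skew map of a four-dimensional space that kills a vector `e` is an infinitesimal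
rotation of a plane orthogonal to `e`. -/
theorem exists_plane_of_skew (hV : Module.finrank ℝ V = 4) (L : V →ₗ[ℝ] V)
    (hL : ∀ a b, inner ℝ (L a) b = -inner ℝ a (L b)) (e : V) (he : e ≠ 0) (hLe : L e = 0)
    (hL0 : L ≠ 0) :
    ∃ (b : OrthonormalBasis (Fin 4) ℝ V) (κ : ℝ), 0 < κ ∧ b 0 = ‖e‖⁻¹ • e ∧
      ∀ a, L a = κ • (inner ℝ (b 2) a • b 3 - inner ℝ (b 3) a • b 2) := by
  have : FiniteDimensional ℝ V := .of_finrank_pos (by omega)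
  obtain ⟨a, ha⟩ : ∃ a, L a ≠ 0 := by
    by_contra! h
    exact hL0 (LinearMap.ext h)
  have hLL : L (L a) ≠ 0 := by
    intro h
    have := hL (L a) a
    rw [h, inner_zero_left, zero_eq_neg, inner_self_eq_zero] at this
    exact ha this
  have hskew (w : V) : inner ℝ w (L w) = 0 := by
    have := hL w w
    rw [real_inner_comm] at this
    linarith
  have hLe' (w : V) : inner ℝ e (L w) = 0 := by
    have := hL e w
    rw [hLe, inner_zero_left] at this
    linarith
  obtain ⟨y₁, hy₁⟩ : ∃ y₁, y₁ = L a := ⟨_, rfl⟩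
  rw [← hy₁] at ha hLL
  have hy1 : ‖y₁‖ ≠ 0 := norm_ne_zero_iff.2 ha
  obtain ⟨e₀, he₀⟩ : ∃ e₀, e₀ = ‖e‖⁻¹ • e := ⟨_, rfl⟩
  obtain ⟨y, hy⟩ : ∃ y, y = ‖y₁‖⁻¹ • y₁ := ⟨_, rfl⟩
  have hLy : L y ≠ 0 := by
    rw [hy, map_smul]
    exact smul_ne_zero (inv_ne_zero hy1) hLL
  obtain ⟨κ, hκ⟩ : ∃ κ, κ = ‖L y‖ := ⟨_, rfl⟩
  have hκ0 : κ ≠ 0 := hκ ▸ norm_ne_zero_iff.2 hLy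
  obtain ⟨x, hx⟩ : ∃ x, x = -(κ⁻¹ • L y) := ⟨_, rfl⟩
  have hLy' : L y = -(κ • x) := by
    rw [hx, smul_neg, neg_neg, smul_inv_smul₀ hκ0]
  have hyn : inner ℝ y y = 1 := by
    rw [real_inner_self_eq_norm_sq, hy, norm_smul, norm_inv, norm_norm, inv_mul_cancel₀ hy1,
      one_pow]
  have hxn : inner ℝ x x = 1 := by
    rw [real_inner_self_eq_norm_sq, hx, norm_neg, norm_smul, norm_inv, ← hκ,
      Real.norm_of_nonneg (hκ ▸ norm_nonneg _), inv_mul_cancel₀ hκ0, one_pow]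
  have hen : inner ℝ e₀ e₀ = 1 := by
    rw [real_inner_self_eq_norm_sq, he₀, norm_smul, norm_inv, norm_norm,
      inv_mul_cancel₀ (norm_ne_zero_iff.2 he), one_pow]
  have hyx : inner ℝ y x = 0 := by
    rw [hx, inner_neg_right, inner_smul_right, hskew, mul_zero, neg_zero]
  have nrm {c : V} (h : inner ℝ c c = 1) : ‖c‖ = 1 := by
    rw [real_inner_self_eq_norm_sq] at h
    exact (pow_eq_one_iff_of_nonneg (norm_nonneg c) two_ne_zero).1 h
  have hex : inner ℝ e₀ x = 0 := by
    rw [hx, he₀, inner_smul_left, inner_neg_right, inner_smul_right, hLe', mul_zero, neg_zero,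
      mul_zero]
  have hey : inner ℝ e₀ y = 0 := by
    rw [hy, hy₁, he₀, inner_smul_left, inner_smul_right, hLe', mul_zero, mul_zero]
  have hxy : inner ℝ x y = 0 := by rw [real_inner_comm, hyx]
  have hxe : inner ℝ x e₀ = 0 := by rw [real_inner_comm, hex]
  have hye : inner ℝ y e₀ = 0 := by rw [real_inner_comm, hey]
  let w : Fin 4 → V := ![e₀, 0, x, y]
  have hw : Orthonormal ℝ (({0, 2, 3} : Set (Fin 4)).domRestrict w) := by
    rw [orthonormal_iff_ite]
    rintro ⟨i, hi⟩ ⟨j, hj⟩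
    simp only [mem_insert_iff, mem_singleton_iff] at hi hj
    rcases hi with rfl | rfl | rfl <;> rcases hj with rfl | rfl | rfl <;>
      simp [w, nrm hen, nrm hxn, nrm hyn, hyx, hex, hey, hxy, hxe, hye]
  obtain ⟨b, hb⟩ := hw.exists_orthonormalBasis_extension_of_card_eq (by simpa using hV)
  have hb0 : b 0 = e₀ := by simpa [w] using hb 0 (by simp)
  have hb2 : b 2 = x := by simpa [w] using hb 2 (by simp)
  have hb3 : b 3 = y := by simpa [w] using hb 3 (by simp)
  have o (i j : Fin 4) := orthonormal_iff_ite.1 b.orthonormal i j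
  have expand (c : V) : c = ∑ i, inner ℝ (b i) c • b i := (b.sum_repr' c).symm
  have hLb0 : L (b 0) = 0 := by rw [hb0, he₀, map_smul, hLe, smul_zero]
  have hb0L (c : V) : inner ℝ (b 0) (L c) = 0 := by
    have := hL (b 0) c
    rw [hLb0, inner_zero_left] at this
    linarith
  have hLb3 : L (b 3) = -(κ • b 2) := by rw [hb3, hb2, hLy']
  have i31 : inner ℝ (b 3) (L (b 1)) = 0 := by
    have := hL (b 3) (b 1)
    rw [hLb3, inner_neg_left, inner_smul_left, o] at this
    simp at this
    linarith
  have i32 : inner ℝ (b 3) (L (b 2)) = κ := by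
    have := hL (b 3) (b 2)
    rw [hLb3, inner_neg_left, inner_smul_left, o] at this
    simp at this
    linarith
  obtain ⟨α, hα⟩ : ∃ α, α = inner ℝ (b 2) (L (b 1)) := ⟨_, rfl⟩
  have i12 : inner ℝ (b 1) (L (b 2)) = -α := by
    have := hL (b 1) (b 2)
    rw [real_inner_comm] at this
    linarith
  have hLb1 : L (b 1) = α • b 2 := by
    rw [expand (L (b 1)), Fin.sum_univ_four, hb0L, hskew, i31]; simp [hα]
  have hLb2 : L (b 2) = κ • b 3 - α • b 1 := by
    rw [expand (L (b 2)), Fin.sum_univ_four, hb0L, hskew, i32, i12]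
    simp only [zero_smul, zero_add, add_zero, neg_smul]
    abel
  have hLa : L a = ‖y₁‖ • b 3 := by rw [hb3, hy, smul_inv_smul₀ hy1, hy₁]
  have hα0 : α = 0 := by
    have h1 : L a = _ := congrArg L (expand a)
    simp only [map_add, map_smul, Fin.sum_univ_four, hLb0, hLb1, hLb2, hLb3, hLa] at h1
    have e3 := congrArg (inner ℝ (b 3)) h1
    have e1 := congrArg (inner ℝ (b 1)) h1
    simp [inner_add_right, inner_sub_right, inner_smul_right, o] at e3 e1
    rcases e1 with e1 | e1
    · rw [e1] at e3
      simp at e3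
      exact absurd e3 ha
    · exact e1
  refine ⟨b, κ, hκ ▸ norm_pos_iff.2 hLy, hb0.trans he₀, fun c => ?_⟩
  conv_lhs => rw [expand c]
  simp only [map_add, map_smul, Fin.sum_univ_four, hLb0, hLb1, hLb2, hLb3, hα0]
  simp only [zero_smul, smul_zero, zero_add, sub_zero, smul_neg, smul_sub, smul_comm κ]
  abel

theorem vol_mul_vol (hV : Module.finrank ℝ V = 4) (vol : V [⋀^Fin 4]→ₗ[ℝ] ℝ)
    (h : ∀ w : Fin 4 → V,
      vol w ^ 2 = (Matrix.of fun i j => inner ℝ (w i) (w j) : Matrix (Fin 4) (Fin 4) ℝ).det)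
    (a c : Fin 4 → V) :
    vol a * vol c = (Matrix.of fun i j => inner ℝ (a i) (c j) : Matrix (Fin 4) (Fin 4) ℝ).det := by
  have : FiniteDimensional ℝ V := .of_finrank_pos (by omega)
  let b : OrthonormalBasis (Fin 4) ℝ V := (stdOrthonormalBasis ℝ V).reindex (finCongr hV)
  have hb : vol b ^ 2 = 1 := by
    rw [h]
    have : (Matrix.of fun i j => inner ℝ (b i) (b j) : Matrix (Fin 4) (Fin 4) ℝ) = 1 := by
      ext i j
      simp [orthonormal_iff_ite.1 b.orthonormal i j, Matrix.one_apply]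
    rw [this, Matrix.det_one]
  have key (w : Fin 4 → V) : vol w = vol b * (b.toBasis.toMatrix w).det := by
    have := congrArg (fun f => f w) (AlternatingMap.eq_smul_basis_det b.toBasis vol)
    simpa [Module.Basis.det_apply] using this
  have hm : (Matrix.of fun i j => inner ℝ (a i) (c j) : Matrix (Fin 4) (Fin 4) ℝ) =
      (b.toBasis.toMatrix a).transpose * b.toBasis.toMatrix c := by
    ext i j
    rw [Matrix.mul_apply, Matrix.of_apply, ← b.sum_inner_mul_inner]
    refine Finset.sum_congr rfl fun k _ => ?_
    simp [Module.Basis.toMatrix_apply, b.repr_apply_apply, real_inner_comm]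
  rw [hm, Matrix.det_mul, Matrix.det_transpose, key a, key c]
  linear_combination ((b.toBasis.toMatrix a).det * (b.toBasis.toMatrix c).det) * hb

/-- Contraction of the volume form with the two-form of an infinitesimal rotation. -/
theorem sum_inner_mul_vol {ι : Type*} [Fintype ι] (vol : V [⋀^Fin 4]→ₗ[ℝ] ℝ)
    (b : OrthonormalBasis ι ℝ V) (L : V → V) (κ : ℝ) (x y : V)
    (hL : ∀ a, L a = κ • (inner ℝ x a • y - inner ℝ y a • x)) (X Y : V) :
    ∑ i, ∑ j, 2 * inner ℝ (L (b i)) (b j) * vol ![X, Y, b i, b j] = 4 * κ * vol ![X, Y, x, y] := by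
  have h4 (c : V) (i : ι) : ∑ j, inner ℝ c (b j) * vol ![X, Y, b i, b j] = vol ![X, Y, b i, c] := by
    have e (d : V) : ![X, Y, b i, d] = Function.update ![X, Y, b i, 0] 3 d := by
      ext k; fin_cases k <;> simp [Function.update]
    conv_rhs => rw [← b.sum_repr' c, e]
    rw [← AlternatingMap.coe_multilinearMap, MultilinearMap.map_update_sum]
    refine Finset.sum_congr rfl fun j _ => ?_
    rw [MultilinearMap.map_update_smul, ← e, real_inner_comm]
    rfl
  have h3 (c d : V) : ∑ i, inner ℝ c (b i) * vol ![X, Y, b i, d] = vol ![X, Y, c, d] := by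
    have e (c : V) : ![X, Y, c, d] = Function.update ![X, Y, 0, d] 2 c := by
      ext k; fin_cases k <;> simp [Function.update]
    conv_rhs => rw [← b.sum_repr' c, e]
    rw [← AlternatingMap.coe_multilinearMap, MultilinearMap.map_update_sum]
    refine Finset.sum_congr rfl fun j _ => ?_
    rw [MultilinearMap.map_update_smul, ← e, real_inner_comm]
    rfl
  have swap : vol ![X, Y, y, x] = -vol ![X, Y, x, y] := by
    have := vol.map_swap ![X, Y, x, y] (show (2 : Fin 4) ≠ 3 by decide)
    rw [← this]
    congr 1
    ext k; fin_cases k <;> simp [Equiv.swap_apply_def]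
  have e (i : ι) : ∑ j, 2 * inner ℝ (L (b i)) (b j) * vol ![X, Y, b i, b j] =
      2 * κ * (inner ℝ x (b i) * vol ![X, Y, b i, y] - inner ℝ y (b i) * vol ![X, Y, b i, x]) := by
    rw [← h4 y, ← h4 x, Finset.mul_sum, Finset.mul_sum, ← Finset.sum_sub_distrib, Finset.mul_sum]
    refine Finset.sum_congr rfl fun j _ => ?_
    rw [hL, inner_smul_left, inner_sub_left, inner_smul_left, inner_smul_left]
    simp
    ring
  simp_rw [e]
  rw [← Finset.mul_sum, Finset.sum_sub_distrib, h3, h3, swap]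
  ring

end LinearAlgebra


section Charts

variable {M : Type*} [MetricSpace M] [ChartedSpace E4 M] [IsManifold (𝓡 4) ∞ M]

/-- The metric at `p`, on the model space of the tangent space. -/
noncomputable def met [RiemannianBundle (fun x : M => TangentSpace (𝓡 4) x)] (p : M) (X Y : E4) : ℝ :=
  @inner ℝ (TangentSpace (𝓡 4) p) _ X Y

/-- The inverse of the preferred chart at `p`. -/
noncomputable def chartInv (p : M) (x : E4) : M := (extChartAt (𝓡 4) p).symm x

/-- The derivative of the inverse of the preferred chart at `p`. -/
noncomputable def chartD (p : M) (x : E4) : E4 →L[ℝ] E4 :=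
  mfderiv 𝓘(ℝ, E4) (𝓡 4) (extChartAt (𝓡 4) p).symm x

/-- The preferred chart at `p`. -/
noncomputable def chartF (p : M) (q : M) : E4 := extChartAt (𝓡 4) p q

theorem chartInv_chartF_self (p : M) : chartInv p (chartF p p) = p := extChartAt_to_inv p

theorem isOpen_target (p : M) : IsOpen (extChartAt (𝓡 4) p).target := isOpen_extChartAt_target p

theorem source_mem_nhds (p : M) : (extChartAt (𝓡 4) p).source ∈ 𝓝 p := extChartAt_source_mem_nhds p

theorem target_mem_nhds (p : M) : (extChartAt (𝓡 4) p).target ∈ 𝓝 (chartF p p) :=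
  extChartAt_target_mem_nhds p

theorem mem_target_self (p : M) : chartF p p ∈ (extChartAt (𝓡 4) p).target :=
  mem_extChartAt_target p

theorem contMDiffAt_chartInv (p : M) {x : E4} (hx : x ∈ (extChartAt (𝓡 4) p).target) :
    ContMDiffAt 𝓘(ℝ, E4) (𝓡 4) ∞ (chartInv p) x :=
  (contMDiffOn_extChartAt_symm p).contMDiffAt ((isOpen_target p).mem_nhds hx)

theorem contMDiffAt_chartF (p : M) {q : M} (hq : q ∈ (extChartAt (𝓡 4) p).source) :
    ContMDiffAt (𝓡 4) 𝓘(ℝ, E4) ∞ (chartF p) q :=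
  contMDiffAt_extChartAt' (by simpa using hq)

theorem hasMFDerivAt_chartInv (p : M) {x : E4} (hx : x ∈ (extChartAt (𝓡 4) p).target) :
    HasMFDerivAt 𝓘(ℝ, E4) (𝓡 4) (chartInv p) x (chartD p x) :=
  ((contMDiffAt_chartInv p hx).mdifferentiableAt (by simp)).hasMFDerivAt

theorem chartD_self (p : M) : chartD p (chartF p p) = ContinuousLinearMap.id ℝ E4 := by
  have := mfderivWithin_range_extChartAt_symm (I := 𝓡 4) (x := p)
  rw [ModelWithCorners.range_eq_univ, mfderivWithin_univ] at this
  exact this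

theorem mfderiv_chartF_self (p : M) :
    mfderiv (𝓡 4) 𝓘(ℝ, E4) (chartF p) p = ContinuousLinearMap.id ℝ E4 :=
  mfderiv_extChartAt_self (I := 𝓡 4) (x := p)

theorem chartD_mfderiv_chartF (p : M) {x : E4} (hx : x ∈ (extChartAt (𝓡 4) p).target) (w : E4) :
    chartD p x ((mfderiv (𝓡 4) 𝓘(ℝ, E4) (chartF p) (chartInv p x) : E4 →L[ℝ] E4) w) = w := by
  have := mfderivWithin_extChartAt_symm_comp_mfderiv_extChartAt (I := 𝓡 4) hx
  rw [ModelWithCorners.range_eq_univ, mfderivWithin_univ] at this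
  exact congrArg (fun f : E4 →L[ℝ] E4 => f w) this

theorem continuousAt_chartInv (p : M) {x : E4} (hx : x ∈ (extChartAt (𝓡 4) p).target) :
    ContinuousAt (chartInv p) x := (contMDiffAt_chartInv p hx).continuousAt

theorem tendsto_chartInv (p : M) : Tendsto (chartInv p) (𝓝 (chartF p p)) (𝓝 p) := by
  have := (continuousAt_chartInv p (mem_target_self p)).tendsto
  rwa [chartInv_chartF_self] at this

theorem tendsto_chartF (p : M) : Tendsto (chartF p) (𝓝 p) (𝓝 (chartF p p)) :=
  continuousAt_extChartAt p

theorem eventually_chart (p : M) {P : M → Prop} :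
    (∀ᶠ q in 𝓝 p, P q) ↔ ∀ᶠ x in 𝓝 (chartF p p), P (chartInv p x) := by
  refine ⟨fun h => (tendsto_chartInv p).eventually h, fun h => ?_⟩
  filter_upwards [(tendsto_chartF p).eventually h, source_mem_nhds p] with q hq hs
  rwa [chartInv, chartF, (extChartAt (𝓡 4) p).left_inv hs] at hq

variable [RiemannianBundle (fun x : M => TangentSpace (𝓡 4) x)]
  [IsContMDiffRiemannianBundle (𝓡 4) ∞ E4 (fun x : M => TangentSpace (𝓡 4) x)]

theorem contDiffAt_met (p : M) {x : E4} (hx : x ∈ (extChartAt (𝓡 4) p).target) (w w' : E4) :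
    ContDiffAt ℝ ∞ (fun y : E4 × E4 × E4 =>
      met (chartInv p y.1) (chartD p y.1 y.2.1) (chartD p y.1 y.2.2)) (x, w, w') := by
  let e := trivializationAt E4 (TangentSpace (𝓡 4)) p
  have key (f : E4 × E4 × E4 → E4) (hf : ContMDiff 𝓘(ℝ, E4 × E4 × E4) 𝓘(ℝ, E4) ∞ f) :
      ContMDiffAt 𝓘(ℝ, E4 × E4 × E4) ((𝓡 4).prod 𝓘(ℝ, E4)) ∞
        (fun y : E4 × E4 × E4 =>
          (TotalSpace.mk' E4 (chartInv p y.1) (chartD p y.1 (f y)) :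
            TotalSpace E4 (fun x : M => TangentSpace (𝓡 4) x))) (x, w, w') := by
    have h1 : ContMDiffAt 𝓘(ℝ, E4 × E4 × E4) ((𝓡 4).prod 𝓘(ℝ, E4)) ∞
        (fun y : E4 × E4 × E4 => (chartInv p y.1, f y)) (x, w, w') := by
      refine ContMDiffAt.prodMk ?_ hf.contMDiffAt
      exact ContMDiffAt.comp (I' := 𝓘(ℝ, E4)) (x, w, w') (contMDiffAt_chartInv p hx)
        contDiff_fst.contMDiff.contMDiffAt
    have hmem : chartInv p x ∈ e.baseSet := by
      have := (extChartAt (𝓡 4) p).map_target hx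
      simpa [e, chartInv] using this
    have h2 : ContMDiffAt ((𝓡 4).prod 𝓘(ℝ, E4)) ((𝓡 4).prod 𝓘(ℝ, E4)) ∞
        e.toOpenPartialHomeomorph.symm (chartInv p x, f (x, w, w')) :=
      (e.contMDiffOn_symm (IB := 𝓡 4) (n := ∞)).contMDiffAt
        (e.open_target.mem_nhds (e.mem_target.2 hmem))
    have h3 := ContMDiffAt.comp (x, w, w') h2 h1
    refine h3.congr_of_eventuallyEq ?_
    have : ∀ᶠ y : E4 × E4 × E4 in 𝓝 (x, w, w'), y.1 ∈ (extChartAt (𝓡 4) p).target :=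
      continuousAt_fst.eventually ((isOpen_target p).mem_nhds hx)
    filter_upwards [this] with y hy
    have hy' : chartInv p y.1 ∈ (chartAt E4 p).source := by
      have := (extChartAt (𝓡 4) p).map_target hy
      simpa [chartInv] using this
    have hb : chartInv p y.1 ∈ e.baseSet := by simpa [e] using hy'
    have h5 := TangentBundle.symmL_trivializationAt (I := 𝓡 4) hy'
    rw [ModelWithCorners.range_eq_univ, mfderivWithin_univ] at h5
    have h6 : extChartAt (𝓡 4) p (chartInv p y.1) = y.1 := (extChartAt (𝓡 4) p).right_inv hy
    rw [h6] at h5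
    show _ = e.toOpenPartialHomeomorph.symm (chartInv p y.1, f y)
    rw [← e.mk_symm hb]
    congr 1
    refine Eq.trans (congrArg (fun g : E4 →L[ℝ] E4 => g (f y)) h5).symm ?_
    exact Bundle.Trivialization.symmL_apply (R := ℝ) e hb (f y)
  have := (key (fun y => y.2.1) (contDiff_fst.comp contDiff_snd).contMDiff).inner_bundle (key (fun y => y.2.2)
    (contDiff_snd.comp contDiff_snd).contMDiff)
  exact this.contDiffAt

end Charts

section HasD

variable {E E' E'' H H' H'' N N' N'' : Type*}
  [NormedAddCommGroup E] [NormedSpace ℝ E] [NormedAddCommGroup E'] [NormedSpace ℝ E']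
  [NormedAddCommGroup E''] [NormedSpace ℝ E'']
  [TopologicalSpace H] [TopologicalSpace H'] [TopologicalSpace H'']
  [TopologicalSpace N] [TopologicalSpace N'] [TopologicalSpace N'']
  [ChartedSpace H N] [ChartedSpace H' N'] [ChartedSpace H'' N'']
  {I : ModelWithCorners ℝ E H} {I' : ModelWithCorners ℝ E' H'} {I'' : ModelWithCorners ℝ E'' H''}

variable (I I') in
/-- `f` has derivative `D` at `x`, where `D` is a map of the model spaces of the tangent spaces. -/
def HasD (f : N → N') (x : N) (D : E →L[ℝ] E') : Prop := HasMFDerivAt I I' f x D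

theorem HasD.comp {g : N' → N''} {f : N → N'} {x : N} {y : N'} {D' : E' →L[ℝ] E''}
    {D : E →L[ℝ] E'} (hg : HasD I' I'' g y D') (hf : HasD I I' f x D) (h : f x = y) :
    HasD I I'' (g ∘ f) x (D'.comp D) := by
  subst h
  exact HasMFDerivAt.comp x hg hf

theorem HasD.unique {f : N → N'} {x : N} {D D' : E →L[ℝ] E'} (h : HasD I I' f x D)
    (h' : HasD I I' f x D') : D = D' := hasMFDerivAt_unique h h'

theorem HasD.continuousAt {f : N → N'} {x : N} {D : E →L[ℝ] E'} (h : HasD I I' f x D) :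
    ContinuousAt f x := HasMFDerivAt.continuousAt h

theorem HasD.congr {f g : N → N'} {x : N} {D : E →L[ℝ] E'} (h : HasD I I' f x D)
    (hfg : g =ᶠ[𝓝 x] f) : HasD I I' g x D := HasMFDerivAt.congr_of_eventuallyEq h hfg

theorem hasD_iff_hasFDerivAt {f : E → E'} {x : E} {D : E →L[ℝ] E'} :
    HasD 𝓘(ℝ, E) 𝓘(ℝ, E') f x D ↔ HasFDerivAt f D x := hasMFDerivAt_iff_hasFDerivAt

theorem hasD_mfderiv {f : N → N'} {x : N} (h : MDifferentiableAt I I' f x) :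
    HasD I I' f x (mfderiv I I' f x) := h.hasMFDerivAt

theorem HasD.mfderiv_eq {f : N → N'} {x : N} {D : E →L[ℝ] E'} (h : HasD I I' f x D) :
    (mfderiv I I' f x : E →L[ℝ] E') = D := HasMFDerivAt.mfderiv h

theorem exists_hasD {f : N → N'} {x : N} (h : ContMDiffAt I I' ∞ f x) :
    ∃ D, HasD I I' f x D := ⟨_, hasD_mfderiv (h.mdifferentiableAt (by simp))⟩

variable (I) in
/-- The curve `f` has velocity `w` at `t`. -/
def HasVel (f : ℝ → N) (t : ℝ) (w : E) : Prop :=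
  HasD 𝓘(ℝ, ℝ) I f t (ContinuousLinearMap.toSpanSingleton ℝ w)

theorem HasD.hasVel {f : ℝ → N} {t : ℝ} {D : ℝ →L[ℝ] E} (h : HasD 𝓘(ℝ, ℝ) I f t D) :
    HasVel I f t (D 1) := by
  rw [HasVel, show ContinuousLinearMap.toSpanSingleton ℝ (D 1) = D by ext; simp]
  exact h

theorem HasD.comp_hasVel {g : N → N'} {f : ℝ → N} {t : ℝ} {y : N} {D : E →L[ℝ] E'} {w : E}
    (hg : HasD I I' g y D) (hf : HasVel I f t w) (h : f t = y) : HasVel I' (g ∘ f) t (D w) := by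
  have := (hg.comp hf h).hasVel
  simpa using this

theorem HasVel.unique {f : ℝ → N} {t : ℝ} {w w' : E} (h : HasVel I f t w) (h' : HasVel I f t w') :
    w = w' := by
  have := congrArg (fun D : ℝ →L[ℝ] E => D 1) (HasD.unique h h')
  simpa using this

theorem hasVel_iff_hasDerivAt {f : ℝ → E} {t : ℝ} {w : E} :
    HasVel 𝓘(ℝ, E) f t w ↔ HasDerivAt f w t := hasD_iff_hasFDerivAt

theorem hasD_chartInv {M : Type*} [MetricSpace M] [ChartedSpace E4 M] [IsManifold (𝓡 4) ∞ M]
    (p : M) {x : E4} (hx : x ∈ (extChartAt (𝓡 4) p).target) :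
    HasD 𝓘(ℝ, E4) (𝓡 4) (chartInv p) x (chartD p x) := hasMFDerivAt_chartInv p hx

theorem hasD_chartF_self {M : Type*} [MetricSpace M] [ChartedSpace E4 M] [IsManifold (𝓡 4) ∞ M]
    (p : M) : HasD (𝓡 4) 𝓘(ℝ, E4) (chartF p) p (ContinuousLinearMap.id ℝ E4) := by
  have := hasD_mfderiv ((contMDiffAt_chartF p (mem_extChartAt_source p)).mdifferentiableAt
    (by simp))
  rwa [mfderiv_chartF_self] at this

end HasD

section Flows

variable {M : Type*} [MetricSpace M] [ChartedSpace E4 M] [IsManifold (𝓡 4) ∞ M]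

/-- A curve in a manifold with zero velocity is constant. -/
theorem eq_of_hasVel_zero {f : ℝ → M} (hf : ∀ t, HasVel (𝓡 4) f t 0) (t : ℝ) : f t = f 0 := by
  have hcl : IsClosed {s | f s = f 0} :=
    isClosed_eq (continuous_iff_continuousAt.2 fun s => (hf s).continuousAt) continuous_const
  have hop : IsOpen {s | f s = f 0} := by
    rw [isOpen_iff_mem_nhds]
    intro s hs
    have h1 : ∀ᶠ r in 𝓝 s, f r ∈ (extChartAt (𝓡 4) (f s)).source :=
      (hf s).continuousAt.eventually (source_mem_nhds (f s))
    obtain ⟨ε, hε, hball⟩ := Metric.eventually_nhds_iff_ball.1 h1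
    have hd (r : ℝ) (hr : r ∈ Metric.ball s ε) : HasDerivAt (chartF (f s) ∘ f) 0 r := by
      obtain ⟨D, hD⟩ := exists_hasD (contMDiffAt_chartF (f s) (hball r hr))
      have := hasVel_iff_hasDerivAt.1 (hD.comp_hasVel (hf r) rfl)
      rwa [map_zero] at this
    filter_upwards [Metric.ball_mem_nhds s hε] with r hr
    have hconst : (chartF (f s) ∘ f) r = (chartF (f s) ∘ f) s :=
      Metric.isOpen_ball.is_const_of_deriv_eq_zero (𝕜 := ℝ)
        (convex_ball s ε).isPreconnected
        (fun y hy => (hd y hy).differentiableAt.differentiableWithinAt)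
        (fun y hy => (hd y hy).deriv) hr (Metric.mem_ball_self hε)
    have := (extChartAt (𝓡 4) (f s)).injOn (hball r hr) (hball s (Metric.mem_ball_self hε)) hconst
    exact this.trans hs
  have ht : t ∈ {s | f s = f 0} := (IsClopen.eq_univ ⟨hcl, hop⟩ ⟨0, rfl⟩) ▸ mem_univ t
  exact ht

variable [AddAction Torus M]

/-- The one-parameter group of the Killing field with components `c`. -/
noncomputable def flow (c : Fin 2 → ℝ) (t : ℝ) (q : M) : M := angles (c 0 * t) (c 1 * t) +ᵥ q

/-- The Killing field with components `c`, as a vector of the model space. -/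
noncomputable def killE (c : Fin 2 → ℝ) (q : M) : E4 := killing c q

/-- The derivative of the action of an element of the torus. -/
noncomputable def dact (a : Torus) (q : M) : E4 →L[ℝ] E4 :=
  mfderiv (𝓡 4) (𝓡 4) (fun x : M => a +ᵥ x) q

theorem angles_add (s t s' t' : ℝ) : angles (s + s') (t + t') = angles s t + angles s' t' := by
  simp [angles]

theorem angles_zero : angles 0 0 = 0 := by simp [angles]

theorem exists_angles (a : Torus) : ∃ s t, a = angles s t := by
  obtain ⟨a, b⟩ := a
  induction a using Real.Angle.induction_on with | _ s
  induction b using Real.Angle.induction_on with | _ t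
  exact ⟨s, t, rfl⟩

theorem flow_add (c : Fin 2 → ℝ) (s t : ℝ) (q : M) : flow c (s + t) q = flow c s (flow c t q) := by
  rw [flow, flow, flow, mul_add, mul_add, angles_add, add_vadd]

@[simp] theorem flow_zero (c : Fin 2 → ℝ) (q : M) : flow c 0 q = q := by
  simp [flow, angles_zero]

section Smooth

variable (hs : ContMDiff (𝓘(ℝ, ℝ × ℝ).prod (𝓡 4)) (𝓡 4) ∞
    (fun x : (ℝ × ℝ) × M => angles x.1.1 x.1.2 +ᵥ x.2))
include hs

theorem contMDiff_flow (c : Fin 2 → ℝ) :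
    ContMDiff (𝓘(ℝ, ℝ).prod (𝓡 4)) (𝓡 4) ∞ (fun x : ℝ × M => flow c x.1 x.2) := by
  have h1 : ContMDiff 𝓘(ℝ, ℝ) 𝓘(ℝ, ℝ × ℝ) ∞ (fun t : ℝ => (c 0 * t, c 1 * t)) :=
    ContDiff.contMDiff (by fun_prop)
  have h2 : ContMDiff (𝓘(ℝ, ℝ).prod (𝓡 4)) (𝓘(ℝ, ℝ × ℝ).prod (𝓡 4)) ∞
      (fun x : ℝ × M => ((c 0 * x.1, c 1 * x.1), x.2)) :=
    (h1.comp contMDiff_fst).prodMk contMDiff_snd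
  exact hs.comp h2

theorem contMDiff_vadd (a : Torus) : ContMDiff (𝓡 4) (𝓡 4) ∞ (fun x : M => a +ᵥ x) := by
  obtain ⟨s, t, rfl⟩ := exists_angles a
  have h2 : ContMDiff (𝓡 4) (𝓘(ℝ, ℝ × ℝ).prod (𝓡 4)) ∞ (fun x : M => ((s, t), x)) :=
    contMDiff_const.prodMk contMDiff_id
  exact hs.comp h2

theorem contMDiff_orbit (q : M) :
    ContMDiff 𝓘(ℝ, ℝ × ℝ) (𝓡 4) ∞ (fun x : ℝ × ℝ => angles x.1 x.2 +ᵥ q) := by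
  have h2 : ContMDiff 𝓘(ℝ, ℝ × ℝ) (𝓘(ℝ, ℝ × ℝ).prod (𝓡 4)) ∞ (fun x : ℝ × ℝ => (x, q)) :=
    contMDiff_id.prodMk contMDiff_const
  exact hs.comp h2

theorem contMDiff_flow_left (c : Fin 2 → ℝ) (q : M) :
    ContMDiff 𝓘(ℝ, ℝ) (𝓡 4) ∞ (fun t : ℝ => flow c t q) := by
  have h2 : ContMDiff 𝓘(ℝ, ℝ) (𝓘(ℝ, ℝ).prod (𝓡 4)) ∞ (fun t : ℝ => (t, q)) :=
    contMDiff_id.prodMk contMDiff_const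
  exact (contMDiff_flow hs c).comp h2

theorem continuous_flow (c : Fin 2 → ℝ) : Continuous (fun x : ℝ × M => flow c x.1 x.2) :=
  (contMDiff_flow hs c).continuous

theorem continuous_flow_right (c : Fin 2 → ℝ) (t : ℝ) : Continuous (flow c t : M → M) :=
  (contMDiff_vadd hs _).continuous

theorem hasD_vadd (a : Torus) (q : M) :
    HasD (𝓡 4) (𝓡 4) (fun x : M => a +ᵥ x) q (dact a q) :=
  hasD_mfderiv ((contMDiff_vadd hs a).mdifferentiable (by simp) q)

theorem dact_add (a b : Torus) (q : M) : dact (a + b) q = (dact a (b +ᵥ q)).comp (dact b q) := by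
  have h := (hasD_vadd hs a (b +ᵥ q)).comp (hasD_vadd hs b q) rfl
  have e : ((fun x : M => a +ᵥ x) ∘ fun x => b +ᵥ x) = fun x => (a + b) +ᵥ x := by
    ext x; exact (add_vadd a b x).symm
  rw [e] at h
  exact h.mfderiv_eq

omit hs in
theorem dact_zero (q : M) : dact 0 q = ContinuousLinearMap.id ℝ E4 := by
  have : (fun x : M => (0 : Torus) +ᵥ x) = id := by ext x; simp
  rw [dact, this]
  exact mfderiv_id

theorem hasVel_flow_zero (c : Fin 2 → ℝ) (q : M) :
    HasVel (𝓡 4) (fun t => flow c t q) 0 (killE c q) :=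
  (hasD_mfderiv ((contMDiff_flow_left hs c q).mdifferentiable (by simp) 0)).hasVel

theorem dact_killE (a : Torus) (c : Fin 2 → ℝ) (q : M) :
    dact a q (killE c q) = killE c (a +ᵥ q) := by
  have h2 := (hasD_vadd hs a q).comp_hasVel (hasVel_flow_zero hs c q) (flow_zero c q)
  have e : ((fun x : M => a +ᵥ x) ∘ fun t => flow c t q) = fun t => flow c t (a +ᵥ q) := by
    ext t
    simp only [Function.comp, flow, ← add_vadd, add_comm]
  rw [e] at h2
  exact h2.unique (hasVel_flow_zero hs c (a +ᵥ q))

theorem hasVel_flow (c : Fin 2 → ℝ) (q : M) (t : ℝ) :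
    HasVel (𝓡 4) (fun t => flow c t q) t (killE c (flow c t q)) := by
  have h2 : HasD 𝓘(ℝ, ℝ) 𝓘(ℝ, ℝ) (fun r : ℝ => r - t) t (ContinuousLinearMap.id ℝ ℝ) :=
    hasD_iff_hasFDerivAt.2 ((hasFDerivAt_id t).sub_const t)
  have h3 := (hasVel_flow_zero hs c (flow c t q)).comp h2 (sub_self t)
  have e : ((fun r => flow c r (flow c t q)) ∘ fun r : ℝ => r - t) = fun r => flow c r q := by
    ext r
    simp only [Function.comp, ← flow_add, sub_add_cancel]
  rw [e, ContinuousLinearMap.comp_id] at h3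
  exact h3

theorem flow_eq_self_of_killE_eq_zero {c : Fin 2 → ℝ} {q : M} (h : killE c q = 0) (t : ℝ) :
    flow c t q = q := by
  have := eq_of_hasVel_zero (f := fun t => flow c t q) (fun t => by
    have h1 := hasVel_flow hs c q t
    rwa [flow, ← dact_killE hs, h, map_zero] at h1) t
  simpa using this

theorem killE_flow_eq_zero_iff (c d : Fin 2 → ℝ) (q : M) (t : ℝ) :
    killE c (flow d t q) = 0 ↔ killE c q = 0 := by
  have h (r : ℝ) (q : M) (h : killE c q = 0) : killE c (flow d r q) = 0 := by
    rw [flow, ← dact_killE hs, h, map_zero]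
  refine ⟨fun h' => ?_, h t q⟩
  have := h (-t) _ h'
  rwa [← flow_add, neg_add_cancel, flow_zero] at this

theorem killE_eq (c : Fin 2 → ℝ) (q : M) :
    killE c q = c 0 • killE ![1, 0] q + c 1 • killE ![0, 1] q := by
  obtain ⟨D, hD⟩ := exists_hasD ((contMDiff_orbit hs q) (0, 0))
  have key (c : Fin 2 → ℝ) : killE c q = D (c 0, c 1) := by
    have h1 : HasVel 𝓘(ℝ, ℝ × ℝ) (fun t : ℝ => (c 0 * t, c 1 * t)) 0 (c 0, c 1) := by
      rw [hasVel_iff_hasDerivAt]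
      simpa using ((hasDerivAt_id (0 : ℝ)).const_mul (c 0)).prodMk
          ((hasDerivAt_id (0 : ℝ)).const_mul (c 1))
    exact (hasVel_flow_zero hs c q).unique (hD.comp_hasVel h1 (by simp))
  rw [key c, key ![1, 0], key ![0, 1], ← map_smul, ← map_smul, ← map_add]
  simp

end Smooth

section Isometric

variable [RiemannianBundle (fun x : M => TangentSpace (𝓡 4) x)]

theorem met_dact (hi : ∀ (a : Torus) (p : M) (X Y : TangentSpace (𝓡 4) p),
    inner ℝ (mfderiv (𝓡 4) (𝓡 4) (fun x : M => a +ᵥ x) p X)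
      (mfderiv (𝓡 4) (𝓡 4) (fun x : M => a +ᵥ x) p Y) = inner ℝ X Y) (a : Torus) (q : M)
    (X Y : E4) : met (a +ᵥ q) (dact a q X) (dact a q Y) = met q X Y := hi a q X Y

end Isometric
end Flows

section Metric

variable {M : Type*} [MetricSpace M] [ChartedSpace E4 M] [IsManifold (𝓡 4) ∞ M]
  [RiemannianBundle (fun x : M => TangentSpace (𝓡 4) x)] (p : M)

theorem met_add_left (X Y Z : E4) : met p (X + Y) Z = met p X Z + met p Y Z :=
  inner_add_left (𝕜 := ℝ) (E := TangentSpace (𝓡 4) p) X Y Z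

theorem met_comm (X Y : E4) : met p X Y = met p Y X :=
  real_inner_comm (F := TangentSpace (𝓡 4) p) Y X

theorem met_smul_left (r : ℝ) (X Y : E4) : met p (r • X) Y = r * met p X Y :=
  real_inner_smul_left (F := TangentSpace (𝓡 4) p) X Y r

theorem met_add_right (X Y Z : E4) : met p X (Y + Z) = met p X Y + met p X Z :=
  inner_add_right (𝕜 := ℝ) (E := TangentSpace (𝓡 4) p) X Y Z

theorem met_smul_right (r : ℝ) (X Y : E4) : met p X (r • Y) = r * met p X Y :=
  real_inner_smul_right (F := TangentSpace (𝓡 4) p) X Y r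

theorem met_self_eq_zero {X : E4} : met p X X = 0 ↔ X = 0 :=
  inner_self_eq_zero (𝕜 := ℝ) (E := TangentSpace (𝓡 4) p)

theorem met_self_nonneg (X : E4) : 0 ≤ met p X X :=
  real_inner_self_nonneg (F := TangentSpace (𝓡 4) p)

theorem met_self_pos {X : E4} (h : X ≠ 0) : 0 < met p X X :=
  (met_self_nonneg p X).lt_of_ne' ((met_self_eq_zero p).not.2 h)

@[simp] theorem met_zero_left (X : E4) : met p 0 X = 0 :=
  inner_zero_left (𝕜 := ℝ) (E := TangentSpace (𝓡 4) p) X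

@[simp] theorem met_zero_right (X : E4) : met p X 0 = 0 :=
  inner_zero_right (𝕜 := ℝ) (E := TangentSpace (𝓡 4) p) X

/-- The functional `met p X`. -/
noncomputable def metL (X : E4) : E4 →L[ℝ] ℝ :=
  LinearMap.toContinuousLinearMap
    { toFun := met p X
      map_add' := met_add_right p X
      map_smul' := fun r Y => met_smul_right p r X Y }

end Metric


section LocalInverse

variable {M : Type*} [MetricSpace M] [ChartedSpace E4 M] [IsManifold (𝓡 4) ∞ M]

theorem chartD_surjective (p : M) {x : E4} (hx : x ∈ (extChartAt (𝓡 4) p).target) :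
    Function.Surjective (chartD p x) := fun w => ⟨_, chartD_mfderiv_chartF p hx w⟩

theorem contDiffAt_comp_chartInv {F : Type*} [NormedAddCommGroup F] [NormedSpace ℝ F] {f : M → F}
    (p : M) {x : E4} (hx : x ∈ (extChartAt (𝓡 4) p).target)
    (hf : ContMDiffAt (𝓡 4) 𝓘(ℝ, F) ∞ f (chartInv p x)) :
    ContDiffAt ℝ ∞ (f ∘ chartInv p) x :=
  (hf.comp x (contMDiffAt_chartInv p hx)).contDiffAt

/-- The inverse function theorem for a map of the manifold to a vector space. -/
theorem exists_local_inverse {F : Type*} [NormedAddCommGroup F] [NormedSpace ℝ F]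
    [CompleteSpace F] {f : M → F} {p : M}
    (hf : ∀ᶠ q in 𝓝 p, ContMDiffAt (𝓡 4) 𝓘(ℝ, F) ∞ f q) (D : E4 ≃L[ℝ] F)
    (hD : HasD (𝓡 4) 𝓘(ℝ, F) f p (D : E4 →L[ℝ] F)) :
    (∃ N ∈ 𝓝 p, InjOn f N) ∧
    (∀ᶠ q in 𝓝 p, ∀ D' : E4 →L[ℝ] F, HasD (𝓡 4) 𝓘(ℝ, F) f q D' → Function.Injective D') ∧
    ∃ g : F → M, g (f p) = p ∧
      ∀ᶠ y in 𝓝 (f p), ContMDiffAt 𝓘(ℝ, F) (𝓡 4) ∞ g y ∧ f (g y) = y := by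
  let h : E4 → F := f ∘ chartInv p
  let x₀ := chartF p p
  have hev : ∀ᶠ x in 𝓝 x₀, x ∈ (extChartAt (𝓡 4) p).target ∧ ContDiffAt ℝ ∞ h x := by
    filter_upwards [(eventually_chart p).1 hf, target_mem_nhds p] with x h1 h2
    exact ⟨h2, contDiffAt_comp_chartInv p h2 h1⟩
  have hc : ContDiffAt ℝ ∞ h x₀ := hev.self_of_nhds.2
  have hD0 : HasFDerivAt h (D : E4 →L[ℝ] F) x₀ := by
    have := hD.comp (hasD_chartInv p (mem_target_self p)) (chartInv_chartF_self p)
    rw [chartD_self] at this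
    exact hasD_iff_hasFDerivAt.1 this
  let e := hc.toOpenPartialHomeomorph h hD0 (by simp)
  have he : ∀ x, e x = h x := fun x => rfl
  have hx₀ : x₀ ∈ e.source := hc.mem_toOpenPartialHomeomorph_source hD0 (by simp)
  have hinv : ∀ᶠ x in 𝓝 x₀, ∃ D' : E4 ≃L[ℝ] F, (D' : E4 →L[ℝ] F) = fderiv ℝ h x := by
    have h1 : ContinuousAt (fderiv ℝ h) x₀ := (hc.fderiv_right (m := 0) (by simp)).continuousAt
    have h2 := h1.preimage_mem_nhds (t := range ((↑) : (E4 ≃L[ℝ] F) → E4 →L[ℝ] F))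
      (by rw [hD0.fderiv]; exact ContinuousLinearEquiv.nhds D)
    exact h2
  have h0 : h x₀ = f p := congrArg f (chartInv_chartF_self p)
  refine ⟨?_, ?_, chartInv p ∘ e.symm, ?_, ?_⟩
  · refine ⟨(extChartAt (𝓡 4) p).source ∩ chartF p ⁻¹' e.source,
      inter_mem (source_mem_nhds p) ((tendsto_chartF p) (e.open_source.mem_nhds hx₀)), ?_⟩
    rintro a ⟨ha, ha'⟩ b ⟨hb, hb'⟩ hab
    have ea : h (chartF p a) = f a := congrArg f ((extChartAt (𝓡 4) p).left_inv ha)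
    have eb : h (chartF p b) = f b := congrArg f ((extChartAt (𝓡 4) p).left_inv hb)
    have := e.injOn ha' hb' (by rw [he, he, ea, eb, hab])
    exact (extChartAt (𝓡 4) p).injOn ha hb this
  · rw [eventually_chart]
    filter_upwards [hinv, hev] with x ⟨D', hD'⟩ hx D'' hD''
    have h1 := hasD_iff_hasFDerivAt.1 (hD''.comp (hasD_chartInv p hx.1) rfl)
    have h2 := h1.fderiv
    change fderiv ℝ h x = _ at h2
    rw [← hD'] at h2
    rw [injective_iff_map_eq_zero]
    intro w hw
    obtain ⟨W, rfl⟩ := chartD_surjective p hx.1 w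
    have h3 : (D' : E4 →L[ℝ] F) W = D'' (chartD p x W) :=
      congrArg (fun A : E4 →L[ℝ] F => A W) h2
    rw [hw] at h3
    have h4 : W = 0 := D'.map_eq_zero_iff.1 h3
    rw [h4, map_zero]
  · have : e.symm (f p) = x₀ := by rw [← h0, ← he, e.left_inv hx₀]
    rw [Function.comp, this, chartInv_chartF_self]
  · have hy0 : f p ∈ e.target := by rw [← h0, ← he]; exact e.map_source hx₀
    have hs0 : e.symm (f p) = x₀ := by rw [← h0, ← he, e.left_inv hx₀]
    have hcs : Tendsto e.symm (𝓝 (f p)) (𝓝 x₀) := by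
      have := e.continuousAt_symm hy0
      rwa [ContinuousAt, hs0] at this
    filter_upwards [e.open_target.mem_nhds hy0, hcs.eventually hev, hcs.eventually hinv]
      with y hy ⟨hy1, hy2⟩ ⟨D', hD'⟩
    have hd : HasFDerivAt e (D' : E4 →L[ℝ] F) (e.symm y) :=
      hD' ▸ (hy2.differentiableAt (by simp)).hasFDerivAt
    have hs : ContDiffAt ℝ ∞ e.symm y := e.contDiffAt_symm hy hd hy2
    refine ⟨(contMDiffAt_chartInv p hy1).comp y hs.contMDiffAt, ?_⟩
    exact e.right_inv hy

end LocalInverse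

section Rigidity

variable {M : Type*} [MetricSpace M] [ChartedSpace E4 M] [IsManifold (𝓡 4) ∞ M]
  [AddAction Torus M]
  (hs : ContMDiff (𝓘(ℝ, ℝ × ℝ).prod (𝓡 4)) (𝓡 4) ∞
    (fun x : (ℝ × ℝ) × M => angles x.1.1 x.1.2 +ᵥ x.2))
include hs

omit hs [IsManifold (𝓡 4) ∞ M] in
theorem nsmul_vadd_eq {b : Torus} {q : M} (h : b +ᵥ q = q) (j : ℕ) : (j • b) +ᵥ q = q := by
  induction j with
  | zero => simp
  | succ j ih => rw [succ_nsmul, add_vadd, h, ih]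

theorem dact_nsmul {b : Torus} {q : M} (h : b +ᵥ q = q) (j : ℕ) :
    dact (j • b) q = dact b q ^ j := by
  induction j with
  | zero => rw [zero_smul, dact_zero]; rfl
  | succ j ih => rw [succ_nsmul, dact_add hs, h, ih, pow_succ]; rfl

/-- An element of finite order of the torus that fixes a point to first order is the identity
near it. -/
theorem eventually_vadd_eq {b : Torus} {n : ℕ} (hn : n ≠ 0) (hb : n • b = 0) {q : M}
    (hq : b +ᵥ q = q) (hd : dact b q = ContinuousLinearMap.id ℝ E4) :
    ∀ᶠ x in 𝓝 q, b +ᵥ x = x := by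
  let f : M → E4 := fun x => ∑ j ∈ Finset.range n, chartF q ((j • b) +ᵥ x)
  have hfb (x : M) : f (b +ᵥ x) = f x := by
    have h1 : f (b +ᵥ x) = ∑ j ∈ Finset.range n, chartF q (((j + 1) • b) +ᵥ x) :=
      Finset.sum_congr rfl fun j _ => by rw [succ_nsmul, add_vadd]
    have h2 := Finset.sum_range_succ' (fun j => chartF q ((j • b) +ᵥ x)) n
    rw [Finset.sum_range_succ, hb, zero_smul] at h2
    rw [h1]
    exact (add_right_cancel h2).symm
  have hcont (j : ℕ) : Tendsto (fun x : M => (j • b) +ᵥ x) (𝓝 q) (𝓝 q) := by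
    have := (contMDiff_vadd hs (j • b)).continuous.tendsto q
    rwa [nsmul_vadd_eq hq] at this
  have hf : ∀ᶠ x in 𝓝 q, ContMDiffAt (𝓡 4) 𝓘(ℝ, E4) ∞ f x := by
    have h1 : ∀ᶠ x in 𝓝 q, ∀ j ∈ Finset.range n, (j • b) +ᵥ x ∈ (extChartAt (𝓡 4) q).source :=
      (Finset.range n).eventually_all.2 fun j _ => (hcont j).eventually (source_mem_nhds q)
    filter_upwards [h1] with x hx
    exact ContMDiffAt.sum fun j hj => (contMDiffAt_chartF q (hx j hj)).comp x
      (contMDiff_vadd hs (j • b)).contMDiffAt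
  have hn' : (n : ℝ) ≠ 0 := Nat.cast_ne_zero.2 hn
  let D : E4 ≃L[ℝ] E4 := ContinuousLinearEquiv.smulLeft (Units.mk0 (n : ℝ) hn')
  have hD : HasD (𝓡 4) 𝓘(ℝ, E4) f q (D : E4 →L[ℝ] E4) := by
    have h1 (j : ℕ) : HasFDerivAt ((fun x => chartF q ((j • b) +ᵥ x)) ∘ chartInv q)
        (ContinuousLinearMap.id ℝ E4) (chartF q q) := by
      have h2 := (hasD_chartF_self q).comp (hasD_vadd hs (j • b) q) (nsmul_vadd_eq hq j)
      rw [dact_nsmul hs hq, hd, ContinuousLinearMap.id_comp,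
        show ContinuousLinearMap.id ℝ E4 ^ j = ContinuousLinearMap.id ℝ E4 from one_pow j] at h2
      have h3 := h2.comp (hasD_chartInv q (mem_target_self q)) (chartInv_chartF_self q)
      rw [chartD_self, ContinuousLinearMap.id_comp] at h3
      exact hasD_iff_hasFDerivAt.1 h3
    have h4 : HasFDerivAt (f ∘ chartInv q) (D : E4 →L[ℝ] E4) (chartF q q) := by
      have h5 := HasFDerivAt.fun_sum (u := Finset.range n) fun j _ => h1 j
      refine h5.congr_fderiv ?_
      ext1 w
      simp only [sum_apply, ContinuousLinearMap.id_apply, Finset.sum_const,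
        Finset.card_range]
      exact (Nat.cast_smul_eq_nsmul ℝ n w).symm
    have h6 := (hasD_iff_hasFDerivAt.2 h4).comp (hasD_chartF_self q) rfl
    rw [ContinuousLinearMap.comp_id] at h6
    refine h6.congr ?_
    filter_upwards [source_mem_nhds q] with x hx
    exact congrArg f ((extChartAt (𝓡 4) q).left_inv hx).symm
  obtain ⟨⟨N, hN, hinj⟩, -⟩ := exists_local_inverse hf D hD
  have h1 : ∀ᶠ x in 𝓝 q, b +ᵥ x ∈ N := by
    have := hcont 1 hN
    simp only [one_smul] at this
    exact this
  filter_upwards [hN, h1] with x hx hx'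
  exact hinj hx' hx (hfb x)

theorem eq_zero_of_dact_eq_id [ConnectedSpace M]
    (heff : ∀ a : Torus, (∀ p : M, a +ᵥ p = p) → a = 0)
    {b : Torus} {n : ℕ} (hn : n ≠ 0) (hb : n • b = 0) {p : M}
    (hp : b +ᵥ p = p) (hd : dact b p = ContinuousLinearMap.id ℝ E4) : b = 0 := by
  let S := interior {x : M | b +ᵥ x = x}
  have hS : IsClosed S := by
    refine isClosed_of_closure_subset fun q hq => ?_
    have hcl : IsClosed {x : M | b +ᵥ x = x} :=
      isClosed_eq (contMDiff_vadd hs b).continuous continuous_id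
    have hbq : b +ᵥ q = q := hcl.closure_subset_iff.2 interior_subset hq
    refine mem_interior_iff_mem_nhds.2 (eventually_vadd_eq hs hn hb hbq ?_)
    let h : E4 → E4 := (fun x => chartF q (b +ᵥ x)) ∘ chartInv q
    have hh : ContDiffAt ℝ ∞ h (chartF q q) := by
      refine contDiffAt_comp_chartInv q (mem_target_self q) ?_
      rw [chartInv_chartF_self]
      refine ContMDiffAt.comp q (contMDiffAt_chartF q ?_) (contMDiff_vadd hs b).contMDiffAt
      rw [hbq]; exact mem_extChartAt_source q
    have hd' : fderiv ℝ h (chartF q q) = dact b q := by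
      have h2 := ((hasD_chartF_self q).comp (hasD_vadd hs b q) hbq).comp
        (hasD_chartInv q (mem_target_self q)) (chartInv_chartF_self q)
      rw [chartD_self, ContinuousLinearMap.id_comp, ContinuousLinearMap.comp_id] at h2
      exact (hasD_iff_hasFDerivAt.1 h2).fderiv
    have hc : ContinuousAt (fderiv ℝ h) (chartF q q) :=
      (hh.fderiv_right (m := 0) (by simp)).continuousAt
    have hfr : ∃ᶠ x in 𝓝 (chartF q q), fderiv ℝ h x = ContinuousLinearMap.id ℝ E4 := by
      have h3 : ∃ᶠ x in 𝓝 q, x ∈ S := mem_closure_iff_frequently.1 hq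
      by_contra hcon
      refine h3 ?_
      rw [not_frequently] at hcon
      filter_upwards [(tendsto_chartF q).eventually hcon, source_mem_nhds q] with x hx hxs hxS
      refine hx ?_
      have hxt : chartF q x ∈ (extChartAt (𝓡 4) q).target := (extChartAt (𝓡 4) q).map_source hxs
      have hxe : chartInv q (chartF q x) = x := (extChartAt (𝓡 4) q).left_inv hxs
      have h4 : h =ᶠ[𝓝 (chartF q x)] id := by
        have h5 : Tendsto (chartInv q) (𝓝 (chartF q x)) (𝓝 x) := by
          have := continuousAt_chartInv q hxt
          rwa [ContinuousAt, hxe] at this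
        filter_upwards [h5 (isOpen_interior.mem_nhds hxS), (isOpen_target q).mem_nhds hxt]
          with y hy hyt
        have : chartInv q y ∈ {x : M | b +ᵥ x = x} :=
          interior_subset (show chartInv q y ∈ S from hy)
        show chartF q (b +ᵥ chartInv q y) = y
        rw [show b +ᵥ chartInv q y = chartInv q y from this]
        exact (extChartAt (𝓡 4) q).right_inv hyt
      rw [h4.fderiv_eq, fderiv_id]
    rw [← hd']
    by_contra hne
    have h6 := hc.eventually (isOpen_ne.mem_nhds hne)
    obtain ⟨x, hx1, hx2⟩ := (hfr.and_eventually h6).exists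
    exact hx2 hx1
  have hp' : p ∈ S := mem_interior_iff_mem_nhds.2 (eventually_vadd_eq hs hn hb hp hd)
  have huniv : S = univ := IsClopen.eq_univ ⟨hS, isOpen_interior⟩ ⟨p, hp'⟩
  refine heff b fun q => ?_
  have : q ∈ S := huniv ▸ mem_univ q
  have h : q ∈ {x : M | b +ᵥ x = x} := interior_subset this
  exact h

end Rigidity

theorem hasDerivAt_fderiv_of_hasFDerivAt {E F : Type*} [NormedAddCommGroup E] [NormedSpace ℝ E]
    [NormedAddCommGroup F] [NormedSpace ℝ F] {f : ℝ × E → F} {x₀ : E} {L : E →L[ℝ] F}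
    (hc : ContDiffAt ℝ ∞ f (0, x₀))
    (hL : HasFDerivAt (fun x => fderiv ℝ f (0, x) (1, 0)) L x₀) (w : E) :
    HasDerivAt (fun t => fderiv ℝ f (t, x₀) (0, w)) (L w) 0 := by
  have hsymm : IsSymmSndFDerivAt ℝ f (0, x₀) :=
    hc.isSymmSndFDerivAt (by
      rw [minSmoothness_of_isRCLikeNormedField]
      exact WithTop.coe_le_coe.2 (le_top : (2 : ℕ∞) ≤ ⊤))
  obtain ⟨D, hD⟩ : ∃ D, D = fderiv ℝ (fderiv ℝ f) (0, x₀) := ⟨_, rfl⟩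
  have hd : HasFDerivAt (fderiv ℝ f) D (0, x₀) :=
    hD ▸ ((hc.fderiv_right (m := 1) (by norm_cast)).differentiableAt (by simp)).hasFDerivAt
  have h1 : HasDerivAt (fun t : ℝ => fderiv ℝ f (t, x₀)) (D (1, 0)) 0 :=
    hd.comp_hasDerivAt (0 : ℝ) ((hasDerivAt_id (0 : ℝ)).prodMk (hasDerivAt_const 0 x₀))
  have h2 : HasDerivAt (fun t => fderiv ℝ f (t, x₀) (0, w)) (D (1, 0) (0, w)) 0 := by
    have := h1.clm_apply (hasDerivAt_const (0 : ℝ) ((0, w) : ℝ × E))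
    simpa using this
  have h3 : HasFDerivAt (fun x : E => fderiv ℝ f (0, x)) (D.comp (.inr ℝ ℝ E)) x₀ :=
    hd.comp x₀ (hasFDerivAt_prodMk_right (𝕜 := ℝ) (0 : ℝ) x₀)
  have h4 := h3.clm_apply (hasFDerivAt_const ((1, 0) : ℝ × E) x₀)
  have h5 : L w = D (0, w) (1, 0) := by
    rw [hL.unique h4]
    simp
  rw [h5, hD, hsymm, ← hD]
  exact h2

section Linearisation

variable {M : Type*} [MetricSpace M] [ChartedSpace E4 M] [IsManifold (𝓡 4) ∞ M]
  [AddAction Torus M]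

/-- The derivative of the preferred chart at `p`. -/
noncomputable def chartFD (p q : M) : E4 →L[ℝ] E4 := mfderiv (𝓡 4) 𝓘(ℝ, E4) (chartF p) q

/-- The Killing field in the preferred chart at `p`. -/
noncomputable def kC (c : Fin 2 → ℝ) (p : M) (x : E4) : E4 :=
  chartFD p (chartInv p x) (killE c (chartInv p x))

/-- The derivative at `p` of the Killing field in the preferred chart at `p`. -/
noncomputable def linK (c : Fin 2 → ℝ) (p : M) : E4 →L[ℝ] E4 := fderiv ℝ (kC c p) (chartF p p)

/-- The derivative of the flow of a Killing field. -/
noncomputable def dflow (c : Fin 2 → ℝ) (t : ℝ) (p : M) : E4 →L[ℝ] E4 :=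
  dact (angles (c 0 * t) (c 1 * t)) p

theorem chartD_kC (c : Fin 2 → ℝ) (p : M) {x : E4} (hx : x ∈ (extChartAt (𝓡 4) p).target) :
    chartD p x (kC c p x) = killE c (chartInv p x) := chartD_mfderiv_chartF p hx _

theorem kC_self (c : Fin 2 → ℝ) (p : M) : kC c p (chartF p p) = killE c p := by
  have := chartD_kC c p (mem_target_self p)
  rw [chartD_self, chartInv_chartF_self] at this
  exact this

/-- The flow in the preferred chart at `p`. -/
noncomputable def flowC (c : Fin 2 → ℝ) (p : M) (y : ℝ × E4) : E4 :=
  chartF p (flow c y.1 (chartInv p y.2))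

variable (hs : ContMDiff (𝓘(ℝ, ℝ × ℝ).prod (𝓡 4)) (𝓡 4) ∞
    (fun x : (ℝ × ℝ) × M => angles x.1.1 x.1.2 +ᵥ x.2))
include hs

theorem contDiffAt_flowC (c : Fin 2 → ℝ) (p : M) {t : ℝ} {x : E4}
    (hx : x ∈ (extChartAt (𝓡 4) p).target)
    (h : flow c t (chartInv p x) ∈ (extChartAt (𝓡 4) p).source) :
    ContDiffAt ℝ ∞ (flowC c p) (t, x) := by
  have h1 : ContMDiffAt 𝓘(ℝ, ℝ × E4) (𝓘(ℝ, ℝ).prod (𝓡 4)) ∞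
      (fun y : ℝ × E4 => (y.1, chartInv p y.2)) (t, x) := by
    refine ContMDiffAt.prodMk contDiff_fst.contMDiff.contMDiffAt ?_
    exact ContMDiffAt.comp (I' := 𝓘(ℝ, E4)) (t, x) (contMDiffAt_chartInv p hx)
        contDiff_snd.contMDiff.contMDiffAt
  have h2 : ContMDiffAt 𝓘(ℝ, ℝ × E4) (𝓡 4) ∞
      (fun y : ℝ × E4 => flow c y.1 (chartInv p y.2)) (t, x) :=
    ContMDiffAt.comp (t, x) ((contMDiff_flow hs c) (t, chartInv p x)) h1
  have h3 : ContMDiffAt 𝓘(ℝ, ℝ × E4) 𝓘(ℝ, E4) ∞ (flowC c p) (t, x) :=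
    ContMDiffAt.comp (t, x) (contMDiffAt_chartF p h) h2
  exact h3.contDiffAt

theorem kC_eq (c : Fin 2 → ℝ) (p : M) {x : E4} (hx : x ∈ (extChartAt (𝓡 4) p).target) :
    kC c p x = fderiv ℝ (flowC c p) (0, x) (1, 0) := by
  have hxs : chartInv p x ∈ (extChartAt (𝓡 4) p).source := (extChartAt (𝓡 4) p).map_target hx
  have h1 := (hasD_mfderiv ((contMDiffAt_chartF p hxs).mdifferentiableAt (by simp))).comp_hasVel
    (hasVel_flow_zero hs c (chartInv p x)) (flow_zero _ _)
  have h2 := (contDiffAt_flowC hs c p (t := 0) hx (by rwa [flow_zero])).differentiableAt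
    (by simp) |>.hasFDerivAt
  have h3 : HasDerivAt (fun t : ℝ => (t, x)) (1, 0) 0 :=
    (hasDerivAt_id (0 : ℝ)).prodMk (hasDerivAt_const 0 x)
  have h4 := h2.comp_hasDerivAt (0 : ℝ) h3
  exact h1.unique (hasVel_iff_hasDerivAt.2 h4)

theorem contDiffAt_kC (c : Fin 2 → ℝ) (p : M) {x : E4} (hx : x ∈ (extChartAt (𝓡 4) p).target) :
    ContDiffAt ℝ ∞ (kC c p) x := by
  have hxs : chartInv p x ∈ (extChartAt (𝓡 4) p).source := (extChartAt (𝓡 4) p).map_target hx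
  have h1 : ContDiffAt ℝ ∞ (fderiv ℝ (flowC c p)) (0, x) :=
    (contDiffAt_flowC hs c p (t := 0) hx (by rwa [flow_zero])).fderiv_right (by simp)
  have h2 : ContDiffAt ℝ ∞ (fun y : E4 => fderiv ℝ (flowC c p) (0, y) (1, 0)) x :=
    (h1.comp x (contDiffAt_const.prodMk contDiffAt_id)).clm_apply contDiffAt_const
  refine h2.congr_of_eventuallyEq ?_
  filter_upwards [(isOpen_target p).mem_nhds hx] with y hy
  exact kC_eq hs c p hy

theorem hasFDerivAt_kC (c : Fin 2 → ℝ) (p : M) :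
    HasFDerivAt (kC c p) (linK c p) (chartF p p) :=
  ((contDiffAt_kC hs c p (mem_target_self p)).differentiableAt (by simp)).hasFDerivAt

theorem dflow_eq (c : Fin 2 → ℝ) {p : M} (hp : killE c p = 0) (t : ℝ) (w : E4) :
    dflow c t p w = fderiv ℝ (flowC c p) (t, chartF p p) (0, w) := by
  have hfix := flow_eq_self_of_killE_eq_zero hs hp t
  have h1 := (((hasD_chartF_self p).comp (hasD_vadd hs _ p) hfix).comp
    (hasD_chartInv p (mem_target_self p)) (chartInv_chartF_self p))
  rw [chartD_self, ContinuousLinearMap.id_comp, ContinuousLinearMap.comp_id,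
    hasD_iff_hasFDerivAt] at h1
  have h2 := (contDiffAt_flowC hs c p (t := t) (mem_target_self p)
    (by rw [chartInv_chartF_self, hfix]; exact mem_extChartAt_source p)).differentiableAt
    (by simp) |>.hasFDerivAt
  have h3 : HasFDerivAt (fun x : E4 => (t, x)) (ContinuousLinearMap.inr ℝ ℝ E4) (chartF p p) :=
    hasFDerivAt_prodMk_right t _
  have h4 := h2.comp (chartF p p) h3
  have h5 := h1.unique h4
  have h6 := congrArg (fun A : E4 →L[ℝ] E4 => A w) h5
  simpa [dflow] using h6

theorem hasDerivAt_dflow_zero (c : Fin 2 → ℝ) {p : M} (hp : killE c p = 0) (w : E4) :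
    HasDerivAt (fun t => dflow c t p w) (linK c p w) 0 := by
  have hc : ContDiffAt ℝ ∞ (flowC c p) (0, chartF p p) :=
    contDiffAt_flowC hs c p (mem_target_self p)
      (by rw [chartInv_chartF_self, flow_zero]; exact mem_extChartAt_source p)
  have hL : HasFDerivAt (fun x => fderiv ℝ (flowC c p) (0, x) (1, 0)) (linK c p) (chartF p p) := by
    refine (hasFDerivAt_kC hs c p).congr_of_eventuallyEq ?_
    filter_upwards [target_mem_nhds p] with x hx
    exact (kC_eq hs c p hx).symm
  refine (hasDerivAt_fderiv_of_hasFDerivAt hc hL w).congr_of_eventuallyEq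
    (Eventually.of_forall fun t => ?_)
  exact dflow_eq hs c hp t w

theorem dflow_add (c : Fin 2 → ℝ) {p : M} (hp : killE c p = 0) (s t : ℝ) :
    dflow c (s + t) p = (dflow c s p).comp (dflow c t p) := by
  have hfix := flow_eq_self_of_killE_eq_zero hs hp t
  rw [dflow, mul_add, mul_add, angles_add, dact_add hs]
  rw [flow] at hfix
  rw [hfix]
  rfl

theorem hasDerivAt_dflow (c : Fin 2 → ℝ) {p : M} (hp : killE c p = 0) (w : E4) (t : ℝ) :
    HasDerivAt (fun t => dflow c t p w) (dflow c t p (linK c p w)) t := by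
  have h1 : HasDerivAt (fun r => dflow c r p w) (linK c p w) (t - t) := by
    rw [sub_self]; exact hasDerivAt_dflow_zero hs c hp w
  have h2 := (dflow c t p).hasFDerivAt.comp_hasDerivAt t (h1.comp_sub_const t t)
  refine h2.congr_of_eventuallyEq (Eventually.of_forall fun r => ?_)
  show dflow c r p w = dflow c t p (dflow c (r - t) p w)
  rw [← ContinuousLinearMap.comp_apply, ← dflow_add hs c hp, add_sub_cancel]

omit hs in
theorem dflow_zero (c : Fin 2 → ℝ) (p : M) : dflow c 0 p = ContinuousLinearMap.id ℝ E4 := by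
  rw [dflow, mul_zero, mul_zero, angles_zero, dact_zero]

theorem dflow_killE (c d : Fin 2 → ℝ) {p : M} (hp : killE c p = 0) (t : ℝ) :
    dflow c t p (killE d p) = killE d p := by
  rw [dflow, dact_killE hs]
  exact congrArg (killE d) (flow_eq_self_of_killE_eq_zero hs hp t)

theorem linK_killE (c d : Fin 2 → ℝ) {p : M} (hp : killE c p = 0) :
    linK c p (killE d p) = 0 := by
  have h := hasDerivAt_dflow_zero hs c hp (killE d p)
  simp only [dflow_killE hs c d hp] at h
  exact h.unique (hasDerivAt_const _ _)

theorem dact_linK (c : Fin 2 → ℝ) {p : M} (hp : killE c p = 0) {a : Torus} (ha : a +ᵥ p = p)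
    (w : E4) : dact a p (linK c p w) = linK c p (dact a p w) := by
  have h1 := (dact a p).hasFDerivAt.comp_hasDerivAt (0 : ℝ) (hasDerivAt_dflow_zero hs c hp w)
  refine h1.unique ((hasDerivAt_dflow_zero hs c hp (dact a p w)).congr_of_eventuallyEq
    (Eventually.of_forall fun t => ?_))
  have hfix := flow_eq_self_of_killE_eq_zero hs hp t
  rw [flow] at hfix
  have h2 := dact_add hs a (angles (c 0 * t) (c 1 * t)) p
  have h3 := dact_add hs (angles (c 0 * t) (c 1 * t)) a p
  rw [add_comm, h3, hfix, ha] at h2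
  exact congrArg (fun A : E4 →L[ℝ] E4 => A w) h2.symm

theorem dflow_eq_id (c : Fin 2 → ℝ) {p : M} (hp : killE c p = 0) {w : E4} (h : linK c p w = 0)
    (t : ℝ) : dflow c t p w = w := by
  have h1 (r : ℝ) : HasDerivAt (fun t => dflow c t p w) 0 r := by
    have := hasDerivAt_dflow hs c hp w r
    rwa [h, map_zero] at this
  have := is_const_of_deriv_eq_zero (fun r => (h1 r).differentiableAt) (fun r => (h1 r).deriv) t 0
  rwa [dflow_zero] at this

theorem dflow_rotation (c : Fin 2 → ℝ) {p : M} (hp : killE c p = 0) {x y : E4} {κ : ℝ}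
    (hx : linK c p x = κ • y) (hy : linK c p y = -(κ • x)) (t : ℝ) :
    dflow c t p x = Real.cos (κ * t) • x + Real.sin (κ * t) • y ∧
    dflow c t p y = -(Real.sin (κ * t) • x) + Real.cos (κ * t) • y := by
  have hκ (r : ℝ) : HasDerivAt (fun t => κ * t) κ r := by
    simpa using (hasDerivAt_id r).const_mul κ
  have hX := hasDerivAt_dflow hs c hp x
  have hY := hasDerivAt_dflow hs c hp y
  rw [hx] at hX
  rw [hy] at hY
  have key (f : ℝ → E4) (hf : ∀ r, HasDerivAt f 0 r) : f t = f 0 :=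
    is_const_of_deriv_eq_zero (fun r => (hf r).differentiableAt) (fun r => (hf r).deriv) t 0
  have h1 := key (fun t => Real.cos (κ * t) • dflow c t p x - Real.sin (κ * t) • dflow c t p y)
    (fun r => by
      have := ((hκ r).cos.smul (hX r)).sub ((hκ r).sin.smul (hY r))
      refine this.congr_deriv ?_
      simp only [map_smul, map_neg]
      module)
  have h2 := key (fun t => Real.sin (κ * t) • dflow c t p x + Real.cos (κ * t) • dflow c t p y)
    (fun r => by
      have := ((hκ r).sin.smul (hX r)).add ((hκ r).cos.smul (hY r))
      refine this.congr_deriv ?_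
      simp only [map_smul, map_neg]
      module)
  simp only [mul_zero, Real.cos_zero, Real.sin_zero, one_smul, zero_smul, sub_zero, zero_add,
    dflow_zero, ContinuousLinearMap.id_apply] at h1 h2
  have h3 := Real.sin_sq_add_cos_sq (κ * t)
  constructor
  · calc dflow c t p x = (Real.sin (κ * t) ^ 2 + Real.cos (κ * t) ^ 2) • dflow c t p x := by
          rw [h3, one_smul]
      _ = Real.cos (κ * t) • (Real.cos (κ * t) • dflow c t p x - Real.sin (κ * t) • dflow c t p y)
          + Real.sin (κ * t) •
            (Real.sin (κ * t) • dflow c t p x + Real.cos (κ * t) • dflow c t p y) := by module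
      _ = _ := by rw [h1, h2]
  · calc dflow c t p y = (Real.sin (κ * t) ^ 2 + Real.cos (κ * t) ^ 2) • dflow c t p y := by
          rw [h3, one_smul]
      _ = -(Real.sin (κ * t) •
            (Real.cos (κ * t) • dflow c t p x - Real.sin (κ * t) • dflow c t p y))
          + Real.cos (κ * t) •
            (Real.sin (κ * t) • dflow c t p x + Real.cos (κ * t) • dflow c t p y) := by module
      _ = _ := by rw [h1, h2]

theorem linK_eq (c : Fin 2 → ℝ) (p : M) :
    linK c p = c 0 • linK ![1, 0] p + c 1 • linK ![0, 1] p := by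
  have h1 := ((hasFDerivAt_kC hs ![1, 0] p).const_smul (c 0)).add
    ((hasFDerivAt_kC hs ![0, 1] p).const_smul (c 1))
  refine (hasFDerivAt_kC hs c p).unique (h1.congr_of_eventuallyEq
    (Eventually.of_forall fun x => ?_))
  simp only [kC, Pi.add_apply, Pi.smul_apply]
  rw [killE_eq hs c, ← map_smul, ← map_smul, ← map_add]

variable [RiemannianBundle (fun x : M => TangentSpace (𝓡 4) x)]

omit hs [AddAction Torus M] in
theorem hasDerivAt_met (p : M) {f g : ℝ → E4} {f' g' : E4} {t : ℝ} (hf : HasDerivAt f f' t)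
    (hg : HasDerivAt g g' t) :
    HasDerivAt (fun t => met p (f t) (g t)) (met p f' (g t) + met p (f t) g') t := by
  let B : E4 →ₗ[ℝ] E4 →ₗ[ℝ] ℝ := LinearMap.mk₂ ℝ (met p) (met_add_left p)
    (met_smul_left p) (met_add_right p) (fun r X Y => met_smul_right p r X Y)
  have := B.toContinuousBilinearMap.hasDerivAt_of_bilinear (fun _ => hf) (fun _ => hg)
  rw [add_comm]
  exact this

theorem met_linK (hi : ∀ (a : Torus) (p : M) (X Y : TangentSpace (𝓡 4) p),
    inner ℝ (mfderiv (𝓡 4) (𝓡 4) (fun x : M => a +ᵥ x) p X)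
      (mfderiv (𝓡 4) (𝓡 4) (fun x : M => a +ᵥ x) p Y) = inner ℝ X Y) (c : Fin 2 → ℝ) {p : M}
    (hp : killE c p = 0) (X Y : E4) : met p (linK c p X) Y = -met p X (linK c p Y) := by
  have h1 := hasDerivAt_met p (hasDerivAt_dflow_zero hs c hp X) (hasDerivAt_dflow_zero hs c hp Y)
  have h2 (t : ℝ) : met p (dflow c t p X) (dflow c t p Y) = met p X Y := by
    have h3 := met_dact hi (angles (c 0 * t) (c 1 * t)) p X Y
    have hfix := flow_eq_self_of_killE_eq_zero hs hp t
    rw [flow] at hfix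
    rw [hfix] at h3
    exact h3
  simp only [h2, dflow_zero, ContinuousLinearMap.id_apply] at h1
  have := h1.unique (hasDerivAt_const _ _)
  linarith

end Linearisation

theorem angles_eq_zero_iff (s t : ℝ) :
    angles s t = 0 ↔ (∃ k : ℤ, s = k * (2 * Real.pi)) ∧ ∃ k : ℤ, t = k * (2 * Real.pi) := by
  have key (s : ℝ) : (s : Real.Angle) = 0 ↔ ∃ k : ℤ, s = k * (2 * Real.pi) := by
    rw [← Real.Angle.coe_zero, Real.Angle.angle_eq_iff_two_pi_dvd_sub]
    simp only [sub_zero, mul_comm]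
  rw [angles, Prod.mk_eq_zero, key, key]

theorem nsmul_angles (n : ℕ) (s t : ℝ) : n • angles s t = angles (n * s) (n * t) := by
  simp [angles]

/-- The real components of an integer vector. -/
def realVec (w : Fin 2 → ℤ) : Fin 2 → ℝ := fun i => (w i : ℝ)

theorem realVec_one_zero : realVec ![1, 0] = ![1, 0] := by
  ext i; fin_cases i <;> simp [realVec]

theorem realVec_zero_one : realVec ![0, 1] = ![0, 1] := by
  ext i; fin_cases i <;> simp [realVec]

theorem angles_two_pi (w : Fin 2 → ℤ) :
    angles (realVec w 0 * (2 * Real.pi)) (realVec w 1 * (2 * Real.pi)) = 0 :=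
  (angles_eq_zero_iff _ _).2 ⟨⟨w 0, rfl⟩, ⟨w 1, rfl⟩⟩

section Frames

variable {M : Type*} [MetricSpace M] [ChartedSpace E4 M] [IsManifold (𝓡 4) ∞ M]
  [AddAction Torus M]

omit [IsManifold (𝓡 4) ∞ M] in
theorem flow_two_pi (w : Fin 2 → ℤ) (q : M) : flow (realVec w) (2 * Real.pi) q = q := by
  rw [flow, angles_two_pi, zero_vadd]

theorem dflow_two_pi (w : Fin 2 → ℤ) (q : M) :
    dflow (realVec w) (2 * Real.pi) q = ContinuousLinearMap.id ℝ E4 := by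
  rw [dflow, angles_two_pi, dact_zero]

variable (hs : ContMDiff (𝓘(ℝ, ℝ × ℝ).prod (𝓡 4)) (𝓡 4) ∞
    (fun x : (ℝ × ℝ) × M => angles x.1.1 x.1.2 +ᵥ x.2))

include hs in
theorem eq_zero_of_linK_eq_zero [ConnectedSpace M]
    (heff : ∀ a : Torus, (∀ p : M, a +ᵥ p = p) → a = 0) (w : Fin 2 → ℤ) {p : M}
    (hp : killE (realVec w) p = 0) (hL : linK (realVec w) p = 0) : w = 0 := by
  let m : ℕ := (w 0).natAbs + (w 1).natAbs + 1
  have hm : (m : ℝ) ≠ 0 := by positivity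
  have h0 : angles (realVec w 0 * (2 * Real.pi / m)) (realVec w 1 * (2 * Real.pi / m)) = 0 := by
    refine eq_zero_of_dact_eq_id hs heff (n := m) (p := p) (by positivity) ?_ ?_ ?_
    · have e (r : ℝ) : m * (r * (2 * Real.pi / m)) = r * (2 * Real.pi) := by field_simp
      rw [nsmul_angles, e, e, angles_two_pi]
    · exact flow_eq_self_of_killE_eq_zero hs hp _
    · ext1 x
      exact dflow_eq_id hs _ hp (by rw [hL]; rfl) _
  have key (i : Fin 2) (hi : (w i).natAbs < m)
      (h : ∃ k : ℤ, realVec w i * (2 * Real.pi / m) = k * (2 * Real.pi)) : w i = 0 := by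
    obtain ⟨k, hk⟩ := h
    have h2 : (w i : ℝ) = k * m := by
      have hπ : (2 * Real.pi) ≠ 0 := by positivity
      have : realVec w i * (2 * Real.pi / m) * m = k * (2 * Real.pi) * m := by rw [hk]
      field_simp at this
      exact this.trans (mul_comm _ _)
    have h3 : w i = k * m := by exact_mod_cast h2
    refine Int.eq_zero_of_abs_lt_dvd (m := m) ⟨k, by rw [h3, mul_comm]⟩ ?_
    rw [← Int.natCast_natAbs]
    exact_mod_cast hi
  rw [angles_eq_zero_iff] at h0
  ext i
  fin_cases i
  · exact key 0 (by omega) h0.1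
  · exact key 1 (by omega) h0.2

variable [RiemannianBundle (fun x : M => TangentSpace (𝓡 4) x)]

omit [AddAction Torus M] in
theorem met_neg_right (p : M) (X Y : E4) : met p X (-Y) = -met p X Y := by
  rw [← neg_one_smul ℝ Y, met_smul_right, neg_one_mul]

/-- `b` is an orthonormal frame at `p` in which the linearisation of the Killing field `c` is the
infinitesimal rotation with speed `κ` of the plane of the last two vectors. -/
structure IsRotationFrame (c : Fin 2 → ℝ) (p : M) (b : Fin 4 → E4) (κ : ℝ) : Prop where
  pos : 0 < κ
  ortho : ∀ i j, met p (b i) (b j) = if i = j then 1 else 0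
  expand : ∀ w, w = ∑ i, met p (b i) w • b i
  lin : ∀ a, linK c p a = κ • (met p (b 2) a • b 3 - met p (b 3) a • b 2)

variable {c : Fin 2 → ℝ} {p : M} {b : Fin 4 → E4} {κ : ℝ}

omit [IsManifold (𝓡 4) ∞ M] in
theorem IsRotationFrame.lin_zero (h : IsRotationFrame c p b κ) : linK c p (b 0) = 0 := by
  rw [h.lin, h.ortho, h.ortho]; simp

omit [IsManifold (𝓡 4) ∞ M] in
theorem IsRotationFrame.lin_one (h : IsRotationFrame c p b κ) : linK c p (b 1) = 0 := by
  rw [h.lin, h.ortho, h.ortho]; simp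

omit [IsManifold (𝓡 4) ∞ M] in
theorem IsRotationFrame.lin_two (h : IsRotationFrame c p b κ) : linK c p (b 2) = κ • b 3 := by
  rw [h.lin, h.ortho, h.ortho]; simp

omit [IsManifold (𝓡 4) ∞ M] in
theorem IsRotationFrame.lin_three (h : IsRotationFrame c p b κ) :
    linK c p (b 3) = -(κ • b 2) := by
  rw [h.lin, h.ortho, h.ortho]; simp

omit [IsManifold (𝓡 4) ∞ M] in
theorem IsRotationFrame.ext (h : IsRotationFrame c p b κ) {F : Type*} [AddCommGroup F] [Module ℝ F]
    {A B : E4 →ₗ[ℝ] F} (hAB : ∀ i, A (b i) = B (b i)) : A = B := by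
  ext1 w
  rw [h.expand w, map_sum, map_sum]
  exact Finset.sum_congr rfl fun i _ => by rw [map_smul, map_smul, hAB]

variable (hi : ∀ (a : Torus) (p : M) (X Y : TangentSpace (𝓡 4) p),
    inner ℝ (mfderiv (𝓡 4) (𝓡 4) (fun x : M => a +ᵥ x) p X)
      (mfderiv (𝓡 4) (𝓡 4) (fun x : M => a +ᵥ x) p Y) = inner ℝ X Y)

include hs hi in
theorem exists_isRotationFrame (hp : killE c p = 0) (hL : linK c p ≠ 0) {e : E4} (he : e ≠ 0)
    (hLe : linK c p e = 0) :
    ∃ (b : Fin 4 → E4) (κ : ℝ), IsRotationFrame c p b κ ∧ ∃ r : ℝ, 0 < r ∧ b 0 = r • e := by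
  obtain ⟨b, κ, hκ, hb0, hb⟩ := exists_plane_of_skew (V := TangentSpace (𝓡 4) p)
    (finrank_euclideanSpace_fin (𝕜 := ℝ) (n := 4)) (linK c p : E4 →ₗ[ℝ] E4)
    (met_linK hs hi c hp) e he hLe (fun h => hL (ContinuousLinearMap.coe_injective h))
  refine ⟨fun i => b i, κ, ⟨hκ, fun i j => orthonormal_iff_ite.1 b.orthonormal i j,
    fun w => (b.sum_repr' w).symm, fun a => hb a⟩, _, ?_, hb0⟩
  exact inv_pos.2 ((norm_pos_iff (E := TangentSpace (𝓡 4) p)).2 he)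

include hs in
theorem exists_int_of_rotation (w : Fin 2 → ℤ) (hp : killE (realVec w) p = 0) {x y : E4} {κ : ℝ}
    (hx : linK (realVec w) p x = κ • y) (hy : linK (realVec w) p y = -(κ • x))
    (hxx : met p x x = 1) (hxy : met p x y = 0) : ∃ k : ℤ, κ = k := by
  have h := (dflow_rotation hs _ hp hx hy (2 * Real.pi)).1
  rw [dflow_two_pi, ContinuousLinearMap.id_apply] at h
  have h2 := congrArg (met p x) h
  rw [met_add_right, met_smul_right, met_smul_right, hxx, hxy, mul_one, mul_zero, add_zero] at h2
  obtain ⟨k, hk⟩ := (Real.cos_eq_one_iff _).1 h2.symm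
  refine ⟨k, ?_⟩
  have hπ : (2 * Real.pi) ≠ 0 := by positivity
  exact (mul_right_cancel₀ hπ hk).symm

include hs in
theorem linK_comm {c d : Fin 2 → ℝ} {p : M} (hc : killE c p = 0) (hd : killE d p = 0) (w : E4) :
    linK c p (linK d p w) = linK d p (linK c p w) := by
  have h1 := hasDerivAt_dflow_zero hs c hc (linK d p w)
  have h2 := (linK d p).hasFDerivAt.comp_hasDerivAt (0 : ℝ) (hasDerivAt_dflow_zero hs c hc w)
  refine h1.unique (h2.congr_of_eventuallyEq (Eventually.of_forall fun t => ?_))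
  exact dact_linK hs d hd (flow_eq_self_of_killE_eq_zero hs hc t) w

include hs hi in
/-- The linearised torus action at a fixed point has no fixed vectors. -/
theorem eq_zero_of_linK_eq_zero_of_fixed [ConnectedSpace M]
    (heff : ∀ a : Torus, (∀ p : M, a +ᵥ p = p) → a = 0) {p : M}
    (h1 : killE (realVec ![1, 0]) p = 0) (h2 : killE (realVec ![0, 1]) p = 0) {e : E4}
    (he1 : linK (realVec ![1, 0]) p e = 0) (he2 : linK (realVec ![0, 1]) p e = 0) : e = 0 := by
  by_contra he
  have hL : linK (realVec ![1, 0]) p ≠ 0 := fun h => by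
    have := congrFun (eq_zero_of_linK_eq_zero hs heff ![1, 0] h1 h) 0
    simp at this
  obtain ⟨b, κ, hb, r, hr, hbr⟩ := exists_isRotationFrame hs hi h1 hL he he1
  set L := linK (realVec ![1, 0]) p
  set L' := linK (realVec ![0, 1]) p
  have hκ := hb.pos.ne'
  have hsk := met_linK hs hi _ h2
  change ∀ X Y, met p (L' X) Y = -met p X (L' Y) at hsk
  have hself (X : E4) : met p X (L' X) = 0 := by
    have := hsk X X
    rw [met_comm] at this
    linarith
  have hb0 : L' (b 0) = 0 := by rw [hbr, map_smul, he2, smul_zero]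
  obtain ⟨μ, hμ⟩ : ∃ μ, μ = met p (b 3) (L' (b 2)) := ⟨_, rfl⟩
  have hb2 : L' (b 2) = μ • b 3 := by
    have e1 : L' (L (b 3)) = L (L' (b 3)) := linK_comm hs h2 h1 _
    rw [hb.lin_three, hb.lin, map_neg, map_smul, ← smul_neg] at e1
    have e2 := smul_right_injective E4 hκ e1
    simp only [hself, zero_smul, sub_zero] at e2
    have e3 : met p (b 2) (L' (b 3)) = -μ := by
      have := hsk (b 2) (b 3)
      rw [met_comm, ← hμ] at this
      linarith
    rw [e3, neg_smul] at e2
    exact neg_injective e2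
  have hb3 : L' (b 3) = -(μ • b 2) := by
    have e1 : L' (L (b 2)) = L (L' (b 2)) := linK_comm hs h2 h1 _
    rw [hb.lin_two, hb2, map_smul, map_smul, hb.lin_three, smul_neg, smul_comm, ← smul_neg] at e1
    exact smul_right_injective E4 hκ e1
  have hb1 : L' (b 1) = 0 := by
    have e (j : Fin 4) (h : met p (L' (b j)) (b 1) = 0) : met p (b j) (L' (b 1)) = 0 := by
      rw [hsk] at h; linarith
    rw [hb.expand (L' (b 1)), Fin.sum_univ_four, hself, e 0 (by rw [hb0, met_zero_left]),
      e 2 (by rw [hb2, met_smul_left, hb.ortho]; simp),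
      e 3 (by rw [hb3, ← neg_smul, met_smul_left, hb.ortho]; simp)]
    simp
  have h22 : met p (b 2) (b 2) = 1 := by rw [hb.ortho]; simp
  have h23 : met p (b 2) (b 3) = 0 := by rw [hb.ortho]; simp
  obtain ⟨k, hk⟩ := exists_int_of_rotation hs _ h1 hb.lin_two hb.lin_three h22 h23
  obtain ⟨m, hm⟩ := exists_int_of_rotation hs _ h2 hb2 hb3 h22 h23
  have hw : linK (realVec ![-m, k]) p = 0 := by
    have e1 : linK (realVec ![-m, k]) p = (-μ) • L + κ • L' := by
      rw [linK_eq hs, hk, hm]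
      simp [realVec, L, L', ← realVec_one_zero, ← realVec_zero_one]
    rw [e1]
    apply ContinuousLinearMap.coe_injective
    refine hb.ext fun i => ?_
    fin_cases i
    · show (-μ) • L (b 0) + κ • L' (b 0) = 0
      rw [hb.lin_zero, hb0]; simp
    · show (-μ) • L (b 1) + κ • L' (b 1) = 0
      rw [hb.lin_one, hb1]; simp
    · show (-μ) • L (b 2) + κ • L' (b 2) = 0
      rw [hb.lin_two, hb2]; module
    · show (-μ) • L (b 3) + κ • L' (b 3) = 0
      rw [hb.lin_three, hb3]; module
  have hkw : killE (realVec ![-m, k]) p = 0 := by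
    rw [killE_eq hs]
    rw [realVec_one_zero] at h1
    rw [realVec_zero_one] at h2
    rw [h1, h2, smul_zero, smul_zero, add_zero]
  have := congrFun (eq_zero_of_linK_eq_zero hs heff _ hkw hw) 1
  simp at this
  rw [this] at hk
  exact hκ (by simpa using hk)

include hs hi in
theorem eventually_eq_of_fixed [ConnectedSpace M]
    (heff : ∀ a : Torus, (∀ p : M, a +ᵥ p = p) → a = 0) {p : M}
    (h1 : killE (realVec ![1, 0]) p = 0) (h2 : killE (realVec ![0, 1]) p = 0) :
    ∀ᶠ q in 𝓝 p, killE (realVec ![1, 0]) q = 0 → killE (realVec ![0, 1]) q = 0 → q = p := by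
  let D : E4 →L[ℝ] E4 × E4 := (linK (realVec ![1, 0]) p).prod (linK (realVec ![0, 1]) p)
  have hD : HasFDerivAt (fun x => (kC (realVec ![1, 0]) p x, kC (realVec ![0, 1]) p x)) D
      (chartF p p) := (hasFDerivAt_kC hs _ p).prodMk (hasFDerivAt_kC hs _ p)
  have hker : (D : E4 →ₗ[ℝ] E4 × E4).ker = ⊥ := by
    rw [LinearMap.ker_eq_bot']
    intro e he
    have he' := Prod.ext_iff.1 he
    exact eq_zero_of_linK_eq_zero_of_fixed hs hi heff h1 h2 he'.1 he'.2
  obtain ⟨K, -, hK⟩ := LinearMap.exists_antilipschitzWith (D : E4 →ₗ[ℝ] E4 × E4) hker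
  have h3 := hD.eventually_ne (c := 0) ⟨K, hK⟩
  rw [eventually_nhdsWithin_iff] at h3
  filter_upwards [(tendsto_chartF p).eventually h3, source_mem_nhds p] with q hq hqs hq1 hq2
  by_contra hne
  have hinv : chartInv p (chartF p q) = q := (extChartAt (𝓡 4) p).left_inv hqs
  refine hq (fun h => hne ((extChartAt (𝓡 4) p).injOn hqs (mem_extChartAt_source p) h)) ?_
  rw [kC, kC, hinv, hq1, hq2, map_zero]
  rfl

end Frames

theorem _root_.Filter.Tendsto.clm_apply {α E F : Type*} [NormedAddCommGroup E] [NormedSpace ℝ E]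
    [NormedAddCommGroup F] [NormedSpace ℝ F] {l : Filter α} {f : α → E →L[ℝ] F} {g : α → E}
    {A : E →L[ℝ] F} {x : E} (hf : Tendsto f l (𝓝 A)) (hg : Tendsto g l (𝓝 x)) :
    Tendsto (fun a => f a (g a)) l (𝓝 (A x)) :=
  (isBoundedBilinearMap_apply.continuous.tendsto (A, x)).comp (hf.prodMk_nhds hg)

theorem contDiffAt_smul_vector {E F : Type*} [NormedAddCommGroup E] [NormedSpace ℝ E]
    [NormedAddCommGroup F] [NormedSpace ℝ F] {f : E → ℝ} {x : E} (v : F)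
    (hf : ContDiffAt ℝ ∞ f x) : ContDiffAt ℝ ∞ (fun y => f y • v) x :=
  hf.smul contDiffAt_const

section Gram

variable {M : Type*} [MetricSpace M] [ChartedSpace E4 M] [IsManifold (𝓡 4) ∞ M]
  [RiemannianBundle (fun x : M => TangentSpace (𝓡 4) x)]

/-- The metric in the preferred chart at `p`, as a bilinear form. -/
noncomputable def gB (p : M) (x : E4) : E4 →L[ℝ] E4 →L[ℝ] ℝ :=
  ∑ i : Fin 4, ∑ k : Fin 4,
    met (chartInv p x) (chartD p x (EuclideanSpace.single i 1))
      (chartD p x (EuclideanSpace.single k 1)) •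
    (EuclideanSpace.proj i : E4 →L[ℝ] ℝ).smulRight (EuclideanSpace.proj k : E4 →L[ℝ] ℝ)

theorem sum_single (w : E4) : ∑ i, w i • EuclideanSpace.single i (1 : ℝ) = w := by
  simpa using (EuclideanSpace.basisFun (Fin 4) ℝ).sum_repr w

theorem met_sum_left {ι : Type*} (s : Finset ι) (p : M) (f : ι → E4) (Y : E4) :
    met p (∑ i ∈ s, f i) Y = ∑ i ∈ s, met p (f i) Y :=
  sum_inner (𝕜 := ℝ) (E := TangentSpace (𝓡 4) p) s f Y

theorem met_sum_right {ι : Type*} (s : Finset ι) (p : M) (f : ι → E4) (Y : E4) :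
    met p Y (∑ i ∈ s, f i) = ∑ i ∈ s, met p Y (f i) :=
  inner_sum (𝕜 := ℝ) (E := TangentSpace (𝓡 4) p) s f Y

theorem gB_apply (p : M) (x w w' : E4) :
    gB p x w w' = met (chartInv p x) (chartD p x w) (chartD p x w') := by
  conv_rhs => rw [← sum_single w, ← sum_single w']
  rw [map_sum, met_sum_left, gB, sum_apply, sum_apply]
  refine Finset.sum_congr rfl fun i _ => ?_
  rw [map_sum, met_sum_right, sum_apply, sum_apply]
  refine Finset.sum_congr rfl fun k _ => ?_
  rw [map_smul, map_smul, met_smul_left, met_smul_right]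
  show _ * (w i * w' k) = _
  ring

theorem gB_self (p : M) (w w' : E4) : gB p (chartF p p) w w' = met p w w' := by
  rw [gB_apply, chartD_self, chartInv_chartF_self]
  rfl

theorem contDiffAt_gB
    [IsContMDiffRiemannianBundle (𝓡 4) ∞ E4 (fun x : M => TangentSpace (𝓡 4) x)]
    (p : M) {x : E4} (hx : x ∈ (extChartAt (𝓡 4) p).target) :
    ContDiffAt ℝ ∞ (gB p) x := by
  refine ContDiffAt.sum fun i _ => ContDiffAt.sum fun k _ =>
    contDiffAt_smul_vector _ ?_
  have h1 : ContDiffAt ℝ ∞ (fun y : E4 => ((y, EuclideanSpace.single i 1,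
    EuclideanSpace.single k 1) : E4 × E4 × E4)) x :=
    contDiffAt_id.prodMk (contDiffAt_const.prodMk contDiffAt_const)
  exact (contDiffAt_met p hx _ _).comp x h1

variable [AddAction Torus M]

/-- The Gram determinant of two Killing fields. -/
noncomputable def gramDet (c d : Fin 2 → ℝ) (q : M) : ℝ :=
  met q (killE c q) (killE c q) * met q (killE d q) (killE d q) - met q (killE c q) (killE d q) ^ 2

theorem gramDet_nonneg (c d : Fin 2 → ℝ) (q : M) : 0 ≤ gramDet c d q := by
  have := real_inner_mul_inner_self_le (F := TangentSpace (𝓡 4) q) (killE c q) (killE d q)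
  rw [gramDet, sq, sub_nonneg]
  exact this

theorem gramDet_chartInv (c d : Fin 2 → ℝ) (p : M) {x : E4}
    (hx : x ∈ (extChartAt (𝓡 4) p).target) :
    gramDet c d (chartInv p x) =
      gB p x (kC c p x) (kC c p x) * gB p x (kC d p x) (kC d p x)
        - gB p x (kC c p x) (kC d p x) ^ 2 := by
  rw [gramDet, gB_apply, gB_apply, gB_apply, chartD_kC c p hx, chartD_kC d p hx]

variable (hs : ContMDiff (𝓘(ℝ, ℝ × ℝ).prod (𝓡 4)) (𝓡 4) ∞
    (fun x : (ℝ × ℝ) × M => angles x.1.1 x.1.2 +ᵥ x.2))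
variable [IsContMDiffRiemannianBundle (𝓡 4) ∞ E4 (fun x : M => TangentSpace (𝓡 4) x)]

include hs in
theorem contDiffAt_gB_kC (c d : Fin 2 → ℝ) (p : M) {x : E4}
    (hx : x ∈ (extChartAt (𝓡 4) p).target) :
    ContDiffAt ℝ ∞ (fun x => gB p x (kC c p x) (kC d p x)) x :=
  ((contDiffAt_gB p hx).clm_apply (contDiffAt_kC hs c p hx)).clm_apply (contDiffAt_kC hs d p hx)

include hs in
theorem contDiffAt_gramDet (c d : Fin 2 → ℝ) (p : M) {x : E4}
    (hx : x ∈ (extChartAt (𝓡 4) p).target) :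
    ContDiffAt ℝ ∞ (gramDet c d ∘ chartInv p) x := by
  have h1 := ((contDiffAt_gB_kC hs c c p hx).mul (contDiffAt_gB_kC hs d d p hx)).sub
    ((contDiffAt_gB_kC hs c d p hx).pow 2)
  refine h1.congr_of_eventuallyEq ?_
  filter_upwards [(isOpen_target p).mem_nhds hx] with y hy
  exact gramDet_chartInv c d p hy

omit [RiemannianBundle (fun x : M => TangentSpace (𝓡 4) x)]
  [IsContMDiffRiemannianBundle (𝓡 4) ∞ E4 (fun x : M => TangentSpace (𝓡 4) x)]
  [AddAction Torus M] in
theorem contMDiffAt_of_chartInv {F : Type*} [NormedAddCommGroup F] [NormedSpace ℝ F] {f : M → F}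
    (q : M) (h : ContDiffAt ℝ ∞ (f ∘ chartInv q) (chartF q q)) :
    ContMDiffAt (𝓡 4) 𝓘(ℝ, F) ∞ f q := by
  have h1 := h.contMDiffAt.comp q (contMDiffAt_chartF q (mem_extChartAt_source q))
  refine h1.congr_of_eventuallyEq ?_
  filter_upwards [source_mem_nhds q] with x hx
  exact (congrArg f ((extChartAt (𝓡 4) q).left_inv hx)).symm

include hs in
theorem contMDiff_gramDet (c d : Fin 2 → ℝ) :
    ContMDiff (𝓡 4) 𝓘(ℝ, ℝ) ∞ (gramDet c d : M → ℝ) := fun q =>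
  contMDiffAt_of_chartInv q (contDiffAt_gramDet hs c d q (mem_target_self q))

section Limits

variable {c d : Fin 2 → ℝ} {p : M} (hp : killE c p = 0) (X : E4)

omit hs [RiemannianBundle (fun x : M => TangentSpace (𝓡 4) x)]
  [IsContMDiffRiemannianBundle (𝓡 4) ∞ E4 (fun x : M => TangentSpace (𝓡 4) x)]
  [AddAction Torus M] in
theorem tendsto_line : Tendsto (fun ε : ℝ => chartF p p + ε • X) (𝓝[≠] 0) (𝓝 (chartF p p)) := by
  have : Continuous fun ε : ℝ => chartF p p + ε • X := by fun_prop
  have h := this.tendsto 0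
  rw [zero_smul, add_zero] at h
  exact h.mono_left nhdsWithin_le_nhds

include hs hp

omit [RiemannianBundle (fun x : M => TangentSpace (𝓡 4) x)]
  [IsContMDiffRiemannianBundle (𝓡 4) ∞ E4 (fun x : M => TangentSpace (𝓡 4) x)] in
theorem tendsto_kC_div : Tendsto (fun ε : ℝ => ε⁻¹ • kC c p (chartF p p + ε • X)) (𝓝[≠] 0)
    (𝓝 (linK c p X)) := by
  have h1 : HasDerivAt (fun ε : ℝ => chartF p p + ε • X) X 0 := by
    simpa using ((hasDerivAt_id (0 : ℝ)).smul_const X).const_add (chartF p p)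
  have h2 : HasDerivAt (fun ε : ℝ => kC c p (chartF p p + ε • X)) (linK c p X) 0 := by
    have h3 : HasFDerivAt (kC c p) (linK c p) (chartF p p + (0 : ℝ) • X) := by
      rw [zero_smul, add_zero]; exact hasFDerivAt_kC hs c p
    exact h3.comp_hasDerivAt (0 : ℝ) h1
  have h3 := hasDerivAt_iff_tendsto_slope_zero.1 h2
  simpa [kC_self, hp] using h3

theorem tendsto_gB_kC_div :
    Tendsto (fun ε : ℝ => ε⁻¹ * gB p (chartF p p + ε • X) (kC d p (chartF p p + ε • X))
      (kC c p (chartF p p + ε • X))) (𝓝[≠] 0) (𝓝 (met p (killE d p) (linK c p X))) := by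
  have h1 : Tendsto (fun ε : ℝ => gB p (chartF p p + ε • X)) (𝓝[≠] 0) (𝓝 (gB p (chartF p p))) :=
    (contDiffAt_gB p (mem_target_self p)).continuousAt.tendsto.comp (tendsto_line X)
  have h2 : Tendsto (fun ε : ℝ => kC d p (chartF p p + ε • X)) (𝓝[≠] 0) (𝓝 (killE d p)) := by
    rw [← kC_self]
    exact (contDiffAt_kC hs d p (mem_target_self p)).continuousAt.tendsto.comp (tendsto_line X)
  have h3 := (h1.clm_apply h2).clm_apply (tendsto_kC_div hs hp X)
  rw [gB_self] at h3
  refine h3.congr fun ε => ?_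
  rw [map_smul, smul_eq_mul]

theorem tendsto_gB_kC_div_sq :
    Tendsto (fun ε : ℝ => (ε ^ 2)⁻¹ * gB p (chartF p p + ε • X) (kC c p (chartF p p + ε • X))
      (kC c p (chartF p p + ε • X))) (𝓝[≠] 0) (𝓝 (met p (linK c p X) (linK c p X))) := by
  have h1 : Tendsto (fun ε : ℝ => gB p (chartF p p + ε • X)) (𝓝[≠] 0) (𝓝 (gB p (chartF p p))) :=
    (contDiffAt_gB p (mem_target_self p)).continuousAt.tendsto.comp (tendsto_line X)
  have h3 := (h1.clm_apply (tendsto_kC_div hs hp X)).clm_apply (tendsto_kC_div hs hp X)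
  rw [gB_self] at h3
  refine h3.congr fun ε => ?_
  rw [map_smul, map_smul, smul_apply, smul_eq_mul, smul_eq_mul]
  ring

theorem tendsto_gramDet_div :
    Tendsto (fun ε : ℝ => (ε ^ 2)⁻¹ * gramDet d c (chartInv p (chartF p p + ε • X))) (𝓝[≠] 0)
      (𝓝 (met p (killE d p) (killE d p) * met p (linK c p X) (linK c p X)
        - met p (killE d p) (linK c p X) ^ 2)) := by
  have h1 : Tendsto (fun ε : ℝ => gB p (chartF p p + ε • X) (kC d p (chartF p p + ε • X))
      (kC d p (chartF p p + ε • X))) (𝓝[≠] 0) (𝓝 (met p (killE d p) (killE d p))) := by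
    have := (contDiffAt_gB_kC hs d d p (mem_target_self p)).continuousAt.tendsto.comp
      (tendsto_line X)
    rw [gB_self, kC_self] at this
    exact this
  have h2 := (h1.mul (tendsto_gB_kC_div_sq hs hp X)).sub
    ((tendsto_gB_kC_div hs (d := d) hp X).pow 2)
  refine h2.congr' ?_
  filter_upwards [(tendsto_line X).eventually_mem (target_mem_nhds p)] with ε hε
  rw [gramDet_chartInv d c p hε]
  ring

theorem tendsto_fderiv_gramDet_div (h : E4) (hdX : met p (killE d p) (linK c p X) = 0) :
    Tendsto (fun ε : ℝ => ε⁻¹ * fderiv ℝ (gramDet d c ∘ chartInv p) (chartF p p + ε • X) h)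
      (𝓝[≠] 0)
      (𝓝 (2 * met p (killE d p) (killE d p) * met p (linK c p h) (linK c p X))) := by
  let x₀ := chartF p p
  have hx₀ := mem_target_self p
  obtain ⟨A, hA⟩ : ∃ A : E4 → ℝ, A = fun x => gB p x (kC d p x) (kC d p x) := ⟨_, rfl⟩
  obtain ⟨B, hB⟩ : ∃ B : E4 → ℝ, B = fun x => gB p x (kC d p x) (kC c p x) := ⟨_, rfl⟩
  obtain ⟨C, hC⟩ : ∃ C : E4 → ℝ, C = fun x => gB p x (kC c p x) (kC c p x) := ⟨_, rfl⟩
  have cA {x} (hx : x ∈ (extChartAt (𝓡 4) p).target) : ContDiffAt ℝ ∞ A x :=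
    hA ▸ contDiffAt_gB_kC hs d d p hx
  have cB {x} (hx : x ∈ (extChartAt (𝓡 4) p).target) : ContDiffAt ℝ ∞ B x :=
    hB ▸ contDiffAt_gB_kC hs d c p hx
  have hG {x} (hx : x ∈ (extChartAt (𝓡 4) p).target) :
      fderiv ℝ (gramDet d c ∘ chartInv p) x h =
        A x * (fderiv ℝ (gB p) x h (kC c p x) (kC c p x)
          + gB p x (fderiv ℝ (kC c p) x h) (kC c p x)
          + gB p x (kC c p x) (fderiv ℝ (kC c p) x h))
        + C x * fderiv ℝ A x h - 2 * B x * fderiv ℝ B x h := by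
    have dA := ((cA hx).differentiableAt (by simp)).hasFDerivAt
    have dB := ((cB hx).differentiableAt (by simp)).hasFDerivAt
    have dg := ((contDiffAt_gB p hx).differentiableAt (by simp)).hasFDerivAt
    have dk := ((contDiffAt_kC hs c p hx).differentiableAt (by simp)).hasFDerivAt
    have dC := (dg.clm_apply dk).clm_apply dk
    have h1 := (dA.mul dC).sub (dB.pow 2)
    have h2 : (gramDet d c ∘ chartInv p) =ᶠ[𝓝 x]
        fun x => A x * gB p x (kC c p x) (kC c p x) - B x ^ 2 := by
      filter_upwards [(isOpen_target p).mem_nhds hx] with y hy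
      rw [Function.comp, gramDet_chartInv d c p hy, hA, hB]
    rw [(h1.congr_of_eventuallyEq h2).fderiv]
    simp [hC]
    ring
  have tl := tendsto_line (p := p) X
  have tg : Tendsto (fun ε : ℝ => gB p (x₀ + ε • X)) (𝓝[≠] 0) (𝓝 (gB p x₀)) :=
    (contDiffAt_gB p hx₀).continuousAt.tendsto.comp tl
  have tdg : Tendsto (fun ε : ℝ => fderiv ℝ (gB p) (x₀ + ε • X) h) (𝓝[≠] 0)
      (𝓝 (fderiv ℝ (gB p) x₀ h)) :=
    (((contDiffAt_gB p hx₀).fderiv_right (m := 0) (by simp)).continuousAt.tendsto.comp tl).clm_apply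
      tendsto_const_nhds
  have tk : Tendsto (fun ε : ℝ => kC c p (x₀ + ε • X)) (𝓝[≠] 0) (𝓝 0) := by
    have := (contDiffAt_kC hs c p hx₀).continuousAt.tendsto.comp tl
    rwa [kC_self, hp] at this
  have tdk : Tendsto (fun ε : ℝ => fderiv ℝ (kC c p) (x₀ + ε • X) h) (𝓝[≠] 0)
      (𝓝 (linK c p h)) :=
    (((contDiffAt_kC hs c p hx₀).fderiv_right (m := 0)
      (by simp)).continuousAt.tendsto.comp tl).clm_apply tendsto_const_nhds
  have tkd := tendsto_kC_div hs hp X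
  have tA : Tendsto (fun ε : ℝ => A (x₀ + ε • X)) (𝓝[≠] 0)
      (𝓝 (met p (killE d p) (killE d p))) := by
    have := (cA hx₀).continuousAt.tendsto.comp tl
    have e : A x₀ = met p (killE d p) (killE d p) := by
      simp only [hA, x₀, gB_self, kC_self]
    rwa [show A (chartF p p) = _ from e] at this
  have tdA : Tendsto (fun ε : ℝ => fderiv ℝ A (x₀ + ε • X) h) (𝓝[≠] 0) (𝓝 (fderiv ℝ A x₀ h)) :=
    (((cA hx₀).fderiv_right (m := 0) (by simp)).continuousAt.tendsto.comp tl).clm_apply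
      tendsto_const_nhds
  have tdB : Tendsto (fun ε : ℝ => fderiv ℝ B (x₀ + ε • X) h) (𝓝[≠] 0) (𝓝 (fderiv ℝ B x₀ h)) :=
    (((cB hx₀).fderiv_right (m := 0) (by simp)).continuousAt.tendsto.comp tl).clm_apply
      tendsto_const_nhds
  have tB := tendsto_gB_kC_div hs (d := d) hp X
  rw [hdX] at tB
  have tC := (tg.clm_apply tk).clm_apply tkd
  have t1 := (tdg.clm_apply tk).clm_apply tkd
  have t2 := (tg.clm_apply tdk).clm_apply tkd
  have t3 := (tg.clm_apply tkd).clm_apply tdk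
  have t := ((tA.mul ((t1.add t2).add t3)).add (tC.mul tdA)).sub ((tB.mul tdB).const_mul 2)
  have e : met p (killE d p) (killE d p) *
        (fderiv ℝ (gB p) x₀ h 0 (linK c p X) + gB p x₀ (linK c p h) (linK c p X) +
          gB p x₀ (linK c p X) (linK c p h)) + gB p x₀ 0 (linK c p X) * fderiv ℝ A x₀ h -
        2 * (0 * fderiv ℝ B x₀ h) =
      2 * met p (killE d p) (killE d p) * met p (linK c p h) (linK c p X) := by
    simp only [x₀, gB_self, map_zero, zero_apply]
    rw [met_comm p (linK c p X)]
    ring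
  rw [e] at t
  refine t.congr' ?_
  filter_upwards [tl.eventually_mem (target_mem_nhds p)] with ε hε
  rw [hG hε, hC, hB]
  simp only [map_smul, smul_apply, smul_eq_mul, x₀]
  ring

end Limits
end Gram

section Alternating

variable {V : Type*} [AddCommGroup V] [Module ℝ V] (f : V [⋀^Fin 4]→ₗ[ℝ] ℝ)

theorem alternating_comb (A B X Y : V) (a b c d : ℝ) :
    f ![a • A + b • B, c • A + d • B, X, Y] = (a * d - b * c) * f ![A, B, X, Y] := by
  have e0 (Z W : V) : ![Z, W, X, Y] = Function.update ![0, W, X, Y] 0 Z := by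
    ext k; fin_cases k <;> simp [Function.update]
  have e1 (Z W : V) : ![Z, W, X, Y] = Function.update ![Z, 0, X, Y] 1 W := by
    ext k; fin_cases k <;> simp [Function.update]
  have l0 (W : V) (a b : ℝ) (Z Z' : V) :
      f ![a • Z + b • Z', W, X, Y] = a * f ![Z, W, X, Y] + b * f ![Z', W, X, Y] := by
    rw [e0, f.map_update_add, f.map_update_smul, f.map_update_smul, ← e0, ← e0]
    rfl
  have l1 (W : V) (a b : ℝ) (Z Z' : V) :
      f ![W, a • Z + b • Z', X, Y] = a * f ![W, Z, X, Y] + b * f ![W, Z', X, Y] := by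
    rw [e1, f.map_update_add, f.map_update_smul, f.map_update_smul, ← e1, ← e1]
    rfl
  have z (W : V) : f ![W, W, X, Y] = 0 :=
    f.map_eq_zero_of_eq _ (i := 0) (j := 1) rfl (by decide)
  have sw : f ![B, A, X, Y] = -f ![A, B, X, Y] := by
    have := f.map_swap ![A, B, X, Y] (show (0 : Fin 4) ≠ 1 by decide)
    rw [← this]
    congr 1
    ext k; fin_cases k <;> simp [Equiv.swap_apply_def]
  rw [l0, l1, l1, z, z, sw]
  ring

theorem alternating_rotate (A B C D : V) : f ![A, B, C, D] = f ![D, A, C, B] := by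
  have h1 := f.map_swap ![A, B, C, D] (show (0 : Fin 4) ≠ 3 by decide)
  have h2 := f.map_swap ![D, B, C, A] (show (1 : Fin 4) ≠ 3 by decide)
  have e1 : ![A, B, C, D] ∘ Equiv.swap (0 : Fin 4) 3 = ![D, B, C, A] := by
    ext k; fin_cases k <;> simp [Equiv.swap_apply_def]
  have e2 : ![D, B, C, A] ∘ Equiv.swap (1 : Fin 4) 3 = ![D, A, C, B] := by
    ext k; fin_cases k <;> simp [Equiv.swap_apply_def]
  rw [e1] at h1
  rw [e2] at h2
  rw [h2, h1, neg_neg]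

end Alternating

section Conjugate

variable {M : Type*} [MetricSpace M] [ChartedSpace E4 M] [IsManifold (𝓡 4) ∞ M]
  [RiemannianBundle (fun x : M => TangentSpace (𝓡 4) x)] [AddAction Torus M]

/-- The differential of a function, on the model space of the tangent space. -/
noncomputable def dfun (f : M → ℝ) (q : M) : E4 →L[ℝ] ℝ := mfderiv (𝓡 4) 𝓘(ℝ, ℝ) f q

omit [IsManifold (𝓡 4) ∞ M] [RiemannianBundle (fun x : M => TangentSpace (𝓡 4) x)]
  [AddAction Torus M] in
theorem hasD_dfun {f : M → ℝ} {q : M} (h : ContMDiffAt (𝓡 4) 𝓘(ℝ, ℝ) ∞ f q) :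
    HasD (𝓡 4) 𝓘(ℝ, ℝ) f q (dfun f q) := hasD_mfderiv (h.mdifferentiableAt (by simp))

omit [AddAction Torus M] in
theorem met_grad (f : M → ℝ) (q : M) (w : E4) : met q (grad f q) w = dfun f q w := by
  let b := stdOrthonormalBasis ℝ (TangentSpace (𝓡 4) q)
  have key : ∀ b' : Fin (Module.finrank ℝ (TangentSpace (𝓡 4) q)) → E4,
      w = ∑ i, met q (b' i) w • b' i →
      met q (∑ i, dfun f q (b' i) • b' i) w = dfun f q w := by
    intro b' h1
    rw [met_sum_left]
    conv_rhs => rw [h1, map_sum]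
    refine Finset.sum_congr rfl fun i _ => ?_
    rw [met_smul_left, map_smul, smul_eq_mul, mul_comm]
  exact key (fun i => b i) (b.sum_repr' w).symm

theorem gram_det (c d : Fin 2 → ℝ) (q : M) : (gram c d q).det = gramDet c d q := by
  rw [gram, Matrix.det_fin_two_of, gramDet]
  have h1 : inner ℝ (killing c q) (killing c q) = met q (killE c q) (killE c q) := rfl
  have h2 : inner ℝ (killing d q) (killing d q) = met q (killE d q) (killE d q) := rfl
  have h3 : inner ℝ (killing c q) (killing d q) = met q (killE c q) (killE d q) := rfl
  have h4 : inner ℝ (killing d q) (killing c q) = met q (killE d q) (killE c q) := rfl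
  rw [h1, h2, h3, h4, met_comm q (killE d q) (killE c q), sq]

omit [AddAction Torus M] in
theorem gram_comb (q : M) (A B : E4) (a b c d : ℝ) :
    met q (a • A + b • B) (a • A + b • B) * met q (c • A + d • B) (c • A + d • B)
        - met q (a • A + b • B) (c • A + d • B) ^ 2 =
      (a * d - b * c) ^ 2 * (met q A A * met q B B - met q A B ^ 2) := by
  simp only [met_add_left, met_add_right, met_smul_left, met_smul_right, met_comm q B A]
  ring

variable (hs : ContMDiff (𝓘(ℝ, ℝ × ℝ).prod (𝓡 4)) (𝓡 4) ∞
    (fun x : (ℝ × ℝ) × M => angles x.1.1 x.1.2 +ᵥ x.2))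

section

variable (e : AFEnd M) {u v : Fin 2 → ℤ} (huv : u 0 * v 1 - u 1 * v 0 = 1)
include hs huv

omit [IsManifold (𝓡 4) ∞ M] [RiemannianBundle (fun x : M => TangentSpace (𝓡 4) x)] hs
  [MetricSpace M] [ChartedSpace E4 M] [AddAction Torus M] in
theorem det_real : (u 0 : ℝ) * v 1 - u 1 * v 0 = 1 := by exact_mod_cast huv

theorem gramDet_eq (q : M) :
    gramDet (realVec u) (realVec v) q = gramDet ![1, 0] ![0, 1] q := by
  have := gram_comb q (killE ![1, 0] q) (killE ![0, 1] q) (u 0) (u 1) (v 0) (v 1)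
  rw [det_real huv, one_pow, one_mul] at this
  rw [gramDet, killE_eq hs (realVec u), killE_eq hs (realVec v)]
  exact this

theorem rho_eq (q : M) :
    e.rho q = 2 * Real.pi / e.β * Real.sqrt (gramDet (realVec u) (realVec v) q) := by
  have hβ := e.β_pos
  have h1 : gramDet e.tauVec e.phiVec q =
      (2 * Real.pi / e.β) ^ 2 * gramDet (realVec u) (realVec v) q := by
    have := gram_comb q (killE ![1, 0] q) (killE ![0, 1] q) (2 * Real.pi / e.β) (-e.Ω) 0 1
    rw [gramDet_eq hs huv, gramDet, killE_eq hs e.tauVec, killE_eq hs e.phiVec]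
    simp only [AFEnd.tauVec, AFEnd.phiVec, Matrix.cons_val_zero, Matrix.cons_val_one]
    rw [this, gramDet]
    ring
  rw [AFEnd.rho, gram_det, h1, Real.sqrt_mul (by positivity), Real.sqrt_sq (by positivity)]

theorem vol_tau_phi (q : M) (vol : TangentSpace (𝓡 4) q [⋀^Fin 4]→ₗ[ℝ] ℝ)
    (X Y : TangentSpace (𝓡 4) q) :
    vol ![killing e.tauVec q, killing e.phiVec q, X, Y] =
      2 * Real.pi / e.β * vol ![killing (realVec u) q, killing (realVec v) q, X, Y] := by
  have h (c : Fin 2 → ℝ) : killing c q = c 0 • killing ![1, 0] q + c 1 • killing ![0, 1] q :=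
    killE_eq hs c q
  rw [h e.tauVec, h e.phiVec, h (realVec u), h (realVec v), alternating_comb, alternating_comb]
  have := det_real huv
  simp only [AFEnd.tauVec, AFEnd.phiVec, Matrix.cons_val_zero, Matrix.cons_val_one, realVec]
  rw [this]
  ring

variable {vol : ∀ p : M, TangentSpace (𝓡 4) p [⋀^Fin 4]→ₗ[ℝ] ℝ} (hvol : IsVolumeForm vol)
  {z : M → ℝ} (hz : e.IsConjugate vol z)
theorem rho_ne_zero {q : M} (hG : 0 < gramDet (realVec u) (realVec v) q) : e.rho q ≠ 0 := by
  rw [rho_eq hs e huv]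
  have := e.β_pos
  have := Real.sqrt_pos.2 hG
  positivity

include hvol hz

/-- The defining equation of the harmonic conjugate, free of gradients. -/
theorem gramDet_mul_dfun {q : M} (hG : 0 < gramDet (realVec u) (realVec v) q) {dG : E4 →L[ℝ] ℝ}
    (hdG : HasD (𝓡 4) 𝓘(ℝ, ℝ) (gramDet (realVec u) (realVec v)) q dG)
    (E : Fin 4 → TangentSpace (𝓡 4) q) (w : E4) :
    gramDet (realVec u) (realVec v) q * dfun z q w * vol q E =
      Real.pi / e.β * (Matrix.of fun i j : Fin 4 => ![met q (killE (realVec u) q) (E j),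
        met q (killE (realVec v) q) (E j), dG (E j), met q w (E j)] i).det := by
  have hβ := e.β_pos
  have hsq := Real.sqrt_pos.2 hG
  obtain ⟨s, hs'⟩ : ∃ s, s = Real.sqrt (gramDet (realVec u) (realVec v) q) := ⟨_, rfl⟩
  rw [← hs'] at hsq
  have hGs : gramDet (realVec u) (realVec v) q = s ^ 2 := by rw [hs', Real.sq_sqrt hG.le]
  have hrho : ∀ w : E4, dfun e.rho q w = Real.pi / e.β / s * dG w := by
    intro w
    have h1 : HasDerivAt (fun t : ℝ => 2 * Real.pi / e.β * Real.sqrt t)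
        (2 * Real.pi / e.β * (1 / (2 * s))) (gramDet (realVec u) (realVec v) q) := by
      rw [hs']
      exact (Real.hasDerivAt_sqrt hG.ne').const_mul _
    have h2 := (hasD_iff_hasFDerivAt.2 h1.hasFDerivAt).comp hdG rfl
    have h3 : ((fun t : ℝ => 2 * Real.pi / e.β * Real.sqrt t) ∘
        gramDet (realVec u) (realVec v)) = e.rho := by
      ext q; exact (rho_eq hs e huv q).symm
    rw [h3] at h2
    have h4 : dfun e.rho q = _ := h2.mfderiv_eq
    rw [h4]
    simp
    field_simp
  have h1 := (hz.dz_eq q (rho_ne_zero hs e huv hG) w).trans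
    (congrArg ((e.rho q)⁻¹ * ·) (vol_tau_phi hs e huv q (vol q) (grad e.rho q) w))
  have h2 := vol_mul_vol (V := TangentSpace (𝓡 4) q)
    (finrank_euclideanSpace_fin (𝕜 := ℝ) (n := 4)) (vol q) (hvol.sq_eq q)
    ![killing (realVec u) q, killing (realVec v) q, grad e.rho q, w] E
  have h3 : (Matrix.of fun i j => inner ℝ
      ((![killing (realVec u) q, killing (realVec v) q, grad e.rho q, w] :
        Fin 4 → TangentSpace (𝓡 4) q) i) (E j) : Matrix (Fin 4) (Fin 4) ℝ) =
      Matrix.of fun i j => (![1, 1, Real.pi / e.β / s, 1] : Fin 4 → ℝ) i *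
        (Matrix.of fun i j : Fin 4 => ![met q (killE (realVec u) q) (E j),
        met q (killE (realVec v) q) (E j), dG (E j), met q w (E j)] i) i j := by
    ext i j
    fin_cases i
    · exact (one_mul _).symm
    · exact (one_mul _).symm
    · exact (met_grad e.rho q (E j)).trans (hrho (E j))
    · exact (one_mul _).symm
  rw [h3, Matrix.det_mul_column] at h2
  have h4 : dfun z q w = (e.rho q)⁻¹ * (2 * Real.pi / e.β *
    vol q ![killing (realVec u) q, killing (realVec v) q, grad e.rho q, w]) := h1
  rw [h4, rho_eq hs e huv, ← hs', hGs]
  rw [Fin.prod_univ_four] at h2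
  simp only [Matrix.cons_val_zero, Matrix.cons_val_one, Matrix.cons_val] at h2
  have h5 : s ^ 2 * ((2 * Real.pi / e.β * s)⁻¹ * (2 * Real.pi / e.β *
      vol q ![killing (realVec u) q, killing (realVec v) q, grad e.rho q, w])) * vol q E =
      s * (vol q ![killing (realVec u) q, killing (realVec v) q, grad e.rho q, w] * vol q E) := by
    have := Real.pi_pos
    field_simp
  rw [h5, h2]
  field_simp

end
end Conjugate

section Limit

variable {M : Type*} [MetricSpace M] [ChartedSpace E4 M] [IsManifold (𝓡 4) ∞ M]
  [RiemannianBundle (fun x : M => TangentSpace (𝓡 4) x)]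

/-- A field of alternating forms, on the model space of the tangent space. -/
noncomputable def volE (vol : ∀ p : M, TangentSpace (𝓡 4) p [⋀^Fin 4]→ₗ[ℝ] ℝ) (q : M) :
    E4 [⋀^Fin 4]→ₗ[ℝ] ℝ := vol q

variable {vol : ∀ p : M, TangentSpace (𝓡 4) p [⋀^Fin 4]→ₗ[ℝ] ℝ} (hvol : IsVolumeForm vol)
include hvol

theorem volE_mul_volE (q : M) (a c : Fin 4 → E4) :
    volE vol q a * volE vol q c = (Matrix.of fun i j => met q (a i) (c j)).det :=
  vol_mul_vol (V := TangentSpace (𝓡 4) q)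
    (finrank_euclideanSpace_fin (𝕜 := ℝ) (n := 4)) (vol q) (hvol.sq_eq q) a c

theorem tendsto_volE (p : M) (b : Fin 4 → E4) :
    Tendsto (fun x => volE vol (chartInv p x) fun j => chartD p x (b j)) (𝓝 (chartF p p))
      (𝓝 (volE vol p b)) := by
  let e := (EuclideanSpace.basisFun (Fin 4) ℝ).toBasis
  let g : E4 → E4 [⋀^Fin 4]→ₗ[ℝ] ℝ := fun x =>
    (volE vol (chartInv p x)).compLinearMap (chartD p x : E4 →ₗ[ℝ] E4)
  have h1 (x : E4) : (volE vol (chartInv p x) fun j => chartD p x (b j)) = g x e * e.det b :=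
    congrArg (fun f : E4 [⋀^Fin 4]→ₗ[ℝ] ℝ => f b) ((g x).eq_smul_basis_det e)
  have h2 : ContinuousAt (fun x => g x e) (chartF p p) := by
    have h3 := (hvol.continuous p).continuousAt (target_mem_nhds p)
    refine h3.congr (Eventually.of_forall fun x => ?_)
    have : (e : Fin 4 → E4) = fun i => EuclideanSpace.single i 1 := by
      ext1 i; simp [e]
    show _ = volE vol (chartInv p x) fun i => chartD p x (e i)
    rw [this]
    rfl
  have h4 : ContinuousAt (fun x => volE vol (chartInv p x) fun j => chartD p x (b j))
      (chartF p p) := by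
    simp only [h1]
    exact h2.mul continuousAt_const
  have h5 := h4.tendsto
  rwa [chartD_self, chartInv_chartF_self] at h5

variable [IsContMDiffRiemannianBundle (𝓡 4) ∞ E4 (fun x : M => TangentSpace (𝓡 4) x)]
  [AddAction Torus M]
variable (hs : ContMDiff (𝓘(ℝ, ℝ × ℝ).prod (𝓡 4)) (𝓡 4) ∞
    (fun x : (ℝ × ℝ) × M => angles x.1.1 x.1.2 +ᵥ x.2))
variable (e : AFEnd M) {u v : Fin 2 → ℤ} (huv : u 0 * v 1 - u 1 * v 0 = 1)
  {z : M → ℝ} (hz : e.IsConjugate vol z)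

omit hvol [RiemannianBundle (fun x : M => TangentSpace (𝓡 4) x)]
  [IsContMDiffRiemannianBundle (𝓡 4) ∞ E4 (fun x : M => TangentSpace (𝓡 4) x)]
  [AddAction Torus M] in
theorem dfun_chartD {f : M → ℝ} (p : M) {x : E4} (hf : ContMDiffAt (𝓡 4) 𝓘(ℝ, ℝ) ∞ f (chartInv p x))
    (hx : x ∈ (extChartAt (𝓡 4) p).target) (w : E4) :
    dfun f (chartInv p x) (chartD p x w) = fderiv ℝ (f ∘ chartInv p) x w := by
  have h1 := (hasD_dfun hf).comp (hasD_chartInv p hx) rfl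
  rw [(hasD_iff_hasFDerivAt.1 h1).fderiv]
  rfl

include hs huv hz

/-- The differential of the conjugate function on a rod, as a limit of the defining equation. -/
theorem dfun_eq_of_isRotationFrame {p : M} (hp : killE (realVec v) p = 0) {b : Fin 4 → E4} {κ r : ℝ}
    (hb : IsRotationFrame (realVec v) p b κ) (hr : 0 < r) (hbr : b 0 = r • killE (realVec u) p)
    (w : E4) :
    dfun z p w = 2 * Real.pi / e.β * κ * volE vol p ![killE (realVec u) p, b 3, b 2, w] := by
  have hβ := e.β_pos
  have hκ := hb.pos
  obtain ⟨U, hU⟩ : ∃ U, U = killE (realVec u) p := ⟨_, rfl⟩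
  rw [← hU] at hbr ⊢
  have hU0 : U ≠ 0 := by
    rintro rfl
    rw [smul_zero] at hbr
    have := hb.ortho 0 0
    rw [hbr] at this
    simp at this
  have hUU := met_self_pos p hU0
  have hUr : U = r⁻¹ • b 0 := by rw [hbr, smul_smul, inv_mul_cancel₀ hr.ne', one_smul]
  have hLX : linK (realVec v) p (b 2) = κ • b 3 := hb.lin_two
  have hUL : met p U (linK (realVec v) p (b 2)) = 0 := by
    rw [hLX, hUr, met_smul_left, met_smul_right, hb.ortho]; simp
  have tl := tendsto_line (p := p) (b 2)
  obtain ⟨x, hxdef⟩ : ∃ x : ℝ → E4, x = fun ε => chartF p p + ε • b 2 := ⟨_, rfl⟩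
  rw [← hxdef] at tl
  -- limits of the terms
  have tG : Tendsto (fun ε : ℝ => (ε ^ 2)⁻¹ * gramDet (realVec u) (realVec v) (chartInv p (x ε)))
      (𝓝[≠] 0) (𝓝 (met p U U * κ ^ 2)) := by
    have := tendsto_gramDet_div hs (d := realVec u) hp (b 2)
    rw [← hU, hUL, hLX, met_smul_left, met_smul_right, hb.ortho] at this
    rw [hxdef]
    convert this using 2
    rw [if_pos rfl]
    ring
  have tz : Tendsto (fun ε : ℝ => dfun z (chartInv p (x ε)) (chartD p (x ε) w)) (𝓝[≠] 0)
      (𝓝 (dfun z p w)) := by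
    have hc : ContDiffAt ℝ ∞ (z ∘ chartInv p) (chartF p p) :=
      contDiffAt_comp_chartInv p (mem_target_self p) (hz.smooth _)
    have h1 := (((hc.fderiv_right (m := 0) (by simp)).continuousAt.tendsto).comp tl).clm_apply
      (tendsto_const_nhds (x := w))
    have h2 := dfun_chartD p (hz.smooth _) (mem_target_self p) w
    rw [chartD_self, chartInv_chartF_self] at h2
    rw [← h2] at h1
    refine h1.congr' ?_
    filter_upwards [tl.eventually_mem (target_mem_nhds p)] with ε hε
    exact (dfun_chartD p (hz.smooth _) hε w).symm
  have tn := (tendsto_volE hvol p b).comp tl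
  have tg : Tendsto (fun ε : ℝ => gB p (x ε)) (𝓝[≠] 0) (𝓝 (gB p (chartF p p))) :=
    (contDiffAt_gB p (mem_target_self p)).continuousAt.tendsto.comp tl
  have t0 (j : Fin 4) : Tendsto (fun ε : ℝ => gB p (x ε) (kC (realVec u) p (x ε)) (b j)) (𝓝[≠] 0)
      (𝓝 (met p U (b j))) := by
    have := (tg.clm_apply ((contDiffAt_kC hs (realVec u) p
      (mem_target_self p)).continuousAt.tendsto.comp tl)).clm_apply (tendsto_const_nhds (x := b j))
    rwa [gB_self, kC_self, ← hU] at this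
  have t1 (j : Fin 4) : Tendsto (fun ε : ℝ => ε⁻¹ * gB p (x ε) (kC (realVec v) p (x ε)) (b j))
      (𝓝[≠] 0) (𝓝 (κ * met p (b 3) (b j))) := by
    have h := tendsto_kC_div hs hp (b 2)
    have := (tg.clm_apply h).clm_apply (tendsto_const_nhds (x := b j))
    rw [gB_self, hLX, met_smul_left] at this
    refine this.congr fun ε => ?_
    rw [hxdef, map_smul, smul_apply, smul_eq_mul]
  have t2 (j : Fin 4) : Tendsto
      (fun ε : ℝ => ε⁻¹ * fderiv ℝ (gramDet (realVec u) (realVec v) ∘ chartInv p) (x ε) (b j))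
      (𝓝[≠] 0) (𝓝 (2 * met p U U * κ ^ 2 * met p (b 2) (b j))) := by
    have := tendsto_fderiv_gramDet_div hs hp (d := realVec u) (b 2) (b j) (hU ▸ hUL)
    rw [← hU] at this
    rw [hxdef]
    convert this using 2
    have e1 := hb.lin (b j)
    rw [e1, hLX, met_smul_left, met_smul_right, sub_eq_add_neg, met_add_left, ← neg_smul,
      met_smul_left, met_smul_left, hb.ortho 3 3, hb.ortho 2 3]
    simp
    ring
  have t3 (j : Fin 4) : Tendsto (fun ε : ℝ => gB p (x ε) w (b j)) (𝓝[≠] 0)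
      (𝓝 (met p w (b j))) := by
    have := (tg.clm_apply (tendsto_const_nhds (x := w))).clm_apply
      (tendsto_const_nhds (x := b j))
    rwa [gB_self] at this
  have tdet : Tendsto (fun ε : ℝ => (Matrix.of fun i j : Fin 4 =>
        ![gB p (x ε) (kC (realVec u) p (x ε)) (b j),
          ε⁻¹ * gB p (x ε) (kC (realVec v) p (x ε)) (b j),
          ε⁻¹ * fderiv ℝ (gramDet (realVec u) (realVec v) ∘ chartInv p) (x ε) (b j),
          gB p (x ε) w (b j)] i).det) (𝓝[≠] 0)
      (𝓝 (Matrix.of fun i j : Fin 4 => ![met p U (b j), κ * met p (b 3) (b j),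
        2 * met p U U * κ ^ 2 * met p (b 2) (b j), met p w (b j)] i).det) := by
    have hc : Continuous fun A : Fin 4 → Fin 4 → ℝ => (Matrix.of A).det :=
      Continuous.matrix_det (continuous_id)
    refine (hc.tendsto _).comp (tendsto_pi_nhds.2 fun i => tendsto_pi_nhds.2 fun j => ?_)
    fin_cases i
    · exact t0 j
    · exact t1 j
    · exact t2 j
    · exact t3 j
  have main : met p U U * κ ^ 2 * dfun z p w * volE vol p b = Real.pi / e.β *
      (Matrix.of fun i j : Fin 4 => ![met p U (b j), κ * met p (b 3) (b j),
        2 * met p U U * κ ^ 2 * met p (b 2) (b j), met p w (b j)] i).det := by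
    refine tendsto_nhds_unique_of_eventuallyEq ((tG.mul tz).mul tn)
      (tdet.const_mul (Real.pi / e.β)) ?_
    have hpos : ∀ᶠ ε in 𝓝[≠] (0 : ℝ),
        0 < (ε ^ 2)⁻¹ * gramDet (realVec u) (realVec v) (chartInv p (x ε)) :=
      tG.eventually (lt_mem_nhds (by positivity))
    filter_upwards [hpos, tl.eventually_mem (target_mem_nhds p), self_mem_nhdsWithin]
      with ε hε hxε hε0
    have hε0 : ε ≠ 0 := hε0
    have hG : 0 < gramDet (realVec u) (realVec v) (chartInv p (x ε)) :=
      pos_of_mul_pos_right hε (by positivity)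
    have h1 := gramDet_mul_dfun hs e huv hvol hz hG
      (hasD_dfun (contMDiff_gramDet hs (realVec u) (realVec v) _))
      (fun j => chartD p (x ε) (b j)) (chartD p (x ε) w)
    have h2 : (Matrix.of fun i j : Fin 4 =>
        ![gB p (x ε) (kC (realVec u) p (x ε)) (b j),
          ε⁻¹ * gB p (x ε) (kC (realVec v) p (x ε)) (b j),
          ε⁻¹ * fderiv ℝ (gramDet (realVec u) (realVec v) ∘ chartInv p) (x ε) (b j),
          gB p (x ε) w (b j)] i) = Matrix.of fun i j => (![1, ε⁻¹, ε⁻¹, 1] : Fin 4 → ℝ) i *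
        (Matrix.of fun i j : Fin 4 =>
        ![met (chartInv p (x ε)) (killE (realVec u) (chartInv p (x ε))) (chartD p (x ε) (b j)),
          met (chartInv p (x ε)) (killE (realVec v) (chartInv p (x ε))) (chartD p (x ε) (b j)),
          dfun (gramDet (realVec u) (realVec v)) (chartInv p (x ε)) (chartD p (x ε) (b j)),
          met (chartInv p (x ε)) (chartD p (x ε) w) (chartD p (x ε) (b j))] i) i j := by
      ext i j
      simp only [gB_apply, chartD_kC _ p hxε, dfun_chartD p (contMDiff_gramDet hs (realVec u) (realVec v) _) hxε]
      fin_cases i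
      · exact (one_mul _).symm
      · rfl
      · rfl
      · exact (one_mul _).symm
    rw [h2, Matrix.det_mul_column, Fin.prod_univ_four]
    simp only [Matrix.cons_val_zero, Matrix.cons_val_one, Matrix.cons_val]
    have h3 : gramDet (realVec u) (realVec v) (chartInv p (x ε)) *
      dfun z (chartInv p (x ε)) (chartD p (x ε) w) *
      volE vol (chartInv p (x ε)) (fun j => chartD p (x ε) (b j)) = _ := h1
    show (ε ^ 2)⁻¹ * gramDet (realVec u) (realVec v) (chartInv p (x ε)) *
      dfun z (chartInv p (x ε)) (chartD p (x ε) w) *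
      volE vol (chartInv p (x ε)) (fun j => chartD p (x ε) (b j)) = _
    rw [mul_assoc, mul_assoc, ← mul_assoc (gramDet _ _ _), h3]
    field_simp
  have hvb : volE vol p b ≠ 0 := by
    have := volE_mul_volE hvol p b b
    have e1 : (Matrix.of fun i j => met p (b i) (b j)) = 1 := by
      ext i j; rw [Matrix.of_apply, hb.ortho, Matrix.one_apply]
    rw [e1, Matrix.det_one] at this
    intro h
    rw [h] at this
    simp at this
  have h4 : (Matrix.of fun i j : Fin 4 => ![met p U (b j), κ * met p (b 3) (b j),
        2 * met p U U * κ ^ 2 * met p (b 2) (b j), met p w (b j)] i) =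
      Matrix.of fun i j => (![1, κ, 2 * met p U U * κ ^ 2, 1] : Fin 4 → ℝ) i *
        (Matrix.of fun i j : Fin 4 => met p (![U, b 3, b 2, w] i) (b j)) i j := by
    ext i j
    fin_cases i
    · exact (one_mul _).symm
    · rfl
    · rfl
    · exact (one_mul _).symm
  rw [h4, Matrix.det_mul_column, ← volE_mul_volE hvol, Fin.prod_univ_four] at main
  simp only [Matrix.cons_val_zero, Matrix.cons_val_one, Matrix.cons_val] at main
  have h5 : met p U U * κ ^ 2 * volE vol p b ≠ 0 := by positivity
  apply mul_left_cancel₀ h5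
  rw [mul_right_comm, main]
  ring

end Limit

section Rod

variable {M : Type*} [MetricSpace M] [ChartedSpace E4 M] [IsManifold (𝓡 4) ∞ M]
  [RiemannianBundle (fun x : M => TangentSpace (𝓡 4) x)]
  [IsContMDiffRiemannianBundle (𝓡 4) ∞ E4 (fun x : M => TangentSpace (𝓡 4) x)]
  [AddAction Torus M]
variable (hs : ContMDiff (𝓘(ℝ, ℝ × ℝ).prod (𝓡 4)) (𝓡 4) ∞
    (fun x : (ℝ × ℝ) × M => angles x.1.1 x.1.2 +ᵥ x.2))
variable (hi : ∀ (a : Torus) (p : M) (X Y : TangentSpace (𝓡 4) p),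
    inner ℝ (mfderiv (𝓡 4) (𝓡 4) (fun x : M => a +ᵥ x) p X)
      (mfderiv (𝓡 4) (𝓡 4) (fun x : M => a +ᵥ x) p Y) = inner ℝ X Y)

include hs hi in
theorem dFlat_killing {c : Fin 2 → ℝ} {p : M} (hp : killE c p = 0) (X Y : E4) :
    dFlat (killing c) p X Y = 2 * met p (linK c p X) Y := by
  have key (X Y : E4) : fderiv ℝ (fun x => met (chartInv p x) (killE c (chartInv p x))
      (chartD p x Y)) (chartF p p) X = met p (linK c p X) Y := by
    have dg := ((contDiffAt_gB p (mem_target_self p)).differentiableAt (by simp)).hasFDerivAt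
    have h1 := (dg.clm_apply (hasFDerivAt_kC hs c p)).clm_apply
      (hasFDerivAt_const Y (chartF p p))
    have h2 : (fun x => met (chartInv p x) (killE c (chartInv p x)) (chartD p x Y))
        =ᶠ[𝓝 (chartF p p)] fun x => gB p x (kC c p x) Y := by
      filter_upwards [target_mem_nhds p] with x hx
      rw [gB_apply, chartD_kC c p hx]
    rw [(h1.congr_of_eventuallyEq h2).fderiv, ← gB_self]
    simp [kC_self, hp]
  have e (X : E4) : (mfderiv (𝓡 4) 𝓘(ℝ, E4) (chartF p) p : E4 →L[ℝ] E4) X = X :=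
    congrArg (fun f : E4 →L[ℝ] E4 => f X) (mfderiv_chartF_self p)
  have h1 : dFlat (killing c) p X Y = met p (linK c p X) Y - met p (linK c p Y) X := by
    rw [← key X Y, ← key Y X]
    have e1 := e X
    have e2 := e Y
    show fderiv ℝ (fun x => met (chartInv p x) (killE c (chartInv p x))
      (chartD p x ((mfderiv (𝓡 4) 𝓘(ℝ, E4) (chartF p) p : E4 →L[ℝ] E4) Y))) (chartF p p)
      ((mfderiv (𝓡 4) 𝓘(ℝ, E4) (chartF p) p : E4 →L[ℝ] E4) X) -
      fderiv ℝ (fun x => met (chartInv p x) (killE c (chartInv p x))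
      (chartD p x ((mfderiv (𝓡 4) 𝓘(ℝ, E4) (chartF p) p : E4 →L[ℝ] E4) X))) (chartF p p)
      ((mfderiv (𝓡 4) 𝓘(ℝ, E4) (chartF p) p : E4 →L[ℝ] E4) Y) = _
    rw [e1, e2]
  rw [h1, met_linK hs hi c hp Y X, met_comm p Y]
  ring

variable {vol : ∀ p : M, TangentSpace (𝓡 4) p [⋀^Fin 4]→ₗ[ℝ] ℝ} (hvol : IsVolumeForm vol)

include hs hi in
theorem hodgeStar_dFlat_killing {c : Fin 2 → ℝ} {p : M} (hp : killE c p = 0) {b : Fin 4 → E4}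
    {κ : ℝ} (hb : IsRotationFrame c p b κ) (X Y : E4) :
    hodgeStar vol (dFlat (killing c)) p X Y = 2 * κ * volE vol p ![X, Y, b 2, b 3] := by
  have h := sum_inner_mul_vol (V := TangentSpace (𝓡 4) p) (vol p)
    (stdOrthonormalBasis ℝ (TangentSpace (𝓡 4) p)) (linK c p) κ (b 2) (b 3) hb.lin X Y
  have h2 : hodgeStar vol (dFlat (killing c)) p X Y = (1 / 2) * (4 * κ * volE vol p
      ![X, Y, b 2, b 3]) := by
    refine Eq.trans ?_ (congrArg ((1 / 2 : ℝ) * ·) h)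
    refine congrArg ((1 / 2 : ℝ) * ·) (Finset.sum_congr rfl fun i _ =>
      Finset.sum_congr rfl fun j _ => ?_)
    exact congrArg (· * _) (dFlat_killing hs hi hp _ _)
  rw [h2]
  ring

omit [IsManifold (𝓡 4) ∞ M]
  [IsContMDiffRiemannianBundle (𝓡 4) ∞ E4 (fun x : M => TangentSpace (𝓡 4) x)]
  [AddAction Torus M] in
include hvol in
theorem volE_sq (q : M) (a : Fin 4 → E4) :
    volE vol q a ^ 2 = (Matrix.of fun i j => met q (a i) (a j)).det := hvol.sq_eq q a

variable (e : AFEnd M) {u v : Fin 2 → ℤ} (huv : u 0 * v 1 - u 1 * v 0 = 1)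
  {z : M → ℝ} (hz : e.IsConjugate vol z)

/-- A point over a rod with rod vector `v`, with a frame adapted to the rotation about it. -/
structure IsRodFrame (u v : Fin 2 → ℤ) (p : M) (b : Fin 4 → E4) (κ r : ℝ) : Prop extends
    IsRotationFrame (realVec v) p b κ where
  zero : killE (realVec v) p = 0
  radius_pos : 0 < r
  tangent : b 0 = r • killE (realVec u) p

variable {p : M} {b : Fin 4 → E4} {κ r : ℝ} (hb : IsRodFrame u v p b κ r)

include hs hi in
theorem exists_isRodFrame [ConnectedSpace M]
    (heff : ∀ a : Torus, (∀ p : M, a +ᵥ p = p) → a = 0) (hv : v ≠ 0)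
    (hp : killE (realVec v) p = 0) (hu : killE (realVec u) p ≠ 0) :
    ∃ (b : Fin 4 → E4) (κ r : ℝ), IsRodFrame u v p b κ r := by
  obtain ⟨b, κ, hb, r, hr, hbr⟩ := exists_isRotationFrame hs hi hp
    (fun h => hv (eq_zero_of_linK_eq_zero hs heff v hp h)) hu (linK_killE hs _ _ hp)
  exact ⟨b, κ, r, hb, hp, hr, hbr⟩

include hs hvol huv hz hb

theorem IsRodFrame.dfun_eq (w : E4) :
    dfun z p w = 2 * Real.pi / e.β * κ * volE vol p ![killE (realVec u) p, b 3, b 2, w] :=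
  dfun_eq_of_isRotationFrame hvol hs e huv hz hb.zero hb.toIsRotationFrame hb.radius_pos hb.tangent w

theorem IsRodFrame.dfun_killE : dfun z p (killE (realVec u) p) = 0 := by
  rw [hb.dfun_eq hs hvol e huv hz]
  rw [(volE vol p).map_eq_zero_of_eq _ (i := 0) (j := 3) rfl (by decide), mul_zero]

theorem IsRodFrame.dfun_two : dfun z p (b 2) = 0 := by
  rw [hb.dfun_eq hs hvol e huv hz]
  rw [(volE vol p).map_eq_zero_of_eq _ (i := 2) (j := 3) rfl (by decide), mul_zero]

theorem IsRodFrame.dfun_three : dfun z p (b 3) = 0 := by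
  rw [hb.dfun_eq hs hvol e huv hz]
  rw [(volE vol p).map_eq_zero_of_eq _ (i := 1) (j := 3) rfl (by decide), mul_zero]

theorem IsRodFrame.dfun_zero : dfun z p (b 0) = 0 := by
  rw [hb.tangent, map_smul, hb.dfun_killE hs hvol e huv hz, smul_zero]

theorem IsRodFrame.dfun_one : dfun z p (b 1) ≠ 0 := by
  have hβ := e.β_pos
  have hκ := hb.pos
  have hr := hb.radius_pos
  rw [hb.dfun_eq hs hvol e huv hz]
  have hU : killE (realVec u) p = r⁻¹ • b 0 := by
    rw [hb.tangent, smul_smul, inv_mul_cancel₀ hr.ne', one_smul]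
  have h1 := volE_sq hvol p ![killE (realVec u) p, b 3, b 2, b 1]
  have h2 : volE vol p ![killE (realVec u) p, b 3, b 2, b 1] ≠ 0 := by
    intro h
    rw [h] at h1
    rw [hU] at h1
    have : (Matrix.of fun i j => met p (![r⁻¹ • b 0, b 3, b 2, b 1] i)
        (![r⁻¹ • b 0, b 3, b 2, b 1] j)) = Matrix.diagonal ![r⁻¹ ^ 2, 1, 1, 1] := by
      ext i j
      fin_cases i <;> fin_cases j <;>
        simp [met_smul_left, met_smul_right, hb.ortho, Matrix.diagonal, sq]
    rw [this, Matrix.det_diagonal, Fin.prod_univ_four] at h1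
    simp at h1
    exact (pow_pos hr 2).ne h1
  have := Real.pi_pos
  positivity

include hi in
theorem IsRodFrame.hodgeStar_eq (X : E4) :
    hodgeStar vol (dFlat (killing (realVec v))) p X (killE (realVec u) p) =
      e.β / Real.pi * dfun z p X := by
  have hβ := e.β_pos
  have := Real.pi_pos
  rw [hodgeStar_dFlat_killing hs hi hb.zero hb.toIsRotationFrame, hb.dfun_eq hs hvol e huv hz,
    alternating_rotate (volE vol p) (killE (realVec u) p)]
  field_simp

end Rod

section OffAxis

variable {M : Type*} [MetricSpace M] [ChartedSpace E4 M] [IsManifold (𝓡 4) ∞ M]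
  [RiemannianBundle (fun x : M => TangentSpace (𝓡 4) x)]
  [AddAction Torus M]
variable (hs : ContMDiff (𝓘(ℝ, ℝ × ℝ).prod (𝓡 4)) (𝓡 4) ∞
    (fun x : (ℝ × ℝ) × M => angles x.1.1 x.1.2 +ᵥ x.2))
variable (hi : ∀ (a : Torus) (p : M) (X Y : TangentSpace (𝓡 4) p),
    inner ℝ (mfderiv (𝓡 4) (𝓡 4) (fun x : M => a +ᵥ x) p X)
      (mfderiv (𝓡 4) (𝓡 4) (fun x : M => a +ᵥ x) p Y) = inner ℝ X Y)
  {vol : ∀ p : M, TangentSpace (𝓡 4) p [⋀^Fin 4]→ₗ[ℝ] ℝ} (hvol : IsVolumeForm vol)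
  (e : AFEnd M) {u v : Fin 2 → ℤ} (huv : u 0 * v 1 - u 1 * v 0 = 1)
  {z : M → ℝ} (hz : e.IsConjugate vol z)

include hs hi in
theorem gramDet_flow (c d w : Fin 2 → ℝ) (t : ℝ) (q : M) :
    gramDet c d (flow w t q) = gramDet c d q := by
  rw [gramDet, gramDet, flow, ← dact_killE hs, ← dact_killE hs, met_dact hi, met_dact hi,
    met_dact hi]

include hs huv hz in
theorem dfun_killE_of_gramDet_pos {q : M} (hG : 0 < gramDet (realVec u) (realVec v) q)
    (c : Fin 2 → ℝ) : dfun z q (killE c q) = 0 := by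
  have key (c : Fin 2 → ℝ) (hc : ∃ i : Fin 2, killing c q =
      (![killing (realVec u) q, killing (realVec v) q] : Fin 2 → TangentSpace (𝓡 4) q) i) :
      dfun z q (killE c q) = 0 := by
    have h1 := (hz.dz_eq q (rho_ne_zero hs e huv hG) (killing c q)).trans
      (congrArg ((e.rho q)⁻¹ * ·) (vol_tau_phi hs e huv q (vol q) (grad e.rho q) (killing c q)))
    obtain ⟨i, hi⟩ := hc
    refine h1.trans ?_
    have : vol q ![killing (realVec u) q, killing (realVec v) q, grad e.rho q, killing c q] = 0 := by
      fin_cases i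
      · exact (vol q).map_eq_zero_of_eq _ (i := 0) (j := 3) hi.symm (by decide)
      · exact (vol q).map_eq_zero_of_eq _ (i := 1) (j := 3) hi.symm (by decide)
    simp only [this, mul_zero]
  have h1 := key (realVec u) ⟨0, rfl⟩
  have h2 := key (realVec v) ⟨1, rfl⟩
  have hd := det_real huv
  have h3 : killE c q = (c 0 * v 1 - c 1 * v 0) • killE (realVec u) q +
      (c 1 * u 0 - c 0 * u 1) • killE (realVec v) q := by
    rw [killE_eq hs c, killE_eq hs (realVec u), killE_eq hs (realVec v)]
    simp only [realVec]
    match_scalars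
    · linear_combination (-c 0) * hd
    · linear_combination (-c 1) * hd
  rw [h3, map_add, map_smul, map_smul, h1, h2, smul_zero, smul_zero, add_zero]

include hs hi huv hz in
theorem flow_eq_of_gramDet_pos {q : M} (hG : 0 < gramDet (realVec u) (realVec v) q)
    (c : Fin 2 → ℝ) (t : ℝ) : z (flow c t q) = z q := by
  have h1 (t : ℝ) : HasDerivAt (fun t => z (flow c t q)) 0 t := by
    have := (hasD_dfun (hz.smooth (flow c t q))).comp_hasVel (hasVel_flow hs c q t) rfl
    rw [dfun_killE_of_gramDet_pos hs e huv hz (by rwa [gramDet_flow hs hi]) c] at this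
    exact hasVel_iff_hasDerivAt.1 this
  have := is_const_of_deriv_eq_zero (fun t => (h1 t).differentiableAt) (fun t => (h1 t).deriv) t 0
  simpa using this

end OffAxis

section HalfTurn

variable {M : Type*} [MetricSpace M] [ChartedSpace E4 M] [IsManifold (𝓡 4) ∞ M]
  [RiemannianBundle (fun x : M => TangentSpace (𝓡 4) x)]
  [IsContMDiffRiemannianBundle (𝓡 4) ∞ E4 (fun x : M => TangentSpace (𝓡 4) x)]
  [AddAction Torus M]
variable (hs : ContMDiff (𝓘(ℝ, ℝ × ℝ).prod (𝓡 4)) (𝓡 4) ∞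
    (fun x : (ℝ × ℝ) × M => angles x.1.1 x.1.2 +ᵥ x.2))
  (heff : ∀ a : Torus, (∀ p : M, a +ᵥ p = p) → a = 0)
variable {vol : ∀ p : M, TangentSpace (𝓡 4) p [⋀^Fin 4]→ₗ[ℝ] ℝ} (hvol : IsVolumeForm vol)
  (e : AFEnd M) {u v : Fin 2 → ℤ} (huv : u 0 * v 1 - u 1 * v 0 = 1)
  {z : M → ℝ} (hz : e.IsConjugate vol z)
  {p : M} {b : Fin 4 → E4} {κ r : ℝ} (hb : IsRodFrame u v p b κ r)

include hs hb in
theorem IsRodFrame.exists_int : ∃ k : ℤ, κ = k :=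
  exists_int_of_rotation hs v hb.zero hb.lin_two hb.lin_three
    (by rw [hb.ortho]; simp) (by rw [hb.ortho]; simp)

include hs hb heff huv in
theorem IsRodFrame.cos_sin [ConnectedSpace M] :
    Real.cos (κ * Real.pi) = -1 ∧ Real.sin (κ * Real.pi) = 0 := by
  obtain ⟨k, rfl⟩ := hb.exists_int hs
  have hsin : Real.sin (k * Real.pi) = 0 := Real.sin_int_mul_pi k
  refine ⟨?_, hsin⟩
  have hsq := Real.sin_sq_add_cos_sq (k * Real.pi)
  rw [hsin] at hsq
  have h1 : (Real.cos (k * Real.pi) - 1) * (Real.cos (k * Real.pi) + 1) = 0 := by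
    linear_combination hsq
  rcases mul_eq_zero.1 h1 with h | h
  swap
  · linarith
  exfalso
  have hcos : Real.cos (k * Real.pi) = 1 := by linarith
  have hrot := dflow_rotation hs (realVec v) hb.zero hb.lin_two hb.lin_three Real.pi
  rw [hcos, hsin, zero_smul, zero_smul, neg_zero, one_smul, one_smul, add_zero, zero_add] at hrot
  have hid : dflow (realVec v) Real.pi p = ContinuousLinearMap.id ℝ E4 := by
    apply ContinuousLinearMap.coe_injective
    refine hb.ext fun i => ?_
    fin_cases i
    · exact dflow_eq_id hs _ hb.zero hb.lin_zero _
    · exact dflow_eq_id hs _ hb.zero hb.lin_one _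
    · exact hrot.1
    · exact hrot.2
  have h0 := eq_zero_of_dact_eq_id hs heff (n := 2) (p := p) (by norm_num)
    (by
      rw [nsmul_angles]
      have := angles_two_pi v
      rw [show ((2 : ℕ) : ℝ) * (realVec v 0 * Real.pi) = realVec v 0 * (2 * Real.pi) by
          push_cast; ring,
        show ((2 : ℕ) : ℝ) * (realVec v 1 * Real.pi) = realVec v 1 * (2 * Real.pi) by
          push_cast; ring]
      exact this)
    (flow_eq_self_of_killE_eq_zero hs hb.zero Real.pi) hid
  rw [angles_eq_zero_iff] at h0
  obtain ⟨⟨m, hm⟩, n, hn⟩ := h0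
  simp only [realVec] at hm hn
  have hπ := Real.pi_pos.ne'
  have e0 : v 0 = 2 * m := by
    have : (v 0 : ℝ) = 2 * m := mul_right_cancel₀ hπ (by linear_combination hm)
    exact_mod_cast this
  have e1 : v 1 = 2 * n := by
    have : (v 1 : ℝ) = 2 * n := mul_right_cancel₀ hπ (by linear_combination hn)
    exact_mod_cast this
  rw [e0, e1] at huv
  have : (2 : ℤ) ∣ 1 := ⟨u 0 * n - u 1 * m, by linear_combination -huv⟩
  norm_num at this

include hs hb heff huv in
theorem IsRodFrame.half_turn [ConnectedSpace M] :
    dflow (realVec v) Real.pi p (b 0) = b 0 ∧ dflow (realVec v) Real.pi p (b 1) = b 1 ∧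
    dflow (realVec v) Real.pi p (b 2) = -b 2 ∧ dflow (realVec v) Real.pi p (b 3) = -b 3 := by
  obtain ⟨hc, hsn⟩ := hb.cos_sin hs heff huv
  have hrot := dflow_rotation hs (realVec v) hb.zero hb.lin_two hb.lin_three Real.pi
  rw [hc, hsn, zero_smul, zero_smul, neg_zero, add_zero, zero_add] at hrot
  exact ⟨dflow_eq_id hs _ hb.zero hb.lin_zero _, dflow_eq_id hs _ hb.zero hb.lin_one _,
    by rw [hrot.1, neg_one_smul], by rw [hrot.2, neg_one_smul]⟩

/-- The differential at a rod point of the coordinates adapted to the half turn about the rod. -/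
noncomputable def rodD (z : M → ℝ) (p : M) (b : Fin 4 → E4) : E4 →L[ℝ] (ℝ × ℝ) × (ℝ × ℝ) :=
  ((dfun z p).prod (metL p (b 0))).prod ((metL p (b 2)).prod (metL p (b 3)))

/-- Coordinates near a rod point adapted to the half turn about the rod. -/
noncomputable def rodMap (z : M → ℝ) (v : Fin 2 → ℤ) (p : M) (b : Fin 4 → E4) (q : M) :
    (ℝ × ℝ) × (ℝ × ℝ) :=
  (((2 : ℝ)⁻¹ * (z q + z (flow (realVec v) Real.pi q)),
    metL p (b 0) ((2 : ℝ)⁻¹ • (chartF p q + chartF p (flow (realVec v) Real.pi q)))),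
   (metL p (b 2) ((2 : ℝ)⁻¹ • (chartF p q - chartF p (flow (realVec v) Real.pi q))),
    metL p (b 3) ((2 : ℝ)⁻¹ • (chartF p q - chartF p (flow (realVec v) Real.pi q)))))

theorem rodMap_half_turn (q : M) :
    rodMap z v p b (flow (realVec v) Real.pi q) =
      ((rodMap z v p b q).1, -(rodMap z v p b q).2) := by
  have h : flow (realVec v) Real.pi (flow (realVec v) Real.pi q) = q := by
    rw [← flow_add, ← two_mul, flow_two_pi]
  rw [rodMap, rodMap, h]
  refine Prod.ext (Prod.ext ?_ ?_) (Prod.ext ?_ ?_)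
  · dsimp only; rw [add_comm]
  · dsimp only; rw [add_comm]
  · dsimp only [Prod.neg_mk]; rw [← map_neg, ← smul_neg, neg_sub]
  · dsimp only [Prod.neg_mk]; rw [← map_neg, ← smul_neg, neg_sub]

theorem rodMap_of_fixed {q : M} (h : flow (realVec v) Real.pi q = q) :
    rodMap z v p b q = ((z q, metL p (b 0) (chartF p q)), 0) := by
  rw [rodMap, h]
  refine Prod.ext (Prod.ext ?_ ?_) ?_
  · dsimp only; ring
  · dsimp only; rw [← two_smul ℝ, smul_smul, inv_mul_cancel₀ two_ne_zero, one_smul]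
  · dsimp only; rw [sub_self, smul_zero, map_zero, map_zero]; rfl

include hs hvol huv hz hb heff

theorem IsRodFrame.hasD_rodMap [ConnectedSpace M] :
    HasD (𝓡 4) 𝓘(ℝ, (ℝ × ℝ) × (ℝ × ℝ)) (rodMap z v p b) p (rodD z p b) := by
  have hfix : flow (realVec v) Real.pi p = p := flow_eq_self_of_killE_eq_zero hs hb.zero _
  have hf : HasD (𝓡 4) (𝓡 4) (flow (realVec v) Real.pi) p (dflow (realVec v) Real.pi p) :=
    hasD_vadd hs _ p
  have hc := hasD_chartF_self p
  have hc' := hc.comp hf hfix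
  have hz0 := hasD_dfun (hz.smooth p)
  have hz' := hz0.comp hf hfix
  have hR := hb.half_turn hs heff huv
  have conv {F : Type} [NormedAddCommGroup F] [NormedSpace ℝ F] {f : M → F} {D : E4 →L[ℝ] F}
      (h : HasD (𝓡 4) 𝓘(ℝ, F) f p D) : HasFDerivAt (f ∘ chartInv p) D (chartF p p) := by
    have h1 := h.comp (hasD_chartInv p (mem_target_self p)) (chartInv_chartF_self p)
    rw [chartD_self, ContinuousLinearMap.comp_id] at h1
    exact hasD_iff_hasFDerivAt.1 h1
  have d1 := ((conv hz0).add (conv hz')).const_mul (2 : ℝ)⁻¹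
  have d2 := (metL p (b 0)).hasFDerivAt.comp (chartF p p)
    (((conv hc).add (conv hc')).const_smul (2 : ℝ)⁻¹)
  have d3 := (metL p (b 2)).hasFDerivAt.comp (chartF p p)
    (((conv hc).sub (conv hc')).const_smul (2 : ℝ)⁻¹)
  have d4 := (metL p (b 3)).hasFDerivAt.comp (chartF p p)
    (((conv hc).sub (conv hc')).const_smul (2 : ℝ)⁻¹)
  have d := (d1.prodMk d2).prodMk (d3.prodMk d4)
  have h5 := (hasD_iff_hasFDerivAt.2 d).comp hc rfl
  have h6 : HasD (𝓡 4) 𝓘(ℝ, (ℝ × ℝ) × (ℝ × ℝ)) (rodMap z v p b) p _ := h5.congr (by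
    filter_upwards [source_mem_nhds p] with q hq
    have : chartInv p (chartF p q) = q := (extChartAt (𝓡 4) p).left_inv hq
    simp only [rodMap, Function.comp, Pi.add_apply, Pi.smul_apply, Pi.sub_apply, this])
  convert h6 using 1
  apply ContinuousLinearMap.coe_injective
  refine hb.ext fun i => ?_
  have t2 := hb.dfun_two hs hvol e huv hz
  have t3 := hb.dfun_three hs hvol e huv hz
  have m (i : Fin 4) (X : E4) : metL p (b i) X = met p (b i) X := rfl
  fin_cases i
  · simp [rodD, hR.1, m, hb.ortho, met_add_right, met_smul_right]
    refine ⟨?_, ?_⟩ <;> ring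
  · simp [rodD, hR.2.1, m, hb.ortho, met_add_right, met_smul_right]
    ring
  · simp [rodD, hR.2.2.1, m, hb.ortho, met_add_right, met_smul_right, t2, met_neg_right]
    norm_num
  · simp [rodD, hR.2.2.2, m, hb.ortho, met_add_right, met_smul_right, t3, met_neg_right]
    norm_num

omit heff in
theorem IsRodFrame.rodD_injective : Function.Injective (rodD z p b) := by
  have t := hb.dfun_one hs hvol e huv hz
  have t0 := hb.dfun_zero hs hvol e huv hz
  have t2 := hb.dfun_two hs hvol e huv hz
  have t3 := hb.dfun_three hs hvol e huv hz
  rw [injective_iff_map_eq_zero]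
  intro w hw
  have h1 : dfun z p w = 0 := congrArg (fun x => x.1.1) hw
  have h2 : met p (b 0) w = 0 := congrArg (fun x => x.1.2) hw
  have h3 : met p (b 2) w = 0 := congrArg (fun x => x.2.1) hw
  have h4 : met p (b 3) w = 0 := congrArg (fun x => x.2.2) hw
  have h5 : w = met p (b 1) w • b 1 := by
    conv_lhs => rw [hb.expand w, Fin.sum_univ_four, h2, h3, h4]
    simp
  rw [h5, map_smul, smul_eq_mul] at h1
  rw [h5, (mul_eq_zero.1 h1).resolve_right t, zero_smul]

omit hvol huv heff in
theorem IsRodFrame.eventually_contMDiffAt_rodMap :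
    ∀ᶠ q in 𝓝 p, ContMDiffAt (𝓡 4) 𝓘(ℝ, (ℝ × ℝ) × (ℝ × ℝ)) ∞ (rodMap z v p b) q := by
  have hfix : flow (realVec v) Real.pi p = p := flow_eq_self_of_killE_eq_zero hs hb.zero _
  have hc : Tendsto (flow (realVec v) Real.pi) (𝓝 p) (𝓝 p) := by
    have := (continuous_flow_right hs (realVec v) Real.pi).tendsto p
    rwa [hfix] at this
  filter_upwards [source_mem_nhds p, hc.eventually_mem (source_mem_nhds p)] with q hq hq'
  have hf : ContMDiffAt (𝓡 4) (𝓡 4) ∞ (flow (realVec v) Real.pi) q := contMDiff_vadd hs _ q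
  have h1 := contMDiffAt_chartF p hq
  have h2 := (contMDiffAt_chartF p hq').comp q hf
  have h3 := hz.smooth q
  have h4 := (hz.smooth (flow (realVec v) Real.pi q)).comp q hf
  have hE : ContMDiffAt (𝓡 4) 𝓘(ℝ, (ℝ × ℝ) × (E4 × E4)) ∞
      (fun q => ((z q, z (flow (realVec v) Real.pi q)), (chartF p q,
        chartF p (flow (realVec v) Real.pi q)))) q :=
    (h3.prodMk_space h4).prodMk_space (h1.prodMk_space h2)
  have hS : ContDiff ℝ ∞ (fun x : (ℝ × ℝ) × (E4 × E4) => (((2 : ℝ)⁻¹ * (x.1.1 + x.1.2),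
    metL p (b 0) ((2 : ℝ)⁻¹ • (x.2.1 + x.2.2))), (metL p (b 2) ((2 : ℝ)⁻¹ • (x.2.1 - x.2.2)),
    metL p (b 3) ((2 : ℝ)⁻¹ • (x.2.1 - x.2.2))))) := by fun_prop
  exact hS.contMDiff.contMDiffAt.comp q hE

end HalfTurn

section Norms

variable {M : Type*} [MetricSpace M] [ChartedSpace E4 M] [IsManifold (𝓡 4) ∞ M]
  [RiemannianBundle (fun x : M => TangentSpace (𝓡 4) x)]
  [IsContMDiffRiemannianBundle (𝓡 4) ∞ E4 (fun x : M => TangentSpace (𝓡 4) x)]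
  [AddAction Torus M]
variable (hs : ContMDiff (𝓘(ℝ, ℝ × ℝ).prod (𝓡 4)) (𝓡 4) ∞
    (fun x : (ℝ × ℝ) × M => angles x.1.1 x.1.2 +ᵥ x.2))

include hs in
theorem continuous_met_killE (c : Fin 2 → ℝ) :
    Continuous fun q : M => met q (killE c q) (killE c q) := by
  refine continuous_iff_continuousAt.2 fun p => ContMDiffAt.continuousAt (I := 𝓡 4)
    (I' := 𝓘(ℝ, ℝ)) (n := ∞) (contMDiffAt_of_chartInv p ?_)
  refine (contDiffAt_gB_kC hs c c p (mem_target_self p)).congr_of_eventuallyEq ?_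
  filter_upwards [target_mem_nhds p] with y hy
  rw [gB_apply, chartD_kC c p hy]
  rfl

include hs in
theorem isClosed_killE_eq_zero (c : Fin 2 → ℝ) : IsClosed {q : M | killE c q = 0} := by
  have := isClosed_eq (continuous_met_killE hs c) (continuous_const (y := (0 : ℝ)))
  simpa only [met_self_eq_zero] using this

omit [RiemannianBundle (fun x : M => TangentSpace (𝓡 4) x)]
  [IsContMDiffRiemannianBundle (𝓡 4) ∞ E4 (fun x : M => TangentSpace (𝓡 4) x)] in
include hs in
theorem eventually_dfun_killE_pos {f : M → ℝ} {p : M}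
    (hf : ∀ᶠ q in 𝓝 p, ContMDiffAt (𝓡 4) 𝓘(ℝ, ℝ) ∞ f q) (c : Fin 2 → ℝ)
    (h : 0 < dfun f p (killE c p)) : ∀ᶠ q in 𝓝 p, 0 < dfun f q (killE c q) := by
  have hp := hf.self_of_nhds
  have h1 : ContDiffAt ℝ ∞ (f ∘ chartInv p) (chartF p p) :=
    contDiffAt_comp_chartInv p (mem_target_self p) (by rwa [chartInv_chartF_self])
  have h2 := ((h1.fderiv_right (m := 0) (by simp)).continuousAt.tendsto).clm_apply
    (contDiffAt_kC hs c p (mem_target_self p)).continuousAt.tendsto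
  have e {x : E4} (hx : x ∈ (extChartAt (𝓡 4) p).target)
      (hfx : ContMDiffAt (𝓡 4) 𝓘(ℝ, ℝ) ∞ f (chartInv p x)) :
      fderiv ℝ (f ∘ chartInv p) x (kC c p x) = dfun f (chartInv p x) (killE c (chartInv p x)) := by
    rw [← dfun_chartD p hfx hx, chartD_kC c p hx]
  rw [e (mem_target_self p) (by rwa [chartInv_chartF_self]), chartInv_chartF_self] at h2
  rw [eventually_chart p]
  filter_upwards [h2.eventually (lt_mem_nhds h), target_mem_nhds p, (eventually_chart p).1 hf]
    with x hx hxt hfx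
  rwa [← e hxt hfx]

omit [IsContMDiffRiemannianBundle (𝓡 4) ∞ E4 (fun x : M => TangentSpace (𝓡 4) x)] in
theorem killE_eq_smul_of_gramDet_eq_zero {c d : Fin 2 → ℝ} {q : M} (hc : killE c q ≠ 0)
    (h : gramDet c d q = 0) : ∃ a : ℝ, killE d q = a • killE c q := by
  have hp := met_self_pos q hc
  refine ⟨met q (killE c q) (killE d q) / met q (killE c q) (killE c q), ?_⟩
  obtain ⟨a, ha⟩ : ∃ a, a = met q (killE c q) (killE d q) / met q (killE c q) (killE c q) :=
    ⟨_, rfl⟩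
  rw [← ha, ← sub_eq_zero, ← met_self_eq_zero q, sub_eq_add_neg, ← neg_smul]
  rw [met_add_left, met_add_right, met_add_right, met_smul_left, met_smul_right, met_smul_left,
    met_smul_right, met_comm q (killE d q) (killE c q)]
  rw [gramDet] at h
  rw [ha]
  field_simp
  linear_combination h

end Norms

section Section

variable {M : Type*} [MetricSpace M] [ChartedSpace E4 M] [IsManifold (𝓡 4) ∞ M]
  [RiemannianBundle (fun x : M => TangentSpace (𝓡 4) x)]
  [IsContMDiffRiemannianBundle (𝓡 4) ∞ E4 (fun x : M => TangentSpace (𝓡 4) x)]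
  [AddAction Torus M] [ConnectedSpace M]
variable (hs : ContMDiff (𝓘(ℝ, ℝ × ℝ).prod (𝓡 4)) (𝓡 4) ∞
    (fun x : (ℝ × ℝ) × M => angles x.1.1 x.1.2 +ᵥ x.2))
  (hi : ∀ (a : Torus) (p : M) (X Y : TangentSpace (𝓡 4) p),
    inner ℝ (mfderiv (𝓡 4) (𝓡 4) (fun x : M => a +ᵥ x) p X)
      (mfderiv (𝓡 4) (𝓡 4) (fun x : M => a +ᵥ x) p Y) = inner ℝ X Y)
  (heff : ∀ a : Torus, (∀ p : M, a +ᵥ p = p) → a = 0)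
variable {vol : ∀ p : M, TangentSpace (𝓡 4) p [⋀^Fin 4]→ₗ[ℝ] ℝ} (hvol : IsVolumeForm vol)
  (e : AFEnd M) {u v : Fin 2 → ℤ} (huv : u 0 * v 1 - u 1 * v 0 = 1)
  {z : M → ℝ} (hz : e.IsConjugate vol z)
  {p : M} {b : Fin 4 → E4} {κ r : ℝ} (hb : IsRodFrame u v p b κ r)

include hs heff hvol huv hz hb in
theorem IsRodFrame.exists_coords :
    (∃ N ∈ 𝓝 p, InjOn (rodMap z v p b) N) ∧
    (∀ᶠ q in 𝓝 p, ∀ D' : E4 →L[ℝ] (ℝ × ℝ) × (ℝ × ℝ),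
      HasD (𝓡 4) 𝓘(ℝ, (ℝ × ℝ) × (ℝ × ℝ)) (rodMap z v p b) q D' → Function.Injective D') ∧
    ∃ g : (ℝ × ℝ) × (ℝ × ℝ) → M, g (rodMap z v p b p) = p ∧
      ∀ᶠ y in 𝓝 (rodMap z v p b p), ContMDiffAt 𝓘(ℝ, (ℝ × ℝ) × (ℝ × ℝ)) (𝓡 4) ∞ g y ∧
        rodMap z v p b (g y) = y := by
  let D := (LinearEquiv.ofInjectiveOfFinrankEq (rodD z p b : E4 →ₗ[ℝ] (ℝ × ℝ) × (ℝ × ℝ))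
    (hb.rodD_injective hs hvol e huv hz) (by simp)).toContinuousLinearEquiv
  refine exists_local_inverse (hb.eventually_contMDiffAt_rodMap hs e hz) D ?_
  have hD : (D : E4 →L[ℝ] (ℝ × ℝ) × (ℝ × ℝ)) = rodD z p b := by ext1 w; rfl
  rw [hD]
  exact hb.hasD_rodMap hs heff hvol e huv hz

include hb in
theorem IsRodFrame.killE_ne_zero : killE (realVec u) p ≠ 0 := by
  intro h
  have := hb.ortho 0 0
  rw [hb.tangent, h, smul_zero] at this
  simp at this

include hb in
theorem IsRodFrame.met_zero_killE : met p (b 0) (killE (realVec u) p) = r⁻¹ := by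
  have hU : killE (realVec u) p = r⁻¹ • b 0 := by
    rw [hb.tangent, smul_smul, inv_mul_cancel₀ hb.radius_pos.ne', one_smul]
  rw [hU, met_smul_right, hb.ortho]
  simp

include hs heff hvol huv hz hb in
/-- Along the torus orbits the second adapted coordinate increases. -/
theorem IsRodFrame.eventually_dfun_pos :
    (∀ᶠ q in 𝓝 p, ContMDiffAt (𝓡 4) 𝓘(ℝ, ℝ) ∞ (fun q => (rodMap z v p b q).1.2) q) ∧
    ∀ᶠ q in 𝓝 p, 0 < dfun (fun q => (rodMap z v p b q).1.2) q (killE (realVec u) q) := by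
  have h0 : ∀ᶠ q in 𝓝 p, ContMDiffAt (𝓡 4) 𝓘(ℝ, ℝ) ∞ (fun q => (rodMap z v p b q).1.2) q := by
    filter_upwards [hb.eventually_contMDiffAt_rodMap hs e hz] with q hq
    have h : ContDiff ℝ ∞ (fun x : (ℝ × ℝ) × (ℝ × ℝ) => x.1.2) := by fun_prop
    exact h.contMDiff.contMDiffAt.comp q hq
  refine ⟨h0, eventually_dfun_killE_pos hs h0 _ ?_⟩
  let ℓ : (ℝ × ℝ) × (ℝ × ℝ) →L[ℝ] ℝ :=
    (ContinuousLinearMap.snd ℝ ℝ ℝ).comp (ContinuousLinearMap.fst ℝ (ℝ × ℝ) (ℝ × ℝ))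
  have h1 := (hasD_iff_hasFDerivAt.2 ℓ.hasFDerivAt).comp
    (hb.hasD_rodMap hs heff hvol e huv hz) rfl
  have h2 : dfun (fun q => (rodMap z v p b q).1.2) p = ℓ.comp (rodD z p b) := h1.mfderiv_eq
  rw [h2]
  show 0 < met p (b 0) (killE (realVec u) p)
  rw [hb.met_zero_killE]
  exact inv_pos.2 hb.radius_pos

include hs hi heff hvol huv hz hb in
/-- Near a rod, the fixed points of the half turn lie over the rod. -/
theorem IsRodFrame.eventually_killE_eq_zero :
    ∀ᶠ q in 𝓝 p, flow (realVec v) Real.pi q = q → killE (realVec v) q = 0 := by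
  obtain ⟨-, hinj, -⟩ := hb.exists_coords hs heff hvol e huv hz
  obtain ⟨hsm, hpos⟩ := hb.eventually_dfun_pos hs heff hvol e huv hz
  have hP := (hinj.and (hb.eventually_contMDiffAt_rodMap hs e hz)).and (hsm.and hpos)
  have htube : ∀ᶠ q in 𝓝 p, ∀ t ∈ Icc (0 : ℝ) (2 * Real.pi),
      ((∀ D' : E4 →L[ℝ] (ℝ × ℝ) × (ℝ × ℝ),
        HasD (𝓡 4) 𝓘(ℝ, (ℝ × ℝ) × (ℝ × ℝ)) (rodMap z v p b) (flow (realVec v) t q) D' →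
        Function.Injective D') ∧ ContMDiffAt (𝓡 4) 𝓘(ℝ, (ℝ × ℝ) × (ℝ × ℝ)) ∞
          (rodMap z v p b) (flow (realVec v) t q)) ∧
      ContMDiffAt (𝓡 4) 𝓘(ℝ, ℝ) ∞ (fun q => (rodMap z v p b q).1.2) (flow (realVec v) t q) ∧
      0 < dfun (fun q => (rodMap z v p b q).1.2) (flow (realVec v) t q)
        (killE (realVec u) (flow (realVec v) t q)) := by
    refine isCompact_Icc.eventually_forall_of_forall_eventually fun t _ => ?_
    have h1 : Tendsto (fun x : M × ℝ => flow (realVec v) x.2 x.1) (𝓝 (p, t)) (𝓝 p) := by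
      have h2 : Continuous (fun x : M × ℝ => flow (realVec v) x.2 x.1) :=
        (continuous_flow hs (realVec v)).comp (continuous_snd.prodMk continuous_fst)
      have h3 := h2.tendsto (p, t)
      rwa [flow_eq_self_of_killE_eq_zero hs hb.zero t] at h3
    exact h1.eventually hP
  filter_upwards [htube] with q hq hfix
  have hfix' (t : ℝ) : flow (realVec v) Real.pi (flow (realVec v) t q) = flow (realVec v) t q := by
    rw [← flow_add, add_comm, flow_add, hfix]
  obtain ⟨h, hh⟩ : ∃ h : M → ℝ, h = fun q => (rodMap z v p b q).1.2 := ⟨_, rfl⟩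
  simp only [← hh] at hq
  have hvel (t : ℝ) := hasVel_flow hs (realVec v) q t
  have hcont : ContinuousOn (fun t => h (flow (realVec v) t q)) (Icc 0 (2 * Real.pi)) :=
    fun t ht => (ContinuousAt.comp (f := fun t => flow (realVec v) t q) (x := t) (g := h)
      (hq t ht).2.1.continuousAt (hvel t).continuousAt).continuousWithinAt
  obtain ⟨t₀, ht₀, hmax⟩ := isCompact_Icc.exists_isMaxOn
    (nonempty_Icc.2 (by positivity)) hcont
  have hper : Function.Periodic (fun t => h (flow (realVec v) t q)) (2 * Real.pi) := by
    intro t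
    dsimp only
    rw [flow_add, flow_two_pi]
  have hloc : IsLocalMax (fun t => h (flow (realVec v) t q)) t₀ := by
    refine Eventually.of_forall fun t => ?_
    obtain ⟨s, hs', hst⟩ := hper.exists_mem_Ico₀ (by positivity) t
    have := hmax (Ico_subset_Icc_self hs')
    exact hst.trans_le this
  obtain ⟨⟨hDinj, hsmooth⟩, hsm', hpos'⟩ := hq t₀ ht₀
  obtain ⟨q₀, hq₀⟩ : ∃ q₀, q₀ = flow (realVec v) t₀ q := ⟨_, rfl⟩
  have hd : HasDerivAt (fun t => h (flow (realVec v) t q)) (dfun h q₀ (killE (realVec v) q₀)) t₀ :=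
    hasVel_iff_hasDerivAt.1 (hq₀ ▸ (hasD_dfun hsm').comp_hasVel (hvel t₀) rfl)
  have hd0 := hloc.hasDerivAt_eq_zero hd
  rw [← hq₀] at hDinj hsmooth hsm' hpos'
  suffices hv0 : killE (realVec v) q₀ = 0 by
    rwa [hq₀, killE_flow_eq_zero_iff hs] at hv0
  rcases (gramDet_nonneg (realVec u) (realVec v) q₀).eq_or_lt' with hG | hG
  · have hu0 : killE (realVec u) q₀ ≠ 0 := by
      intro h0
      rw [h0, map_zero] at hpos'
      exact lt_irrefl _ hpos'
    obtain ⟨a, ha⟩ := killE_eq_smul_of_gramDet_eq_zero hu0 hG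
    rw [ha, map_smul, smul_eq_mul] at hd0
    rw [ha, (mul_eq_zero.1 hd0).resolve_right hpos'.ne', zero_smul]
  · obtain ⟨D', hD'⟩ := exists_hasD hsmooth
    apply hDinj D' hD'
    rw [map_zero]
    have hd1 : HasDerivAt (fun t => rodMap z v p b (flow (realVec v) t q))
        (D' (killE (realVec v) q₀)) t₀ := by
      have h1 := hvel t₀
      rw [← hq₀] at h1
      exact hasVel_iff_hasDerivAt.1 (hD'.comp_hasVel h1 hq₀.symm)
    have hd2 : HasDerivAt (fun t => rodMap z v p b (flow (realVec v) t q))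
        ((0, 0), 0) t₀ := by
      have e1 : (fun t => rodMap z v p b (flow (realVec v) t q)) =
          fun t => ((z q, h (flow (realVec v) t q)), (0 : ℝ × ℝ)) := by
        ext1 t
        have hGq : 0 < gramDet (realVec u) (realVec v) q := by
          rwa [hq₀, gramDet_flow hs hi] at hG
        rw [hh]
        simp only [rodMap_of_fixed (hfix' t), flow_eq_of_gramDet_pos hs hi e huv hz hGq]
      rw [e1]
      rw [hd0] at hd
      exact ((hasDerivAt_const t₀ (z q)).prodMk hd).prodMk (hasDerivAt_const t₀ 0)
    exact hd1.unique hd2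

include hs hi heff hvol huv hz in
theorem flow_eq_of_killE_eq_zero {q : M} (hq : killE (realVec v) q = 0) (t : ℝ) :
    z (flow (realVec u) t q) = z q := by
  have hv : v ≠ 0 := by
    rintro rfl
    simp at huv
  have h1 (t : ℝ) : HasDerivAt (fun t => z (flow (realVec u) t q)) 0 t := by
    have := (hasD_dfun (hz.smooth (flow (realVec u) t q))).comp_hasVel (hasVel_flow hs _ q t) rfl
    have hz0 : dfun z (flow (realVec u) t q) (killE (realVec u) (flow (realVec u) t q)) = 0 := by
      by_cases h0 : killE (realVec u) (flow (realVec u) t q) = 0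
      · rw [h0, map_zero]
      · obtain ⟨b, κ, r, hb⟩ := exists_isRodFrame hs hi heff hv
          ((killE_flow_eq_zero_iff hs _ _ q t).2 hq) h0
        exact hb.dfun_killE hs hvol e huv hz
    rw [hz0] at this
    exact hasVel_iff_hasDerivAt.1 this
  have := is_const_of_deriv_eq_zero (fun t => (h1 t).differentiableAt) (fun t => (h1 t).deriv) t 0
  simpa using this

include hs hi heff hvol huv hz hb in
/-- Over a rod, the torus orbits are locally parametrised by `z`. -/
theorem IsRodFrame.exists_section : ∃ γ : ℝ → M, γ (z p) = p ∧
    (∀ᶠ s in 𝓝 (z p), ContMDiffAt 𝓘(ℝ, ℝ) (𝓡 4) ∞ γ s ∧ z (γ s) = s ∧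
      killE (realVec v) (γ s) = 0) ∧
    ∀ᶠ q in 𝓝 p, killE (realVec v) q = 0 → ∃ t, flow (realVec u) t (γ (z q)) = q := by
  obtain ⟨⟨N, hN, hNinj⟩, -, g, hgp, hg⟩ := hb.exists_coords hs heff hvol e huv hz
  obtain ⟨hsm, hpos⟩ := hb.eventually_dfun_pos hs heff hvol e huv hz
  have hfixp : flow (realVec v) Real.pi p = p := flow_eq_self_of_killE_eq_zero hs hb.zero _
  obtain ⟨h, hh⟩ : ∃ h : M → ℝ, h = fun q => (rodMap z v p b q).1.2 := ⟨_, rfl⟩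
  rw [← hh] at hsm hpos
  have hmap {q : M} (hq : flow (realVec v) Real.pi q = q) : rodMap z v p b q = ((z q, h q), 0) := by
    rw [hh]
    simp only [rodMap_of_fixed hq]
  let ι : ℝ → (ℝ × ℝ) × (ℝ × ℝ) := fun s => ((s, h p), 0)
  have hι : ContDiff ℝ ∞ ι := by fun_prop
  have hιp : ι (z p) = rodMap z v p b p := (hmap hfixp).symm
  have hιt : Tendsto ι (𝓝 (z p)) (𝓝 (rodMap z v p b p)) := by
    have := hι.continuous.tendsto (z p)
    rwa [hιp] at this
  let γ : ℝ → M := g ∘ ι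
  have hγp : γ (z p) = p := by
    show g (ι (z p)) = p
    rw [hιp, hgp]
  have hgc : Tendsto g (𝓝 (rodMap z v p b p)) (𝓝 p) := by
    have := hg.self_of_nhds.1.continuousAt.tendsto
    rwa [hgp] at this
  have hγt : Tendsto γ (𝓝 (z p)) (𝓝 p) := hgc.comp hιt
  have hat : Tendsto (flow (realVec v) Real.pi) (𝓝 p) (𝓝 p) := by
    have := (continuous_flow_right hs (realVec v) Real.pi).tendsto p
    rwa [hfixp] at this
  have hγ : ∀ᶠ s in 𝓝 (z p), ContMDiffAt 𝓘(ℝ, ℝ) (𝓡 4) ∞ γ s ∧ z (γ s) = s ∧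
      killE (realVec v) (γ s) = 0 := by
    filter_upwards [hιt.eventually hg, hγt.eventually_mem hN,
      (hat.comp hγt).eventually_mem hN,
      hγt.eventually (hb.eventually_killE_eq_zero hs hi heff hvol e huv hz)] with s h1 h2 h3 h4
    have h5 : rodMap z v p b (γ s) = ι s := h1.2
    have h6 : flow (realVec v) Real.pi (γ s) = γ s := by
      refine hNinj h3 h2 ?_
      rw [Function.comp, rodMap_half_turn, h5]
      simp [ι]
    refine ⟨h1.1.comp s hι.contMDiff.contMDiffAt, ?_, h4 h6⟩
    rw [hmap h6] at h5
    exact congrArg (fun x => x.1.1) h5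
  refine ⟨γ, hγp, hγ, ?_⟩
  -- a box around `p` in which the flow of `u` is monotone
  have hslope : ∀ᶠ t in 𝓝[≠] (0 : ℝ), 0 < t⁻¹ • (h (flow (realVec u) (0 + t) p)
      - h (flow (realVec u) 0 p)) := by
    have h1 : HasDerivAt (fun t => h (flow (realVec u) t p))
        (dfun h p (killE (realVec u) p)) 0 :=
      hasVel_iff_hasDerivAt.1 ((hasD_dfun hsm.self_of_nhds).comp_hasVel
        (hasVel_flow_zero hs _ p) (flow_zero _ p))
    exact (hasDerivAt_iff_tendsto_slope_zero.1 h1).eventually (lt_mem_nhds hpos.self_of_nhds)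
  have hbox : ∀ᶠ x : ℝ × ℝ in 𝓝 (0, z p), flow (realVec u) x.1 (γ x.2) ∈ N ∧
      ContMDiffAt (𝓡 4) 𝓘(ℝ, ℝ) ∞ h (flow (realVec u) x.1 (γ x.2)) := by
    have h1 : Tendsto (fun x : ℝ × ℝ => flow (realVec u) x.1 (γ x.2)) (𝓝 (0, z p)) (𝓝 p) := by
      have h2 := ((continuous_flow hs (realVec u)).tendsto (0, p)).comp
        ((continuous_fst.tendsto ((0 : ℝ), z p)).prodMk_nhds
          (hγt.comp (continuous_snd.tendsto ((0 : ℝ), z p))))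
      simpa [Function.comp_def] using h2
    exact (h1.eventually_mem hN).and (h1.eventually hsm)
  rw [eventually_nhdsWithin_iff] at hslope
  obtain ⟨δ₁, hδ₁, hδ₁'⟩ := Metric.eventually_nhds_iff.1 hslope
  obtain ⟨δ₂, hδ₂, hδ₂'⟩ := Metric.eventually_nhds_iff.1 hbox
  obtain ⟨δ, hδ, hδ1, hδ2⟩ : ∃ δ, 0 < δ ∧ δ < δ₁ ∧ δ < δ₂ :=
    ⟨min δ₁ δ₂ / 2, by positivity, by
      have := min_le_left δ₁ δ₂
      have : 0 < min δ₁ δ₂ := by positivity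
      linarith, by
      have := min_le_right δ₁ δ₂
      have : 0 < min δ₁ δ₂ := by positivity
      linarith⟩
  have hup : h p < h (flow (realVec u) δ p) := by
    have := hδ₁' (y := δ) (by simpa [abs_of_pos hδ] using hδ1) hδ.ne'
    rw [zero_add, flow_zero, smul_eq_mul] at this
    have := pos_of_mul_pos_right this (inv_pos.2 hδ).le
    linarith
  have hdown : h (flow (realVec u) (-δ) p) < h p := by
    have := hδ₁' (y := -δ) (by simpa [abs_of_pos hδ] using hδ1) (neg_ne_zero.2 hδ.ne')
    rw [zero_add, flow_zero, smul_eq_mul, inv_neg, neg_mul, ← mul_neg] at this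
    have := pos_of_mul_pos_right this (inv_pos.2 hδ).le
    linarith
  have hzt : Tendsto z (𝓝 p) (𝓝 (z p)) := hz.smooth.continuous.tendsto p
  have hend (t : ℝ) (ht : |t| ≤ δ) :
      Tendsto (fun q => h (flow (realVec u) t (γ (z q)))) (𝓝 p) (𝓝 (h (flow (realVec u) t p))) := by
    have h1 : ContMDiffAt (𝓡 4) 𝓘(ℝ, ℝ) ∞ h (flow (realVec u) t p) := by
      have := (hδ₂' (y := (t, z p)) (by
        rw [Prod.dist_eq]
        refine max_lt ?_ (by simpa using hδ₂)
        simpa using ht.trans_lt hδ2)).2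
      rwa [hγp] at this
    exact (h1.continuousAt.tendsto).comp (((continuous_flow_right hs (realVec u) t).tendsto p).comp
      (hγt.comp hzt))
  have hhp : Tendsto h (𝓝 p) (𝓝 (h p)) := hsm.self_of_nhds.continuousAt.tendsto
  filter_upwards [hhp.eventually_lt (hend δ (abs_of_pos hδ).le) hup,
    (hend (-δ) (by rw [abs_neg, abs_of_pos hδ])).eventually_lt hhp hdown, hN,
    hzt.eventually hγ, hzt.eventually (Metric.ball_mem_nhds (z p) hδ₂)] with q h1 h2 h3 h4 h5 hq
  have hin (t : ℝ) (ht : t ∈ Icc (-δ) δ) := hδ₂' (y := (t, z q)) (by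
    rw [Prod.dist_eq]
    refine max_lt ?_ h5
    simpa using (abs_le.2 ht).trans_lt hδ2)
  have hcont : ContinuousOn (fun t => h (flow (realVec u) t (γ (z q)))) (Icc (-δ) δ) :=
    fun t ht => (ContinuousAt.comp (f := fun t => flow (realVec u) t (γ (z q))) (x := t) (g := h)
      (hin t ht).2.continuousAt
      (hasVel_flow hs (realVec u) (γ (z q)) t).continuousAt).continuousWithinAt
  obtain ⟨t, ht, hht⟩ := intermediate_value_Icc (by linarith) hcont ⟨h2.le, h1.le⟩
  refine ⟨t, hNinj (hin t ht).1 h3 ?_⟩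
  have hv' : killE (realVec v) (flow (realVec u) t (γ (z q))) = 0 :=
    (killE_flow_eq_zero_iff hs _ _ _ t).2 h4.2.2
  rw [hmap (flow_eq_self_of_killE_eq_zero hs hv' _), hmap (flow_eq_self_of_killE_eq_zero hs hq _)]
  rw [flow_eq_of_killE_eq_zero hs hi heff hvol e huv hz h4.2.2, h4.2.1]
  exact congrArg (fun y => ((z q, y), (0 : ℝ × ℝ))) hht

end Section

theorem exists_cos_sin_of_sq_add_sq {c s : ℝ} (h : c ^ 2 + s ^ 2 = 1) :
    ∃ θ, Real.cos θ = c ∧ Real.sin θ = s := by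
  have hn : ‖(⟨c, s⟩ : ℂ)‖ = 1 := by
    rw [Complex.norm_def, Complex.normSq_mk, Real.sqrt_eq_one]
    linarith
  refine ⟨Complex.arg ⟨c, s⟩, ?_, ?_⟩
  · simpa [hn] using Complex.norm_mul_cos_arg ⟨c, s⟩
  · simpa [hn] using Complex.norm_mul_sin_arg ⟨c, s⟩

section Free

variable {M : Type*} [MetricSpace M] [ChartedSpace E4 M] [IsManifold (𝓡 4) ∞ M]
  [AddAction Torus M]
variable (hs : ContMDiff (𝓘(ℝ, ℝ × ℝ).prod (𝓡 4)) (𝓡 4) ∞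
    (fun x : (ℝ × ℝ) × M => angles x.1.1 x.1.2 +ᵥ x.2))

include hs in
/-- The period of an integral Killing field along a nontrivial orbit is a rational multiple of
`2π`. -/
theorem exists_nat_mul_period {w : Fin 2 → ℤ} {p : M} (hp : killE (realVec w) p ≠ 0) {t : ℝ}
    (ht : flow (realVec w) t p = p) : ∃ (m : ℕ) (k : ℤ), m ≠ 0 ∧ m * t = k * (2 * Real.pi) := by
  let A : AddSubgroup ℝ :=
    { carrier := {t | flow (realVec w) t p = p}
      zero_mem' := flow_zero _ _
      add_mem' := fun {a b} ha hb => by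
        have ha : flow (realVec w) a p = p := ha
        have hb : flow (realVec w) b p = p := hb
        show flow (realVec w) (a + b) p = p
        rw [flow_add, hb, ha]
      neg_mem' := fun {a} ha => by
        have ha : flow (realVec w) a p = p := ha
        show flow (realVec w) (-a) p = p
        conv_lhs => rw [← ha, ← flow_add, neg_add_cancel, flow_zero] }
  have hcl : IsClosed (A : Set ℝ) :=
    isClosed_eq (contMDiff_flow_left hs (realVec w) p).continuous continuous_const
  have h2π : 2 * Real.pi ∈ A := flow_two_pi w p
  have htA : t ∈ A := ht
  rcases A.dense_or_cyclic with h | ⟨a, ha⟩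
  · exfalso
    have huniv := hcl.closure_eq ▸ h.closure_eq
    have h1 : (fun t => flow (realVec w) t p) = fun _ => p := by
      ext1 t
      have : t ∈ (A : Set ℝ) := huniv ▸ mem_univ t
      exact this
    have h2 := hasVel_flow_zero hs (realVec w) p
    rw [h1] at h2
    have h3 : HasVel (𝓡 4) (fun _ : ℝ => p) 0 0 := by
      rw [HasVel, show ContinuousLinearMap.toSpanSingleton ℝ (0 : E4) = 0 by ext1; simp]
      exact hasMFDerivAt_const p 0
    exact hp (h2.unique h3)
  · rw [← AddSubgroup.zmultiples_eq_closure] at ha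
    rw [ha, AddSubgroup.mem_zmultiples_iff] at h2π htA
    obtain ⟨m, hm⟩ := h2π
    obtain ⟨k, hk⟩ := htA
    rw [zsmul_eq_mul] at hm hk
    have hm0 : m ≠ 0 := by
      rintro rfl
      have := Real.pi_pos
      simp at hm
    refine ⟨m.natAbs, m.sign * k, by simpa using hm0, ?_⟩
    rw [← hk, ← hm, Nat.cast_natAbs, ← Int.sign_mul_self_eq_abs]
    push_cast
    ring

variable [RiemannianBundle (fun x : M => TangentSpace (𝓡 4) x)]
  [IsContMDiffRiemannianBundle (𝓡 4) ∞ E4 (fun x : M => TangentSpace (𝓡 4) x)]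
  [ConnectedSpace M]
  (hi : ∀ (a : Torus) (p : M) (X Y : TangentSpace (𝓡 4) p),
    inner ℝ (mfderiv (𝓡 4) (𝓡 4) (fun x : M => a +ᵥ x) p X)
      (mfderiv (𝓡 4) (𝓡 4) (fun x : M => a +ᵥ x) p Y) = inner ℝ X Y)
  (heff : ∀ a : Torus, (∀ p : M, a +ᵥ p = p) → a = 0)
variable {vol : ∀ p : M, TangentSpace (𝓡 4) p [⋀^Fin 4]→ₗ[ℝ] ℝ} (hvol : IsVolumeForm vol)
  (e : AFEnd M) {u v : Fin 2 → ℤ} (huv : u 0 * v 1 - u 1 * v 0 = 1)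
  {z : M → ℝ} (hz : e.IsConjugate vol z)
  {p : M} {b : Fin 4 → E4} {κ r : ℝ} (hb : IsRodFrame u v p b κ r)

include hs hi heff hvol huv hz hb in
theorem IsRodFrame.dflow_eq {t : ℝ} (ht : flow (realVec u) t p = p) :
    ∃ s, dflow (realVec u) t p = dflow (realVec v) s p := by
  obtain ⟨B, hB⟩ : ∃ B, B = dflow (realVec u) t p := ⟨_, rfl⟩
  rw [← hB]
  have hκ := hb.pos.ne'
  have hlin (w : E4) : B (linK (realVec v) p w) = linK (realVec v) p (B w) := by
    rw [hB]; exact dact_linK hs _ hb.zero ht w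
  have hmet (X Y : E4) : met p (B X) (B Y) = met p X Y := by
    have := met_dact hi (angles (realVec u 0 * t) (realVec u 1 * t)) p X Y
    rw [show angles (realVec u 0 * t) (realVec u 1 * t) +ᵥ p = p from ht] at this
    rw [hB]; exact this
  have hB0 : B (b 0) = b 0 := by
    have : B (killE (realVec u) p) = killE (realVec u) p := by
      rw [hB, dflow, dact_killE hs]
      exact congrArg (killE (realVec u)) ht
    rw [hb.tangent, map_smul, this]
  obtain ⟨c, hc⟩ : ∃ c, c = met p (b 2) (B (b 2)) := ⟨_, rfl⟩
  obtain ⟨s, hs'⟩ : ∃ s, s = met p (b 3) (B (b 2)) := ⟨_, rfl⟩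
  have hB3 : B (b 3) = c • b 3 - s • b 2 := by
    have := hlin (b 2)
    rw [hb.lin_two, map_smul, hb.lin, ← hc, ← hs'] at this
    exact smul_right_injective E4 hκ this
  have hB2 : B (b 2) = c • b 2 + s • b 3 := by
    have := hlin (b 3)
    rw [hb.lin_three, map_neg, map_smul, hb.lin, hB3, ← smul_neg] at this
    have := smul_right_injective E4 hκ this
    simp only [sub_eq_add_neg, ← neg_smul, met_add_right, met_smul_right, hb.ortho] at this
    rw [← neg_inj, this]
    simp
  have hB1 : B (b 1) = met p (b 1) (B (b 1)) • b 1 := by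
    have h1 := hlin (b 1)
    rw [hb.lin_one, map_zero, hb.lin] at h1
    have h2 := (smul_eq_zero.1 h1.symm).resolve_left hκ
    have e3 := congrArg (met p (b 3)) h2
    have e2 := congrArg (met p (b 2)) h2
    simp only [sub_eq_add_neg, ← neg_smul, met_add_right, met_smul_right, hb.ortho,
      met_zero_right] at e2 e3
    have e0 : met p (b 0) (B (b 1)) = 0 := by
      rw [← hB0, hmet, hb.ortho]; simp
    simp at e2 e3
    conv_lhs => rw [hb.expand (B (b 1)), Fin.sum_univ_four, e0, e2, e3]
    simp
  have hε : met p (b 1) (B (b 1)) = 1 := by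
    obtain ⟨ε, hε⟩ : ∃ ε, ε = met p (b 1) (B (b 1)) := ⟨_, rfl⟩
    rw [← hε] at hB1 ⊢
    obtain ⟨γ, hγp, hγ, -⟩ := hb.exists_section hs hi heff hvol e huv hz
    obtain ⟨D, hD⟩ := exists_hasD hγ.self_of_nhds.1
    have hvel := hD.hasVel
    obtain ⟨w, hw⟩ : ∃ w, w = D 1 := ⟨_, rfl⟩
    rw [← hw] at hvel
    have hid : HasVel 𝓘(ℝ, ℝ) (fun s : ℝ => s) (z p) 1 :=
      hasVel_iff_hasDerivAt.2 (hasDerivAt_id _)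
    have h1 : dfun z p w = 1 := by
      have h := (hasD_dfun (hz.smooth p)).comp_hasVel hvel hγp
      exact h.unique (HasD.congr hid (by filter_upwards [hγ] with s hs; exact hs.2.1))
    have h2 : dfun z p (B w) = 1 := by
      rw [hB]
      have h := (hasD_dfun (hz.smooth p)).comp_hasVel
        ((hasD_vadd hs (angles (realVec u 0 * t) (realVec u 1 * t)) p).comp_hasVel hvel hγp)
        (by rw [Function.comp, hγp]; exact ht)
      refine h.unique (HasD.congr hid ?_)
      filter_upwards [hγ] with s h
      exact (flow_eq_of_killE_eq_zero hs hi heff hvol e huv hz h.2.2 t).trans h.2.1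
    have t0 := hb.dfun_zero hs hvol e huv hz
    have t2 := hb.dfun_two hs hvol e huv hz
    have t3 := hb.dfun_three hs hvol e huv hz
    rw [hb.expand w, Fin.sum_univ_four] at h1 h2
    simp only [map_add, map_smul, hB0, hB1, hB2, hB3, map_sub, t0, t2, t3, smul_eq_mul] at h1 h2
    linear_combination h2 - ε * h1
  rw [hε, one_smul] at hB1
  have hcs : c ^ 2 + s ^ 2 = 1 := by
    have := hmet (b 2) (b 2)
    rw [hB2] at this
    simp only [met_add_right, met_add_left, met_smul_right, met_smul_left, hb.ortho] at this
    simp at this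
    linear_combination this
  obtain ⟨θ, hθc, hθs⟩ := exists_cos_sin_of_sq_add_sq hcs
  have hrot := dflow_rotation hs (realVec v) hb.zero hb.lin_two hb.lin_three (θ / κ)
  rw [mul_div_cancel₀ _ hκ, hθc, hθs] at hrot
  refine ⟨θ / κ, ?_⟩
  apply ContinuousLinearMap.coe_injective
  refine hb.ext fun i => ?_
  fin_cases i
  · exact hB0.trans (dflow_eq_id hs _ hb.zero hb.lin_zero _).symm
  · exact hB1.trans (dflow_eq_id hs _ hb.zero hb.lin_one _).symm
  · exact hB2.trans hrot.1.symm
  · refine hB3.trans (Eq.trans ?_ hrot.2.symm)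
    abel

include hs hi heff hvol huv hz hb in
/-- The circle action transversal to the stabiliser of a rod is free on the rod. -/
theorem IsRodFrame.eq_mul_of_flow_eq_self {t : ℝ} (ht : flow (realVec u) t p = p) :
    ∃ k : ℤ, t = k * (2 * Real.pi) := by
  obtain ⟨s, hs'⟩ := hb.dflow_eq hs hi heff hvol e huv hz ht
  obtain ⟨m, k, hm, hk⟩ := exists_nat_mul_period hs hb.killE_ne_zero ht
  obtain ⟨l, hl⟩ := hb.exists_int hs
  have hπ := Real.pi_pos
  have hmt : m • angles (realVec u 0 * t) (realVec u 1 * t) = 0 := by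
    rw [nsmul_angles, angles_eq_zero_iff]
    refine ⟨⟨u 0 * k, ?_⟩, ⟨u 1 * k, ?_⟩⟩ <;> simp only [realVec] <;> push_cast
    · linear_combination (u 0 : ℝ) * hk
    · linear_combination (u 1 : ℝ) * hk
  have hsp : flow (realVec v) s p = p := flow_eq_self_of_killE_eq_zero hs hb.zero s
  have hBm : dflow (realVec u) t p ^ m = ContinuousLinearMap.id ℝ E4 := by
    have := dact_nsmul hs (b := angles (realVec u 0 * t) (realVec u 1 * t)) ht m
    rw [hmt, dact_zero] at this
    exact this.symm
  have hms : dflow (realVec v) (m * s) p = ContinuousLinearMap.id ℝ E4 := by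
    rw [← hBm, hs', dflow, dflow, ← dact_nsmul hs hsp, nsmul_angles]
    congr 2 <;> ring
  obtain ⟨j, hj⟩ : ∃ j : ℤ, κ * (m * s) = j * (2 * Real.pi) := by
    have hrot := (dflow_rotation hs (realVec v) hb.zero hb.lin_two hb.lin_three (m * s)).1
    rw [hms] at hrot
    have h2 := congrArg (met p (b 2)) hrot
    rw [met_add_right, met_smul_right, met_smul_right, ContinuousLinearMap.id_apply, hb.ortho,
      hb.ortho] at h2
    simp at h2
    obtain ⟨j, hj⟩ := (Real.cos_eq_one_iff _).1 h2.symm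
    exact ⟨j, hj.symm⟩
  have hl0 : 0 < l := by
    have := hb.pos
    rw [hl] at this
    exact_mod_cast this
  obtain ⟨l', rfl⟩ := Int.eq_ofNat_of_zero_le hl0.le
  have hl' : l' ≠ 0 := by
    rintro rfl
    simp at hl0
  have h0 : angles (realVec u 0 * t + -(realVec v 0 * s)) (realVec u 1 * t + -(realVec v 1 * s))
      = 0 := by
    have hneg : angles (-(realVec v 0 * s)) (-(realVec v 1 * s)) =
        angles (realVec v 0 * -s) (realVec v 1 * -s) := by congr 1 <;> ring
    have hsp' : flow (realVec v) (-s) p = p := flow_eq_self_of_killE_eq_zero hs hb.zero (-s)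
    rw [angles_add, hneg]
    refine eq_zero_of_dact_eq_id hs heff (n := l' * m) (p := p) (mul_ne_zero hl' hm) ?_ ?_ ?_
    · rw [smul_add, mul_smul, hmt, smul_zero, zero_add, nsmul_angles, angles_eq_zero_iff]
      rw [hl] at hj
      refine ⟨⟨-(v 0 * j), ?_⟩, ⟨-(v 1 * j), ?_⟩⟩ <;> simp only [realVec] <;> push_cast at hj ⊢
      · linear_combination -(v 0 : ℝ) * hj
      · linear_combination -(v 1 : ℝ) * hj
    · rw [add_vadd]
      exact (congrArg (angles (realVec u 0 * t) (realVec u 1 * t) +ᵥ ·) hsp').trans ht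
    · have h1 : dflow (realVec v) s p ∘L dflow (realVec v) (-s) p =
          ContinuousLinearMap.id ℝ E4 := by
        rw [← dflow_add hs _ hb.zero, add_neg_cancel, dflow_zero]
      rw [dact_add hs]
      have h2 : angles (realVec v 0 * -s) (realVec v 1 * -s) +ᵥ p = p := hsp'
      rw [h2]
      exact (congrArg (fun A : E4 →L[ℝ] E4 => A ∘L dflow (realVec v) (-s) p) hs').trans h1
  rw [angles_eq_zero_iff] at h0
  obtain ⟨⟨a, ha⟩, c, hc⟩ := h0
  refine ⟨v 1 * a - v 0 * c, ?_⟩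
  have hd := det_real huv
  simp only [realVec] at ha hc
  push_cast
  linear_combination (v 1 : ℝ) * ha - (v 0 : ℝ) * hc - t * hd

end Free

section Tubes

variable {Q : Type*} [TopologicalSpace Q] {f : Q → ℝ}

/-- An open set which a function identifies with an interval. -/
structure IsTube (f : Q → ℝ) (A : Set Q) : Prop where
  isOpen : IsOpen A
  injOn : InjOn f A
  preconnected : IsPreconnected (f '' A)

variable [T2Space Q] (ho : IsOpenMap f)
include ho

theorem IsTube.eq_of_eq {A B : Set Q} (hA : IsTube f A) (hB : IsTube f B) (hAB : (A ∩ B).Nonempty)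
    {a b : Q} (ha : a ∈ A) (hb : b ∈ B) (hab : f a = f b) : a = b := by
  have hI : IsPreconnected (f '' A ∩ f '' B) :=
    (hA.preconnected.ordConnected.inter hB.preconnected.ordConnected).isPreconnected
  by_contra hne
  let W : Set ℝ := ⋃ (U : Set Q) (V : Set Q) (_ : IsOpen U ∧ IsOpen V ∧ Disjoint U V),
    f '' (A ∩ U) ∩ f '' (B ∩ V)
  have hW : IsOpen W := isOpen_iUnion fun U => isOpen_iUnion fun V => isOpen_iUnion fun h =>
    (ho _ (hA.isOpen.inter h.1)).inter (ho _ (hB.isOpen.inter h.2.1))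
  have hmemW {a b : Q} (ha : a ∈ A) (hb : b ∈ B) (hab : f a = f b) (hne : a ≠ b) : f a ∈ W := by
    obtain ⟨U, V, hU, hV, haU, hbV, hd⟩ := t2_separation hne
    exact mem_iUnion.2 ⟨U, mem_iUnion.2 ⟨V, mem_iUnion.2 ⟨⟨hU, hV, hd⟩, ⟨a, ⟨ha, haU⟩, rfl⟩,
      ⟨b, ⟨hb, hbV⟩, hab.symm⟩⟩⟩⟩
  obtain ⟨w, hwA, hwB⟩ := hAB
  obtain ⟨s, -, ⟨c, hc, hcs⟩, hsW⟩ := hI (f '' (A ∩ B)) W (ho _ (hA.isOpen.inter hB.isOpen)) hW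
    (by
      rintro s ⟨⟨a, ha, rfl⟩, b, hb, hab⟩
      by_cases h : a = b
      · exact Or.inl ⟨a, ⟨ha, h ▸ hb⟩, rfl⟩
      · exact Or.inr (hmemW ha hb hab.symm h))
    ⟨f w, ⟨⟨w, hwA, rfl⟩, w, hwB, rfl⟩, w, ⟨hwA, hwB⟩, rfl⟩
    ⟨f a, ⟨⟨a, ha, rfl⟩, b, hb, hab.symm⟩, hmemW ha hb hab hne⟩
  simp only [W, mem_iUnion] at hsW
  obtain ⟨U, V, ⟨-, -, hd⟩, ⟨a', ⟨ha', haU⟩, has⟩, b', ⟨hb', hbV⟩, hbs⟩ := hsW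
  have e1 : a' = c := hA.injOn ha' hc.1 (has.trans hcs.symm)
  have e2 : b' = c := hB.injOn hb' hc.2 (hbs.trans hcs.symm)
  exact disjoint_left.1 hd (e1 ▸ haU) (e2 ▸ hbV)

theorem IsTube.union {A B : Set Q} (hA : IsTube f A) (hB : IsTube f B)
    (hAB : (A ∩ B).Nonempty) : IsTube f (A ∪ B) where
  isOpen := hA.isOpen.union hB.isOpen
  injOn := by
    rintro a (ha | ha) b (hb | hb) hab
    · exact hA.injOn ha hb hab
    · exact hA.eq_of_eq ho hB hAB ha hb hab
    · exact (hA.eq_of_eq ho hB hAB hb ha hab.symm).symm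
    · exact hB.injOn ha hb hab
  preconnected := by
    obtain ⟨w, hwA, hwB⟩ := hAB
    rw [image_union]
    exact hA.preconnected.union (f w) ⟨w, hwA, rfl⟩ ⟨w, hwB, rfl⟩ hB.preconnected

theorem exists_isTube (hc : Continuous f) (hloc : ∀ x, ∃ U ∈ 𝓝 x, InjOn f U) (x : Q) :
    ∃ A, IsTube f A ∧ x ∈ A := by
  obtain ⟨U, hU, hinj⟩ := hloc x
  obtain ⟨V, hVU, hV, hxV⟩ := mem_nhds_iff.1 hU
  obtain ⟨ε, hε, hball⟩ := Metric.isOpen_iff.1 (ho V hV) (f x) ⟨x, hxV, rfl⟩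
  have himg : f '' (V ∩ f ⁻¹' Metric.ball (f x) ε) = Metric.ball (f x) ε := by
    rw [image_inter_preimage, inter_eq_right]
    exact hball
  refine ⟨V ∩ f ⁻¹' Metric.ball (f x) ε, ⟨hV.inter (Metric.isOpen_ball.preimage hc),
    (hinj.mono hVU).mono inter_subset_left, ?_⟩, hxV, Metric.mem_ball_self hε⟩
  rw [himg]
  exact (convex_ball _ _).isPreconnected

/-- A local homeomorphism of a connected Hausdorff space to the line is injective. -/
theorem injective_of_isOpenMap [PreconnectedSpace Q] (hc : Continuous f)
    (hloc : ∀ x, ∃ U ∈ 𝓝 x, InjOn f U) : Function.Injective f := by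
  intro x y hxy
  let T : Set Q := ⋃₀ {A | IsTube f A ∧ x ∈ A}
  have hTo : IsOpen T := isOpen_sUnion fun A hA => hA.1.isOpen
  have hTc : IsClosed T := by
    refine isClosed_of_closure_subset fun w hw => ?_
    obtain ⟨B, hB, hwB⟩ := exists_isTube ho hc hloc w
    obtain ⟨c, hcB, A, ⟨hA, hxA⟩, hcA⟩ := mem_closure_iff.1 hw B hB.isOpen hwB
    exact ⟨A ∪ B, ⟨hA.union ho hB ⟨c, hcA, hcB⟩, Or.inl hxA⟩, Or.inr hwB⟩
  have hxT : x ∈ T := by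
    obtain ⟨A, hA, hxA⟩ := exists_isTube ho hc hloc x
    exact ⟨A, ⟨hA, hxA⟩, hxA⟩
  have hT : T = univ := IsClopen.eq_univ ⟨hTc, hTo⟩ ⟨x, hxT⟩
  obtain ⟨A, ⟨hA, hxA⟩, hyA⟩ : y ∈ T := hT ▸ mem_univ y
  exact hA.injOn hxA hyA hxy

end Tubes

section RodSet

variable {M : Type*} [MetricSpace M] [ChartedSpace E4 M] [IsManifold (𝓡 4) ∞ M] [AddAction Torus M]

/-- The points at which the Killing field `v` vanishes and `u` does not. -/
def rodSet (M : Type*) [MetricSpace M] [ChartedSpace E4 M] [IsManifold (𝓡 4) ∞ M]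
    [AddAction Torus M] (u v : Fin 2 → ℤ) : Set M :=
  {q | killE (realVec v) q = 0 ∧ killE (realVec u) q ≠ 0}

/-- A connected component of the set of points over rods with rod vector `v`. -/
structure IsRod (u v : Fin 2 → ℤ) (S : Set M) : Prop where
  subset : S ⊆ rodSet M u v
  nonempty : S.Nonempty
  preconnected : IsPreconnected S
  maximal : ∀ T, IsPreconnected T → T ⊆ rodSet M u v → (T ∩ S).Nonempty → T ⊆ S

variable (hs : ContMDiff (𝓘(ℝ, ℝ × ℝ).prod (𝓡 4)) (𝓡 4) ∞
    (fun x : (ℝ × ℝ) × M => angles x.1.1 x.1.2 +ᵥ x.2))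
  {u v : Fin 2 → ℤ}

include hs in
theorem flow_mem_rodSet {q : M} (hq : q ∈ rodSet M u v) (t : ℝ) :
    flow (realVec u) t q ∈ rodSet M u v :=
  ⟨(killE_flow_eq_zero_iff hs _ _ _ _).2 hq.1, fun h => hq.2 ((killE_flow_eq_zero_iff hs _ _ _ _).1 h)⟩

include hs in
theorem IsRod.flow_mem {S : Set M} (hS : IsRod u v S) {q : M} (hq : q ∈ S) (t : ℝ) :
    flow (realVec u) t q ∈ S := by
  refine hS.maximal (range fun t => flow (realVec u) t q) ?_ ?_ ⟨q, ⟨0, flow_zero _ _⟩, hq⟩ ⟨t, rfl⟩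
  · exact isPreconnected_range (contMDiff_flow_left hs (realVec u) q).continuous
  · rintro _ ⟨t, rfl⟩
    exact flow_mem_rodSet hs (hS.subset hq) t

variable (huv : u 0 * v 1 - u 1 * v 0 = 1)

include hs huv in
theorem killE_eq_comb (c : Fin 2 → ℝ) (q : M) :
    killE c q = (c 0 * v 1 - c 1 * v 0) • killE (realVec u) q +
      (c 1 * u 0 - c 0 * u 1) • killE (realVec v) q := by
  have hd := det_real huv
  rw [killE_eq hs c, killE_eq hs (realVec u), killE_eq hs (realVec v)]
  simp only [realVec]
  match_scalars
  · linear_combination (-c 0) * hd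
  · linear_combination (-c 1) * hd

variable [RiemannianBundle (fun x : M => TangentSpace (𝓡 4) x)]

theorem gram_eq_zero_iff (q : M) :
    gram ![1, 0] ![0, 1] q = 0 ↔ killE ![1, 0] q = 0 ∧ killE ![0, 1] q = 0 := by
  have h00 : gram ![1, 0] ![0, 1] q 0 0 = met q (killE ![1, 0] q) (killE ![1, 0] q) := rfl
  have h11 : gram ![1, 0] ![0, 1] q 1 1 = met q (killE ![0, 1] q) (killE ![0, 1] q) := rfl
  have h01 : gram ![1, 0] ![0, 1] q 0 1 = met q (killE ![1, 0] q) (killE ![0, 1] q) := rfl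
  have h10 : gram ![1, 0] ![0, 1] q 1 0 = met q (killE ![0, 1] q) (killE ![1, 0] q) := rfl
  constructor
  · intro h
    rw [h] at h00 h11
    exact ⟨(met_self_eq_zero q).1 h00.symm, (met_self_eq_zero q).1 h11.symm⟩
  · rintro ⟨h1, h2⟩
    rw [h1, met_zero_left] at h00 h01
    rw [h2, met_zero_left] at h10 h11
    ext i j
    fin_cases i <;> fin_cases j
    · exact h00
    · exact h01
    · exact h10
    · exact h11

theorem _root_.Matrix.rank_eq_zero_iff {m n : Type*} [Fintype m] [Fintype n] [DecidableEq n]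
    (A : Matrix m n ℝ) : A.rank = 0 ↔ A = 0 := by
  rw [Matrix.rank, Submodule.finrank_eq_zero, LinearMap.range_eq_bot]
  exact ⟨fun h => Matrix.toLin'.injective (h.trans (map_zero _).symm), fun h => by simp [h]⟩

include hs huv in
theorem rodSet_subset_rankOneLocus : rodSet M u v ⊆ rankOneLocus M := by
  rintro q ⟨hv, hu⟩
  have h1 (c : Fin 2 → ℝ) : killE c q = (c 0 * v 1 - c 1 * v 0) • killE (realVec u) q := by
    rw [killE_eq_comb hs huv, hv, smul_zero, add_zero]
  obtain ⟨n, hn⟩ : ∃ n, n = met q (killE (realVec u) q) (killE (realVec u) q) := ⟨_, rfl⟩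
  have hg (c d : Fin 2 → ℝ) : met q (killE c q) (killE d q) =
      (c 0 * v 1 - c 1 * v 0) * ((d 0 * v 1 - d 1 * v 0) * n) := by
    rw [h1 c, h1 d, met_smul_left, met_smul_right, hn]
  have h2 : gram ![1, 0] ![0, 1] q = Matrix.vecMulVec ![(v 1 : ℝ), -v 0] ![v 1 * n, -v 0 * n] := by
    have h00 : gram ![1, 0] ![0, 1] q 0 0 = _ := hg ![1, 0] ![1, 0]
    have h11 : gram ![1, 0] ![0, 1] q 1 1 = _ := hg ![0, 1] ![0, 1]
    have h01 : gram ![1, 0] ![0, 1] q 0 1 = _ := hg ![1, 0] ![0, 1]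
    have h10 : gram ![1, 0] ![0, 1] q 1 0 = _ := hg ![0, 1] ![1, 0]
    ext i j
    fin_cases i <;> fin_cases j
    · exact h00.trans (by simp [Matrix.vecMulVec_apply])
    · exact h01.trans (by simp [Matrix.vecMulVec_apply])
    · exact h10.trans (by simp [Matrix.vecMulVec_apply])
    · exact h11.trans (by simp [Matrix.vecMulVec_apply])
  have h3 : (gram ![1, 0] ![0, 1] q).rank ≤ 1 := h2 ▸ Matrix.rank_vecMulVec_le _ _
  have h4 : (gram ![1, 0] ![0, 1] q).rank ≠ 0 := by
    rw [Ne, Matrix.rank_eq_zero_iff, gram_eq_zero_iff]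
    rintro ⟨h5, h6⟩
    exact hu (by rw [killE_eq hs, h5, h6, smul_zero, smul_zero, add_zero])
  show (gram ![1, 0] ![0, 1] q).rank = 1
  omega

include hs huv in
theorem IsFiniteRod.isRod {z : M → ℝ} {S : Set M} (hS : IsFiniteRod z S) (hv : IsRodVector S v) :
    IsRod u v S := by
  obtain ⟨⟨p, hp, rfl⟩, -⟩ := hS
  have hpS : p ∈ connectedComponentIn (rankOneLocus M) p := mem_connectedComponentIn hp
  refine ⟨fun q hq => ⟨hv.2 q hq, fun hu => ?_⟩, ⟨p, hpS⟩, isPreconnected_connectedComponentIn, ?_⟩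
  · have hr : (gram ![1, 0] ![0, 1] q).rank = 1 :=
      connectedComponentIn_subset (rankOneLocus M) p hq
    have hq0 : killE (realVec v) q = 0 := hv.2 q hq
    have h0 (c : Fin 2 → ℝ) : killE c q = 0 := by
      rw [killE_eq_comb hs huv, hq0, hu, smul_zero, smul_zero, add_zero]
    rw [(gram_eq_zero_iff q).2 ⟨h0 _, h0 _⟩, Matrix.rank_zero] at hr
    exact zero_ne_one hr
  · rintro T hT hTr ⟨x, hxT, hxS⟩
    rw [connectedComponentIn_eq hxS]
    exact hT.subset_connectedComponentIn hxT (hTr.trans (rodSet_subset_rankOneLocus hs huv))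

variable [IsContMDiffRiemannianBundle (𝓡 4) ∞ E4 (fun x : M => TangentSpace (𝓡 4) x)]
  [ConnectedSpace M]
  (hi : ∀ (a : Torus) (p : M) (X Y : TangentSpace (𝓡 4) p),
    inner ℝ (mfderiv (𝓡 4) (𝓡 4) (fun x : M => a +ᵥ x) p X)
      (mfderiv (𝓡 4) (𝓡 4) (fun x : M => a +ᵥ x) p Y) = inner ℝ X Y)
  (heff : ∀ a : Torus, (∀ p : M, a +ᵥ p = p) → a = 0)
variable {vol : ∀ p : M, TangentSpace (𝓡 4) p [⋀^Fin 4]→ₗ[ℝ] ℝ} (hvol : IsVolumeForm vol)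
  (e : AFEnd M) {z : M → ℝ} (hz : e.IsConjugate vol z)

include hs hi heff huv in
theorem exists_isRodFrame_of_mem {p : M} (hp : p ∈ rodSet M u v) :
    ∃ (b : Fin 4 → E4) (κ r : ℝ), IsRodFrame u v p b κ r := by
  refine exists_isRodFrame hs hi heff ?_ hp.1 hp.2
  rintro rfl
  simp at huv

include hs hi heff in
theorem countable_fixed [SecondCountableTopology M] :
    {q : M | killE ![1, 0] q = 0 ∧ killE ![0, 1] q = 0}.Countable := by
  let A := {q : M | killE ![1, 0] q = 0 ∧ killE ![0, 1] q = 0}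
  have hcl : IsClosed A := (isClosed_killE_eq_zero hs _).inter (isClosed_killE_eq_zero hs _)
  have h (x : M) : ∃ N ∈ 𝓝 x, ∀ q ∈ N, q ∈ A → q = x := by
    by_cases hx : x ∈ A
    · have := eventually_eq_of_fixed (p := x) hs hi heff (by rw [realVec_one_zero]; exact hx.1)
        (by rw [realVec_zero_one]; exact hx.2)
      rw [realVec_one_zero, realVec_zero_one] at this
      exact ⟨_, this, fun q hq hqA => hq hqA.1 hqA.2⟩
    · exact ⟨Aᶜ, hcl.isOpen_compl.mem_nhds hx, fun q hq hqA => (hq hqA).elim⟩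
  choose N hN hNA using h
  obtain ⟨s, hs, hsu⟩ := TopologicalSpace.countable_cover_nhds hN
  refine hs.mono fun q hq => ?_
  obtain ⟨x, hx, hqx⟩ := mem_iUnion₂.1 (hsu ▸ mem_univ q : q ∈ ⋃ x ∈ s, N x)
  exact hNA x q hqx hq ▸ hx

include hs hi heff hvol huv hz in
theorem exists_rod_section {p : M} (hp : p ∈ rodSet M u v) :
    ∃ (ε : ℝ) (γ : ℝ → M), 0 < ε ∧ γ (z p) = p ∧
      (∀ s ∈ Metric.ball (z p) ε, ContMDiffAt 𝓘(ℝ, ℝ) (𝓡 4) ∞ γ s ∧ z (γ s) = s ∧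
        γ s ∈ rodSet M u v) ∧
      ∀ᶠ q in 𝓝 p, q ∈ rodSet M u v →
        z q ∈ Metric.ball (z p) ε ∧ ∃ t, flow (realVec u) t (γ (z q)) = q := by
  obtain ⟨b, κ, r, hb⟩ := exists_isRodFrame_of_mem hs huv hi heff hp
  obtain ⟨γ, hγp, hγ, hq⟩ := hb.exists_section hs hi heff hvol e huv hz
  have hu : ∀ᶠ s in 𝓝 (z p), killE (realVec u) (γ s) ≠ 0 := by
    have h1 := hγ.self_of_nhds.1.continuousAt.tendsto
    rw [hγp] at h1
    exact h1.eventually ((isClosed_killE_eq_zero hs (realVec u)).isOpen_compl.mem_nhds hp.2)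
  obtain ⟨ε, hε, hball⟩ := Metric.eventually_nhds_iff_ball.1 (hγ.and hu)
  refine ⟨ε, γ, hε, hγp, fun s hs => ⟨(hball s hs).1.1, (hball s hs).1.2.1, (hball s hs).1.2.2,
    (hball s hs).2⟩, ?_⟩
  have hzt : Tendsto z (𝓝 p) (𝓝 (z p)) := hz.smooth.continuous.tendsto p
  filter_upwards [hq, hzt.eventually_mem (Metric.ball_mem_nhds _ hε)] with q h1 h2 h3
  exact ⟨h2, h1 h3.1⟩

include hs hi heff hvol huv hz in
/-- A connected neighbourhood of a point in the rod set. -/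
theorem exists_preconnected_nhds {p : M} (hp : p ∈ rodSet M u v) :
    ∃ T ⊆ rodSet M u v, IsPreconnected T ∧ p ∈ T ∧ ∀ᶠ q in 𝓝 p, q ∈ rodSet M u v → q ∈ T := by
  obtain ⟨ε, γ, hε, hγp, hγ, hq⟩ := exists_rod_section hs huv hi heff hvol e hz hp
  have hc : ContinuousOn (fun x : ℝ × ℝ => flow (realVec u) x.1 (γ x.2))
      (univ ×ˢ Metric.ball (z p) ε) := by
    refine (continuous_flow hs (realVec u)).comp_continuousOn (continuous_fst.continuousOn.prodMk ?_)
    exact ContinuousOn.comp (fun s hs => (hγ s hs).1.continuousAt.continuousWithinAt)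
      continuous_snd.continuousOn fun x hx => hx.2
  refine ⟨(fun x : ℝ × ℝ => flow (realVec u) x.1 (γ x.2)) '' (univ ×ˢ Metric.ball (z p) ε), ?_,
    (isPreconnected_univ.prod (convex_ball _ _).isPreconnected).image _ hc,
    ⟨(0, z p), ⟨mem_univ _, Metric.mem_ball_self hε⟩, by simp [hγp]⟩, ?_⟩
  · rintro _ ⟨x, hx, rfl⟩
    exact flow_mem_rodSet hs (hγ _ hx.2).2.2 _
  · filter_upwards [hq] with q h1 h2
    obtain ⟨h3, t, ht⟩ := h1 h2
    exact ⟨(t, z q), ⟨mem_univ _, h3⟩, ht⟩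

variable {S : Set M} (hS : IsRod u v S)
include hS hs hi heff hvol huv hz

theorem IsRod.mem_of_mem_closure {p : M} (hp : p ∈ closure S) (hpr : p ∈ rodSet M u v) : p ∈ S := by
  obtain ⟨T, hTr, hT, hpT, h⟩ := exists_preconnected_nhds hs huv hi heff hvol e hz hpr
  obtain ⟨q, hq, hqS⟩ := mem_closure_iff_nhds.1 hp _ h
  exact hS.maximal T hT hTr ⟨q, hq (hS.subset hqS), hqS⟩ hpT

theorem IsRod.closure_diff_subset :
    closure S \ S ⊆ {q : M | killE ![1, 0] q = 0 ∧ killE ![0, 1] q = 0} := by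
  rintro q ⟨hq, hqS⟩
  have hv : killE (realVec v) q = 0 :=
    closure_minimal (fun q hq => (hS.subset hq).1) (isClosed_killE_eq_zero hs (realVec v)) hq
  have hu : killE (realVec u) q = 0 := by
    by_contra hu
    exact hqS (hS.mem_of_mem_closure hs huv hi heff hvol e hz hq ⟨hv, hu⟩)
  constructor <;> rw [killE_eq_comb hs huv, hv, hu, smul_zero, smul_zero, add_zero]

/-- Local smooth sections of `z` over a rod. -/
theorem IsRod.exists_section {p : M} (hp : p ∈ S) :
    ∃ (ε : ℝ) (γ : ℝ → M), 0 < ε ∧ γ (z p) = p ∧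
      (∀ s ∈ Metric.ball (z p) ε, ContMDiffAt 𝓘(ℝ, ℝ) (𝓡 4) ∞ γ s ∧ z (γ s) = s ∧ γ s ∈ S) ∧
      ∀ᶠ q in 𝓝 p, q ∈ S → ∃ t, flow (realVec u) t (γ (z q)) = q := by
  obtain ⟨ε, γ, hε, hγp, hγ, hq⟩ :=
    exists_rod_section hs huv hi heff hvol e hz (hS.subset hp)
  refine ⟨ε, γ, hε, hγp, fun s hs => ⟨(hγ s hs).1, (hγ s hs).2.1, ?_⟩, ?_⟩
  · refine hS.maximal (γ '' Metric.ball (z p) ε) ?_ ?_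
      ⟨p, ⟨z p, Metric.mem_ball_self hε, hγp⟩, hp⟩ ⟨s, hs, rfl⟩
    · exact (convex_ball _ _).isPreconnected.image _
        fun s hs => (hγ s hs).1.continuousAt.continuousWithinAt
    · rintro _ ⟨s, hs, rfl⟩
      exact (hγ s hs).2.2
  · filter_upwards [hq] with q h1 h2
    exact (h1 (hS.subset h2)).2

theorem IsRod.isOpenMap : IsOpenMap fun q : S => z q := by
  rw [isOpenMap_iff_nhds_le]
  rintro ⟨p, hp⟩ W hW
  obtain ⟨N, hN, hNW⟩ := mem_nhds_subtype S _ _ |>.1 hW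
  obtain ⟨ε, γ, hε, hγp, hγ, -⟩ := hS.exists_section hs huv hi heff hvol e hz hp
  have h1 := (hγ _ (Metric.mem_ball_self hε)).1.continuousAt.tendsto
  rw [hγp] at h1
  filter_upwards [h1.eventually_mem hN, Metric.ball_mem_nhds (z p) hε] with s h2 h3
  have h4 : z (γ s) ∈ W := hNW (a := ⟨γ s, (hγ s h3).2.2⟩) h2
  rwa [(hγ s h3).2.1] at h4

theorem IsRod.isOpen_image : IsOpen (z '' S) := by
  have := (hS.isOpenMap hs huv hi heff hvol e hz).isOpen_range
  convert this using 1
  ext s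
  simp

/-- Over a rod, the orbits are parametrised by `z`. -/
theorem IsRod.exists_flow_eq {p q : M} (hp : p ∈ S) (hq : q ∈ S) (hpq : z p = z q) :
    ∃ t, flow (realVec u) t p = q := by
  let φ : ℝ → S → S := fun t x => ⟨flow (realVec u) t x, hS.flow_mem hs x.2 t⟩
  have hφ (t : ℝ) : Continuous (φ t) :=
    ((continuous_flow_right hs (realVec u) t).comp continuous_subtype_val).subtype_mk _
  let rel : Setoid S :=
    { r := fun x y => ∃ t, flow (realVec u) t (x : M) = y
      iseqv :=
        { refl := fun x => ⟨0, flow_zero _ _⟩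
          symm := by
            rintro x y ⟨t, ht⟩
            exact ⟨-t, by rw [← ht, ← flow_add, neg_add_cancel, flow_zero]⟩
          trans := by
            rintro x y w ⟨t, ht⟩ ⟨t', ht'⟩
            exact ⟨t' + t, by rw [flow_add, ht, ht']⟩ } }
  let pr : S → Quotient rel := Quotient.mk rel
  have hprc : Continuous pr := continuous_quotient_mk'
  have hprs : Function.Surjective pr := Quotient.mk_surjective
  have hpr {x y : S} : pr x = pr y ↔ ∃ t, flow (realVec u) t (x : M) = y := Quotient.eq
  have hpro : IsOpenMap pr := by
    intro V hV
    have : pr ⁻¹' (pr '' V) = ⋃ t, φ t ⁻¹' V := by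
      ext x
      simp only [mem_preimage, mem_image, mem_iUnion]
      constructor
      · rintro ⟨y, hy, hyx⟩
        obtain ⟨t, ht⟩ := hpr.1 hyx.symm
        refine ⟨t, ?_⟩
        have : φ t x = y := Subtype.ext ht
        rwa [this]
      · rintro ⟨t, ht⟩
        exact ⟨φ t x, ht, (hpr.2 ⟨t, rfl⟩).symm⟩
    have h2 : IsOpen (pr ⁻¹' (pr '' V)) := this ▸ isOpen_iUnion fun t => hV.preimage (hφ t)
    exact isQuotientMap_quotient_mk'.isOpen_preimage.1 h2
  let f : Quotient rel → ℝ := Quotient.lift (fun x : S => z x) (by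
    rintro x y ⟨t, ht⟩
    show z x = z y
    rw [← ht, flow_eq_of_killE_eq_zero hs hi heff hvol e huv hz (hS.subset x.2).1])
  have hf : Continuous f :=
    (hz.smooth.continuous.comp continuous_subtype_val).quotient_lift _
  have hfo : IsOpenMap f :=
    IsOpenMap.of_comp hprc hprs (hS.isOpenMap hs huv hi heff hvol e hz)
  have : PreconnectedSpace S := Subtype.preconnectedSpace hS.preconnected
  have : PreconnectedSpace (Quotient rel) := hprs.denseRange.preconnectedSpace hprc
  have : T2Space (Quotient rel) := by
    have hq : IsOpenQuotientMap pr := ⟨hprs, hprc, hpro⟩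
    rw [t2Space_iff_of_isOpenQuotientMap hq]
    have hcl : IsClosed {x : Icc 0 (2 * Real.pi) × (S × S) |
        flow (realVec u) x.1 (x.2.1 : M) = x.2.2} := by
      have h1 : Continuous fun x : Icc 0 (2 * Real.pi) × (S × S) => ((x.1 : ℝ), (x.2.1 : M)) := by
        fun_prop
      exact isClosed_eq ((continuous_flow hs (realVec u)).comp h1) (by fun_prop)
    convert isClosedMap_snd_of_compactSpace _ hcl using 1
    ext ⟨x, y⟩
    simp only [mem_image, Prod.exists, exists_eq_right]
    constructor
    · intro h
      obtain ⟨t, ht⟩ := hpr.1 h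
      have hper : Function.Periodic (fun t => flow (realVec u) t (x : M)) (2 * Real.pi) := by
        intro t
        dsimp only
        rw [flow_add, flow_two_pi]
      obtain ⟨t', ht', htt⟩ := hper.exists_mem_Ico₀ (by positivity) t
      exact ⟨⟨t', Ico_subset_Icc_self ht'⟩, htt.symm.trans ht⟩
    · rintro ⟨t, ht⟩
      exact hpr.2 ⟨t, ht⟩
  have hloc (x : Quotient rel) : ∃ U ∈ 𝓝 x, InjOn f U := by
    obtain ⟨⟨p, hp⟩, rfl⟩ := hprs x
    obtain ⟨ε, γ, hε, hγp, hγ, hq⟩ := hS.exists_section hs huv hi heff hvol e hz hp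
    refine ⟨pr '' (Subtype.val ⁻¹' {q | q ∈ S → ∃ t, flow (realVec u) t (γ (z q)) = q}),
      hpro.image_mem_nhds (continuous_subtype_val.continuousAt.preimage_mem_nhds hq), ?_⟩
    rintro _ ⟨a, ha, rfl⟩ _ ⟨b, hb, rfl⟩ hab
    obtain ⟨t, ht⟩ := ha a.2
    obtain ⟨t', ht'⟩ := hb b.2
    have hab : z a = z b := hab
    rw [hab] at ht
    refine hpr.2 ⟨t' - t, ?_⟩
    rw [← ht, ← flow_add, sub_add_cancel, ht']
  exact hpr.1 (injective_of_isOpenMap hfo hf hloc (a₁ := pr ⟨p, hp⟩) (a₂ := pr ⟨q, hq⟩) hpq)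

end RodSet

theorem eq_Ioo_of_isOpen {A : Set ℝ} (ho : IsOpen A) (hc : IsPreconnected A)
    (hb : Bornology.IsBounded A) : A = Ioo (sInf A) (sSup A) := by
  rcases A.eq_empty_or_nonempty with rfl | hne
  · simp
  refine Subset.antisymm (fun x hx => ⟨?_, ?_⟩) ?_
  · obtain ⟨ε, hε, hball⟩ := Metric.isOpen_iff.1 ho x hx
    have : x - ε / 2 ∈ A := hball (by
      rw [Metric.mem_ball, Real.dist_eq, abs_lt]; constructor <;> linarith)
    have := csInf_le hb.bddBelow this
    linarith
  · obtain ⟨ε, hε, hball⟩ := Metric.isOpen_iff.1 ho x hx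
    have : x + ε / 2 ∈ A := hball (by
      rw [Metric.mem_ball, Real.dist_eq, abs_lt]; constructor <;> linarith)
    have := le_csSup hb.bddAbove this
    linarith
  · exact IsConnected.Ioo_csInf_csSup_subset ⟨hne, hc⟩ hb.bddBelow hb.bddAbove

section Pieces

variable (x δ : ℕ → ℝ)

/-- The part of the `n`-th interval outside the closures of the preceding ones. -/
def piece (n : ℕ) : Set ℝ :=
  Metric.ball (x n) (δ n) \ ⋃ k ∈ Finset.range n, Metric.closedBall (x k) (δ k)

/-- The index of the first interval containing a number. -/
noncomputable def pieceIndex (s : ℝ) : ℕ := sInf {n | s ∈ Metric.ball (x n) (δ n)}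

theorem isOpen_piece (n : ℕ) : IsOpen (piece x δ n) := by
  refine Metric.isOpen_ball.sdiff ?_
  exact (Finset.range n).finite_toSet.isClosed_biUnion fun k _ => Metric.isClosed_closedBall

theorem pieceIndex_eq {n : ℕ} {s : ℝ} (hs : s ∈ piece x δ n) : pieceIndex x δ s = n := by
  refine le_antisymm (Nat.sInf_le hs.1) (le_csInf ⟨n, hs.1⟩ fun k hk => ?_)
  by_contra! h
  exact hs.2 (mem_biUnion (Finset.mem_coe.2 (Finset.mem_range.2 h)) (Metric.ball_subset_closedBall hk))

theorem mem_piece_or {s : ℝ} (h : ∃ n, s ∈ Metric.ball (x n) (δ n)) :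
    ∃ n, s ∈ piece x δ n ∨ s = x n + δ n ∨ s = x n - δ n := by
  classical
  have h' : ∃ n, s ∈ Metric.closedBall (x n) (δ n) :=
    h.imp fun n hn => Metric.ball_subset_closedBall hn
  refine ⟨Nat.find h', ?_⟩
  have h1 := Nat.find_spec h'
  by_cases hb : s ∈ Metric.ball (x (Nat.find h')) (δ (Nat.find h'))
  · left
    refine ⟨hb, fun hs => ?_⟩
    obtain ⟨k, hk, hks⟩ := mem_iUnion₂.1 hs
    exact Nat.find_min h' (Finset.mem_range.1 hk) hks
  · right
    rw [Metric.mem_closedBall, Real.dist_eq] at h1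
    rw [Metric.mem_ball, Real.dist_eq, not_lt] at hb
    rcases eq_or_eq_neg_of_abs_eq (le_antisymm h1 hb) with h2 | h2
    · left; linarith
    · right; linarith

end Pieces

section Charge

variable {M : Type*} [MetricSpace M] [ChartedSpace E4 M] [IsManifold (𝓡 4) ∞ M] [AddAction Torus M]
  [RiemannianBundle (fun x : M => TangentSpace (𝓡 4) x)]
  [IsContMDiffRiemannianBundle (𝓡 4) ∞ E4 (fun x : M => TangentSpace (𝓡 4) x)]
  [ConnectedSpace M] [SecondCountableTopology M]
  (hs : ContMDiff (𝓘(ℝ, ℝ × ℝ).prod (𝓡 4)) (𝓡 4) ∞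
    (fun x : (ℝ × ℝ) × M => angles x.1.1 x.1.2 +ᵥ x.2))
  {u v : Fin 2 → ℤ} (huv : u 0 * v 1 - u 1 * v 0 = 1)
  (hi : ∀ (a : Torus) (p : M) (X Y : TangentSpace (𝓡 4) p),
    inner ℝ (mfderiv (𝓡 4) (𝓡 4) (fun x : M => a +ᵥ x) p X)
      (mfderiv (𝓡 4) (𝓡 4) (fun x : M => a +ᵥ x) p Y) = inner ℝ X Y)
  (heff : ∀ a : Torus, (∀ p : M, a +ᵥ p = p) → a = 0)
  {vol : ∀ p : M, TangentSpace (𝓡 4) p [⋀^Fin 4]→ₗ[ℝ] ℝ} (hvol : IsVolumeForm vol)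
  (e : AFEnd M) {z : M → ℝ} (hz : e.IsConjugate vol z) {S : Set M} (hS : IsRod u v S)

include hS hs hi heff hvol huv hz

omit [SecondCountableTopology M] in
/-- A countable family of sections of `z` over a rod. -/
theorem IsRod.exists_sections : ∃ (x δ : ℕ → ℝ) (γ : ℕ → ℝ → M), (∀ n, 0 < δ n) ∧
    (∀ n, ∀ s ∈ Metric.closedBall (x n) (δ n),
      ContMDiffAt 𝓘(ℝ, ℝ) (𝓡 4) ∞ (γ n) s ∧ z (γ n s) = s ∧ γ n s ∈ S) ∧
    ∀ s ∈ z '' S, ∃ n, s ∈ Metric.ball (x n) (δ n) := by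
  have h (s : ℝ) (hs' : s ∈ z '' S) : ∃ (δ : ℝ) (γ : ℝ → M), 0 < δ ∧
      ∀ s' ∈ Metric.closedBall s δ, ContMDiffAt 𝓘(ℝ, ℝ) (𝓡 4) ∞ γ s' ∧ z (γ s') = s' ∧ γ s' ∈ S := by
    obtain ⟨p, hp, rfl⟩ := hs'
    obtain ⟨ε, γ, hε, -, hγ, -⟩ := hS.exists_section hs huv hi heff hvol e hz hp
    refine ⟨ε / 2, γ, by positivity, fun s' hs' => hγ s' ?_⟩
    exact Metric.closedBall_subset_ball (by linarith) hs'
  choose! δ γ hδ hγ using h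
  obtain ⟨t, ht, htc, hcov⟩ := TopologicalSpace.countable_cover_nhdsWithin (s := z '' S)
    (f := fun s => Metric.ball s (δ s))
    fun s hs => mem_nhdsWithin_of_mem_nhds (Metric.ball_mem_nhds s (hδ s hs))
  have htne : t.Nonempty := by
    obtain ⟨p, hp⟩ := hS.nonempty
    obtain ⟨s, hs, -⟩ := mem_iUnion₂.1 (hcov ⟨p, hp, rfl⟩)
    exact ⟨s, hs⟩
  obtain ⟨x, rfl⟩ := htc.exists_eq_range htne
  refine ⟨x, fun n => δ (x n), fun n => γ (x n), fun n => hδ _ (ht ⟨n, rfl⟩),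
    fun n => hγ _ (ht ⟨n, rfl⟩), fun s hs => ?_⟩
  obtain ⟨_, ⟨n, rfl⟩, hn⟩ := mem_iUnion₂.1 (hcov hs)
  exact ⟨n, hn⟩

omit [SecondCountableTopology M] in
/-- The pull-backs of the orientation and of the charge density in rod coordinates. -/
theorem IsRod.pullback_eq {F : ℝ × ℝ → M} {q : ℝ × ℝ}
    (hF : ContMDiffAt 𝓘(ℝ, ℝ × ℝ) (𝓡 4) ∞ F q) (hq : F q ∈ S)
    (hzF : ∀ᶠ x in 𝓝 q, z (F x) = x.1) (hFt : ∀ t, F (q.1, t) = flow (realVec u) t (F (q.1, 0))) :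
    0 < pullback (boltOrientation z u) F q ∧
      pullback (hodgeStar vol (dFlat (killing (realVec v)))) F q = e.β / Real.pi := by
  obtain ⟨b, κ, r, hb⟩ := exists_isRodFrame_of_mem hs huv hi heff (hS.subset hq)
  obtain ⟨D, hD⟩ := exists_hasD hF
  have hU : D (0, 1) = killE (realVec u) (F q) := by
    have h1 : HasVel 𝓘(ℝ, ℝ × ℝ) (fun t : ℝ => (q.1, t)) q.2 (0, 1) :=
      hasVel_iff_hasDerivAt.2 ((hasDerivAt_const _ _).prodMk (hasDerivAt_id _))
    have h2 := hD.comp_hasVel h1 rfl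
    have h3 := hasVel_flow hs (realVec u) (F (q.1, 0)) q.2
    rw [← hFt] at h3
    have h4 : (F ∘ fun t : ℝ => (q.1, t)) = fun t => flow (realVec u) t (F (q.1, 0)) :=
      funext hFt
    rw [h4] at h2
    exact h2.unique h3
  have hX : dfun z (F q) (D (1, 0)) = 1 := by
    have h1 := (hasD_dfun (hz.smooth (F q))).comp hD rfl
    have h2 : HasD 𝓘(ℝ, ℝ × ℝ) 𝓘(ℝ, ℝ) (fun x : ℝ × ℝ => x.1) q (ContinuousLinearMap.fst ℝ ℝ ℝ) :=
      hasD_iff_hasFDerivAt.2 hasFDerivAt_fst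
    have h3 := h1.unique (h2.congr hzF)
    have := congrArg (fun A : ℝ × ℝ →L[ℝ] ℝ => A (1, 0)) h3
    exact this
  have hpull (α : ∀ p : M, TangentSpace (𝓡 4) p → TangentSpace (𝓡 4) p → ℝ) :
      pullback α F q = α (F q) (D (1, 0)) (killE (realVec u) (F q)) := by
    have e1 : (mfderiv 𝓘(ℝ, ℝ × ℝ) (𝓡 4) F q : ℝ × ℝ →L[ℝ] E4) (1, 0) = D (1, 0) :=
      congrArg (fun A : ℝ × ℝ →L[ℝ] E4 => A (1, 0)) hD.mfderiv_eq
    have e2 : (mfderiv 𝓘(ℝ, ℝ × ℝ) (𝓡 4) F q : ℝ × ℝ →L[ℝ] E4) (0, 1) =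
        killE (realVec u) (F q) :=
      (congrArg (fun A : ℝ × ℝ →L[ℝ] E4 => A (0, 1)) hD.mfderiv_eq).trans hU
    exact congrArg₂ (fun X Y : E4 => α (F q) X Y) e1 e2
  constructor
  · rw [hpull]
    show 0 < dfun z (F q) (D (1, 0)) * met (F q) (killE (realVec u) (F q)) (killE (realVec u) (F q))
      - dfun z (F q) (killE (realVec u) (F q)) * met (F q) (killE (realVec u) (F q)) (D (1, 0))
    rw [hX, hb.dfun_killE hs hvol e huv hz, zero_mul, sub_zero, one_mul]
    exact met_self_pos _ hb.killE_ne_zero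
  · rw [hpull]
    refine (hb.hodgeStar_eq hs hi hvol e huv hz (D (1, 0))).trans ?_
    rw [hX, mul_one]

theorem IsRod.hasCharge (hbd : Bornology.IsBounded (z '' S)) :
    HasCharge vol (realVec v) (bolt S) (boltOrientation z u) (2 * e.β * rodLength z S) := by
  obtain ⟨x, δ, γ, hδ, hγ, hcov⟩ := hS.exists_sections hs huv hi heff hvol e hz
  have hpi := Real.pi_pos
  let W : Set ℝ := ⋃ n, piece x δ n
  have hW : IsOpen W := isOpen_iUnion fun n => isOpen_piece x δ n
  have hpc {n : ℕ} {s : ℝ} (h : s ∈ piece x δ n) : s ∈ Metric.closedBall (x n) (δ n) :=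
    Metric.ball_subset_closedBall h.1
  obtain ⟨Γ, hΓ⟩ : ∃ Γ : ℝ → M, Γ = fun s => γ (pieceIndex x δ s) s := ⟨_, rfl⟩
  have hΓn {n : ℕ} {s : ℝ} (h : s ∈ piece x δ n) : Γ s = γ n s := by
    rw [hΓ]; simp only [pieceIndex_eq x δ h]
  have hΓs {s : ℝ} (h : s ∈ W) : ContMDiffAt 𝓘(ℝ, ℝ) (𝓡 4) ∞ Γ s ∧ z (Γ s) = s ∧ Γ s ∈ S := by
    obtain ⟨n, hn⟩ := mem_iUnion.1 h
    obtain ⟨h1, h2, h3⟩ := hγ n s (hpc hn)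
    rw [hΓn hn]
    refine ⟨h1.congr_of_eventuallyEq ?_, h2, h3⟩
    filter_upwards [(isOpen_piece x δ n).mem_nhds hn] with s' hs'
    exact hΓn hs'
  obtain ⟨F, hF⟩ : ∃ F : ℝ × ℝ → M, F = fun q => flow (realVec u) q.2 (Γ q.1) := ⟨_, rfl⟩
  let U : Set (ℝ × ℝ) := W ×ˢ Ioo 0 (2 * Real.pi)
  have hU : IsOpen U := hW.prod isOpen_Ioo
  have hzflow {q : M} (hq : q ∈ S) (t : ℝ) : z (flow (realVec u) t q) = z q :=
    flow_eq_of_killE_eq_zero hs hi heff hvol e huv hz (hS.subset hq).1 t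
  have hFsm {q : ℝ × ℝ} (hq : q ∈ U) : ContMDiffAt 𝓘(ℝ, ℝ × ℝ) (𝓡 4) ∞ F q := by
    have h1 : ContMDiffAt 𝓘(ℝ, ℝ × ℝ) (𝓘(ℝ, ℝ).prod (𝓡 4)) ∞ (fun q => (q.2, Γ q.1)) q := by
      refine ContMDiffAt.prodMk contDiff_snd.contMDiff.contMDiffAt ?_
      exact ContMDiffAt.comp q (hΓs hq.1).1 contDiff_fst.contMDiff.contMDiffAt
    rw [hF]
    exact (contMDiff_flow hs (realVec u)).contMDiffAt.comp q h1
  have hFS {q : ℝ × ℝ} (hq : q ∈ U) : F q ∈ S := by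
    rw [hF]; exact hS.flow_mem hs (hΓs hq.1).2.2 _
  have hzF {q : ℝ × ℝ} (hq : q ∈ U) : z (F q) = q.1 := by
    rw [hF]
    exact (hzflow (hΓs hq.1).2.2 _).trans (hΓs hq.1).2.1
  have hpull {q : ℝ × ℝ} (hq : q ∈ U) := hS.pullback_eq hs huv hi heff hvol e hz (hFsm hq) (hFS hq)
    (by filter_upwards [hU.mem_nhds hq] with q' hq' using hzF hq')
    (by intro t; rw [hF]; simp only [flow_zero])
  -- the exceptional values of `z`
  obtain ⟨E, hE⟩ : ∃ E : Set ℝ, E = range (fun n => x n + δ n) ∪ range fun n => x n - δ n := ⟨_, rfl⟩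
  have hEc : E.Countable := hE ▸ (countable_range _).union (countable_range _)
  have hWE : z '' S ⊆ W ∪ E := by
    intro s hs
    obtain ⟨n, h | h | h⟩ := mem_piece_or x δ (hcov s hs)
    · exact Or.inl (mem_iUnion.2 ⟨n, h⟩)
    · exact Or.inr (hE ▸ Or.inl ⟨n, h.symm⟩)
    · exact Or.inr (hE ▸ Or.inr ⟨n, h.symm⟩)
  have hWS : W ⊆ z '' S := fun s hs => ⟨Γ s, (hΓs hs).2.2, (hΓs hs).2.1⟩
  have hvolW : volume W = ENNReal.ofReal (rodLength z S) := by
    have h1 : volume W = volume (z '' S) := by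
      refine le_antisymm (measure_mono hWS) ((measure_mono hWE).trans ?_)
      refine (measure_union_le _ _).trans ?_
      rw [hEc.measure_zero, add_zero]
    have h2 := eq_Ioo_of_isOpen (hS.isOpen_image hs huv hi heff hvol e hz)
      (hS.preconnected.image _ hz.smooth.continuous.continuousOn) hbd
    rw [h1, h2, Real.volume_Ioo]
    rfl
  have hlen : 0 ≤ rodLength z S := by
    have := Real.sInf_le_sSup (z '' S) hbd.bddBelow hbd.bddAbove
    rw [rodLength]; linarith
  have hvolU : volume U = ENNReal.ofReal (rodLength z S * (2 * Real.pi)) := by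
    rw [Measure.volume_eq_prod, Measure.prod_prod, hvolW, Real.volume_Ioo, sub_zero,
      ENNReal.ofReal_mul hlen]
  have hconst : EqOn (fun _ => e.β / Real.pi)
      (pullback (hodgeStar vol (dFlat (killing (realVec v)))) F) U := fun q hq => (hpull hq).2.symm
  refine ⟨U, F, hU, fun q hq => (hFsm hq).contMDiffWithinAt, ?_, fun q hq => subset_closure (hFS hq),
    ?_, fun q hq => (hpull hq).1, ?_, ?_⟩
  · intro q hq q' hq' hqq
    have h1 : q.1 = q'.1 := by rw [← hzF hq, ← hzF hq', hqq]
    have h2 : flow (realVec u) (q.2 - q'.2) (Γ q.1) = Γ q.1 := by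
      have h3 : flow (realVec u) q.2 (Γ q.1) = flow (realVec u) q'.2 (Γ q.1) := by
        rw [hF] at hqq
        conv_rhs => rw [h1]
        exact hqq
      rw [sub_eq_neg_add, flow_add, h3, ← flow_add, neg_add_cancel, flow_zero]
    obtain ⟨b, κ, r, hb⟩ := exists_isRodFrame_of_mem hs huv hi heff (hS.subset (hΓs hq.1).2.2)
    obtain ⟨k, hk⟩ := hb.eq_mul_of_flow_eq_self hs hi heff hvol e huv hz h2
    have h4 := hq.2
    have h5 := hq'.2
    have hk0 : k = 0 := by
      have h6 : (k : ℝ) < 1 := by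
        by_contra! h
        nlinarith [h4.1, h4.2, h5.1, h5.2]
      have h7 : (-1 : ℝ) < k := by
        by_contra! h
        nlinarith [h4.1, h4.2, h5.1, h5.2]
      have h8 : k < 1 := by exact_mod_cast h6
      have h9 : -1 < k := by exact_mod_cast h7
      omega
    rw [hk0, Int.cast_zero, zero_mul, sub_eq_zero] at hk
    exact Prod.ext h1 hk
  · let P := {q : M | killE ![1, 0] q = 0 ∧ killE ![0, 1] q = 0}
    have hP : P.Countable := countable_fixed hs hi heff
    let c₁ : ℕ → ℝ → M := fun n t => γ n (x n + δ n * Real.sin t)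
    let c₂ : ℕ → ℝ → M := fun n t => flow (realVec u) t (γ n (x n + δ n))
    let c₃ : ℕ → ℝ → M := fun n t => flow (realVec u) t (γ n (x n - δ n))
    let 𝒞 : Set (ℝ → M) := (range c₁ ∪ range c₂) ∪ (range c₃ ∪ (fun q _ => q) '' P)
    have hCc : 𝒞.Countable := ((countable_range _).union (countable_range _)).union
      ((countable_range _).union (hP.image _))
    have hCs : ∀ c ∈ 𝒞, ContMDiff 𝓘(ℝ, ℝ) (𝓡 4) 1 c := by
      rintro c ((⟨n, rfl⟩ | ⟨n, rfl⟩) | (⟨n, rfl⟩ | ⟨q, -, rfl⟩))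
      · intro t
        have h1 : x n + δ n * Real.sin t ∈ Metric.closedBall (x n) (δ n) := by
          rw [Metric.mem_closedBall, Real.dist_eq, add_sub_cancel_left, abs_mul,
            abs_of_pos (hδ n)]
          exact mul_le_of_le_one_right (hδ n).le (Real.abs_sin_le_one t)
        have h2 : ContDiff ℝ ∞ fun t => x n + δ n * Real.sin t := by
          have := Real.contDiff_sin (n := ∞)
          fun_prop
        exact (ContMDiffAt.comp t (hγ n _ h1).1 h2.contMDiff.contMDiffAt).of_le (by simp)
      · exact (contMDiff_flow_left hs _ _).of_le (by simp)
      · exact (contMDiff_flow_left hs _ _).of_le (by simp)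
      · exact contMDiff_const
    obtain ⟨c, hc⟩ := hCc.exists_eq_range ⟨c₁ 0, Or.inl (Or.inl ⟨0, rfl⟩)⟩
    refine ⟨c, fun n => hCs _ (hc ▸ ⟨n, rfl⟩), fun q hq => ?_⟩
    suffices h : ∃ f ∈ 𝒞, q ∈ range f by
      obtain ⟨f, hf, hqf⟩ := h
      rw [hc] at hf
      obtain ⟨n, rfl⟩ := hf
      exact mem_iUnion.2 ⟨n, hqf⟩
    obtain ⟨hqc, hqF⟩ := hq
    by_cases hqS : q ∈ S
    swap
    · exact ⟨fun _ => q, Or.inr (Or.inr ⟨q, hS.closure_diff_subset hs huv hi heff hvol e hz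
        ⟨hqc, hqS⟩, rfl⟩), 0, rfl⟩
    have hball (n : ℕ) (r : ℝ) (hr : |r| ≤ δ n) : x n + r ∈ Metric.closedBall (x n) (δ n) := by
      rwa [Metric.mem_closedBall, Real.dist_eq, add_sub_cancel_left]
    obtain ⟨n, h | h | h⟩ := mem_piece_or x δ (hcov (z q) ⟨q, hqS, rfl⟩)
    · obtain ⟨h1, h2, h3⟩ := hγ n (z q) (hpc h)
      obtain ⟨t, ht⟩ := hS.exists_flow_eq hs huv hi heff hvol e hz h3 hqS h2
      have hper : Function.Periodic (fun t => flow (realVec u) t (γ n (z q))) (2 * Real.pi) := by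
        intro t
        dsimp only
        rw [flow_add, flow_two_pi]
      obtain ⟨t', ht', htt⟩ := hper.exists_mem_Ico₀ (by positivity) t
      have htq : flow (realVec u) t' (γ n (z q)) = q := htt.symm.trans ht
      rcases ht'.1.eq_or_lt with h0 | h0
      · refine ⟨c₁ n, Or.inl (Or.inl ⟨n, rfl⟩), Real.arcsin ((z q - x n) / δ n), ?_⟩
        have h4 := hpc h
        rw [Metric.mem_closedBall, Real.dist_eq, abs_le] at h4
        have h5 := hδ n
        show γ n (x n + δ n * Real.sin (Real.arcsin ((z q - x n) / δ n))) = q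
        rw [Real.sin_arcsin (by rw [le_div_iff₀ h5]; linarith) (by rw [div_le_iff₀ h5]; linarith),
          mul_div_cancel₀ _ h5.ne', add_sub_cancel]
        rwa [← h0, flow_zero] at htq
      · refine (hqF ⟨(z q, t'), ⟨mem_iUnion.2 ⟨n, h⟩, h0, ht'.2⟩, ?_⟩).elim
        rw [hF]
        simp only [hΓn h]
        exact htq
    · obtain ⟨h1, h2, h3⟩ := hγ n _ (hball n (δ n) (abs_of_pos (hδ n)).le)
      obtain ⟨t, ht⟩ := hS.exists_flow_eq hs huv hi heff hvol e hz h3 hqS (h2.trans h.symm)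
      exact ⟨c₂ n, Or.inl (Or.inr ⟨n, rfl⟩), t, ht⟩
    · obtain ⟨h1, h2, h3⟩ := hγ n _ (hball n (-δ n) (by rw [abs_neg, abs_of_pos (hδ n)]))
      obtain ⟨t, ht⟩ := hS.exists_flow_eq hs huv hi heff hvol e hz h3 hqS
        (h2.trans (h.trans (sub_eq_add_neg _ _)).symm)
      refine ⟨c₃ n, Or.inr (Or.inl ⟨n, rfl⟩), t, ?_⟩
      rw [← sub_eq_add_neg] at ht
      exact ht
  · refine IntegrableOn.congr_fun (integrableOn_const ?_) hconst hU.measurableSet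
    rw [hvolU]
    exact ENNReal.ofReal_ne_top
  · rw [← setIntegral_congr_fun hU.measurableSet hconst, setIntegral_const, Measure.real, hvolU,
      ENNReal.toReal_ofReal (by positivity), smul_eq_mul]
    field_simp

end Charge
end ToricInstanton

theorem mainTheorem9 {M : Type*} [MetricSpace M] [SecondCountableTopology M]
    [ChartedSpace ToricInstanton.E4 M] [IsManifold (𝓡 4) ∞ M]
    [RiemannianBundle (fun x : M => TangentSpace (𝓡 4) x)]
    [IsContMDiffRiemannianBundle (𝓡 4) ∞ ToricInstanton.E4 (fun x : M => TangentSpace (𝓡 4) x)]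
    [IsRiemannianManifold (𝓡 4) M] [AddAction ToricInstanton.Torus M]
    (_hM : ToricInstanton.IsToricGravitationalInstanton M) (e : ToricInstanton.AFEnd M)
    (vol : ∀ p : M, TangentSpace (𝓡 4) p [⋀^Fin 4]→ₗ[ℝ] ℝ)
    (_hvol : ToricInstanton.IsVolumeForm vol)
    (z : M → ℝ) (_hz : e.IsConjugate vol z)
    (S : Set M) (_hS : ToricInstanton.IsFiniteRod z S)
    (v : Fin 2 → ℤ) (_hv : ToricInstanton.IsRodVector S v)
    (u : Fin 2 → ℤ) (_hu : u 0 * v 1 - u 1 * v 0 = 1) :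
    ToricInstanton.HasCharge vol (fun i => (v i : ℝ)) (ToricInstanton.bolt S)
      (ToricInstanton.boltOrientation z u) (2 * e.β * ToricInstanton.rodLength z S) := by
  have := _hM.simplyConnected
  exact (ToricInstanton.IsFiniteRod.isRod _hM.smooth _hu _hS _hv).hasCharge _hM.smooth _hu
    _hM.isometric _hM.effective _hvol e _hz _hS.2
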